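/- Let $n\ge 1$ and $a\in(-1,1)$. Write $X=(x,y)\in\mathbb R^n\times\mathbb R$, $B_r=\{x\in\mathbb R^n:|x|<r\}$ and $\mathbb B_r^+=\{(x,y): |x|^2+y^2<r^2,\ y>0\}$. Let $B:\mathbb R^{(n+1)\times(n+1)}\to\mathbb R^{n+1}$ be a (constant) linear map with norm $|B|$, and let $\tilde V$ be an $(n+1)\times(n+1)$-matrix-valued function of class $C^1$ on $B_4\times[0,16)$ with finite norm $\|\tilde V\|_{C^1}$. Let $U$ be an $\mathbb R^{n+1}$-valued weak solution of the backward parabolic system $$y^a\partial_tU+\operatorname{div}(y^a\nabla U)-y^aB\nabla U=0\ \text{ in }\ \mathbb B_4^+\times[0,16),\qquad \lim_{y\to0^+}y^a\partial_yU=\tilde V\,U\ \text{ on }\ B_4\times[0,16),$$ where $\nabla=\nabla_X$ and $\operatorname{div}=\operatorname{div}_X$. This means that $U\in L^2(\mathbb B_4^+\times(0,16);y^a\,dX\,dt)$, that for every $r<4$ one has $U\in C([0,16);L^2(\mathbb B_r^+;y^adX))$ and the weak gradient satisfies $\nabla U\in L^2(\mathbb B_r^+\times(0,r^2);y^a\,dX\,dt)$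 (so that $U$ has a trace on $\{y=0\}$, which is in $L^2(B_r\times(0,r^2))$), and that for all $0\le t_1<t_2<16$ and all $\Phi\in C_0^\infty(\mathbb B_4\times\mathbb R;\mathbb R^{n+1})$, where $\mathbb B_4$ is the full ball $\{|X|<4\}$, $$\Big[\int_{\mathbb B_4^+}U\cdot\Phi\,y^adX\Big]_{t_1}^{t_2}-\int_{t_1}^{t_2}\!\!\int_{\mathbb B_4^+}\big(U\cdot\partial_t\Phi+\langle\nabla U,\nabla\Phi\rangle\big)y^a\,dX\,dt-\int_{t_1}^{t_2}\!\!\int_{B_4}(\tilde VU\cdot\Phi)|_{y=0}\,dx\,dt=\int_{t_1}^{t_2}\!\!\int_{\mathbb B_4^+}(B\nabla U)\cdot\Phi\,y^a\,dX\,dt .$$ Assume that $\int_{\mathbb B_1^+}|U(X,0)|^2y^adX>0$ and put $$\theta=\frac{\int_{\mathbb B_4^+\times[0,16)}|U|^2y^a\,dX\,dt}{\int_{\mathbb B_1^+}|U(X,0)|^2y^a\,dX}.$$ Then there is a constant $N>2$, depending only on $n$, $a$ and (upper bounds for) $|B|$ and $\|\tilde V\|_{C^1}$, such that $N\log(N\theta)\ge1$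 and, for all $0\le t\le\dfrac1{N\log(N\theta)}$, $$N\int_{\mathbb B_2^+}|U(X,t)|^2y^a\,dX\ \ge\ \int_{\mathbb B_1^+}|U(X,0)|^2y^a\,dX .$$ -/

import Mathlib

open MeasureTheory Set Filter Topology
open scoped ContDiff

noncomputable section

/-- The thin space `ℝⁿ`, with generic point `x`. -/
abbrev Thin (n : ℕ) := EuclideanSpace ℝ (Fin n)

/-- The thick space `ℝⁿ × ℝ`, with generic point `X = (x, y)`; `y` is the last coordinate. -/
abbrev Thick (n : ℕ) := EuclideanSpace ℝ (Fin (n + 1))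

/-- The space `ℝⁿ⁺¹` in which the unknown of the system takes its values. -/
abbrev Val (n : ℕ) := EuclideanSpace ℝ (Fin (n + 1))

/-- The space of `(n + 1) × (n + 1)` gradients `(∂_{x₁} U, …, ∂_{xₙ} U, ∂_y U)`, each entry being a
vector in `ℝⁿ⁺¹`, with the Frobenius norm and inner product. -/
abbrev Grad (n : ℕ) := PiLp 2 (fun _ : Fin (n + 1) => Val n)

/-- The coordinate `y` of `X = (x, y)`. -/
def yCoord {n : ℕ} (X : Thick n) : ℝ := X (Fin.last n)

/-- The point `(x, 0)` of the thick space. -/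
def thinPoint {n : ℕ} (x : Thin n) : Thick n :=
  WithLp.toLp 2 (Fin.snoc (α := fun _ => ℝ) (fun i => x i) 0)

/-- The upper half-ball `𝔹_r⁺ = {(x, y) : |x|² + y² < r², y > 0}`. -/
def halfBall (n : ℕ) (r : ℝ) : Set (Thick n) :=
  Metric.ball 0 r ∩ {X | 0 < yCoord X}

/-- The measure `y^a dX` on the half-ball `𝔹_r⁺`. -/
def weightMeasure (n : ℕ) (a r : ℝ) : Measure (Thick n) :=
  (volume.restrict (halfBall n r)).withDensity (fun X => ENNReal.ofReal (yCoord X ^ a))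

/-- The measure `y^a dX dt` on `𝔹_r⁺ × (s, t)`. -/
def weightMeasureTime (n : ℕ) (a r s t : ℝ) : Measure (Thick n × ℝ) :=
  (weightMeasure n a r).prod (volume.restrict (Ioo s t))

/-- The measure `dx dt` on `B_r × (s, t)`, where `B_r` is the ball of `ℝⁿ`. -/
def thinMeasureTime (n : ℕ) (r s t : ℝ) : Measure (Thin n × ℝ) :=
  (volume.restrict (Metric.ball (0 : Thin n) r)).prod (volume.restrict (Ioo s t))

/-- The spatial partial derivative of `f(X, t)` in the `i`-th coordinate of `X`. -/
def partialX {n : ℕ} {F : Type*} [NormedAddCommGroup F] [NormedSpace ℝ F]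
    (f : Thick n × ℝ → F) (i : Fin (n + 1)) (p : Thick n × ℝ) : F :=
  fderiv ℝ f p (EuclideanSpace.single i 1, 0)

/-- The time derivative of `f(X, t)`. -/
def partialT {n : ℕ} {F : Type*} [NormedAddCommGroup F] [NormedSpace ℝ F]
    (f : Thick n × ℝ → F) (p : Thick n × ℝ) : F :=
  fderiv ℝ f p (0, 1)

/-- The spatial gradient `∇_X Φ` of a smooth vector-valued function. -/
def gradX {n : ℕ} (Φ : Thick n × ℝ → Val n) (p : Thick n × ℝ) : Grad n :=
  WithLp.toLp 2 (fun i => partialX Φ i p)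

/-- `DU` is the weak spatial gradient of `U` in `𝔹₄⁺ × (0, 16)` and `T` is the trace of `U` on the
thin set `{y = 0}`. Both are characterized by integration by parts against smooth scalar functions
whose compact support may touch `{y = 0}`, so that a boundary term appears in the `y`-direction:
`∫ (∂_i ψ) U + ψ (∂_i U) = 0` for the tangential directions, and
`∫ (∂_y ψ) U + ψ (∂_y U) = - ∫_{y = 0} ψ T`. -/
def HasWeakGradientAndTrace {n : ℕ} (U : Thick n × ℝ → Val n)
    (DU : Thick n × ℝ → Grad n) (T : Thin n × ℝ → Val n) : Prop :=
  ∀ ψ : Thick n × ℝ → ℝ, ContDiff ℝ ∞ ψ → HasCompactSupport ψ →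
    tsupport ψ ⊆ Metric.ball 0 4 ×ˢ Ioo 0 16 →
    ∀ i : Fin (n + 1),
      ∫ p in halfBall n 4 ×ˢ Ioo (0 : ℝ) 16, (partialX ψ i p • U p + ψ p • DU p i) =
        if i = Fin.last n then
          - ∫ q in Metric.ball (0 : Thin n) 4 ×ˢ Ioo (0 : ℝ) 16, ψ (thinPoint q.1, q.2) • T q
        else 0

/-- Weak solutions `U` of the backward system
`y^a ∂_t U + div (y^a ∇U) - y^a B ∇U = 0` in `𝔹₄⁺ × [0, 16)`, with
`lim_{y → 0} y^a ∂_y U = V U` on `B₄ × [0, 16)`, with weak spatial gradient `DU` and trace `T` on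
`{y = 0}`. The function `U` lies in `L²(𝔹₄⁺ × (0, 16); y^a dX dt)` and, away from the lateral
boundary and the time `16`, in the energy class `C(L²(y^a dX)) ∩ L²(W^{1,2}(y^a dX))`; the system is
tested against smooth functions on every time interval `[t₁, t₂] ⊆ [0, 16)`. -/
structure IsWeakSolutionWith {n : ℕ} (a : ℝ) (B : Grad n →L[ℝ] Val n)
    (V : Thin n × ℝ → Val n →L[ℝ] Val n) (U : Thick n × ℝ → Val n)
    (DU : Thick n × ℝ → Grad n) (T : Thin n × ℝ → Val n) : Prop where
  memLp : MemLp U 2 (weightMeasureTime n a 4 0 16)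
  memLp_slice : ∀ r, 0 < r → r < 4 → ∀ t ∈ Ico (0 : ℝ) 16,
    MemLp (fun X => U (X, t)) 2 (weightMeasure n a r)
  continuous_time : ∀ r, 0 < r → r < 4 → ∀ t₀ ∈ Ico (0 : ℝ) 16,
    Tendsto (fun t => ∫ X, ‖U (X, t) - U (X, t₀)‖ ^ 2 ∂(weightMeasure n a r))
      (𝓝[Ico 0 16] t₀) (𝓝 0)
  memLp_gradient : ∀ r, 0 < r → r < 4 → MemLp DU 2 (weightMeasureTime n a r 0 (r ^ 2))
  memLp_trace : ∀ r, 0 < r → r < 4 → MemLp T 2 (thinMeasureTime n r 0 (r ^ 2))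
  weak_gradient : HasWeakGradientAndTrace U DU T
  weak_form : ∀ Φ : Thick n × ℝ → Val n, ContDiff ℝ ∞ Φ → HasCompactSupport Φ →
    tsupport Φ ⊆ Metric.ball 0 4 ×ˢ univ →
    ∀ t₁ t₂ : ℝ, 0 ≤ t₁ → t₁ < t₂ → t₂ < 16 →
      (∫ X, inner ℝ (U (X, t₂)) (Φ (X, t₂)) ∂(weightMeasure n a 4))
        - (∫ X, inner ℝ (U (X, t₁)) (Φ (X, t₁)) ∂(weightMeasure n a 4))
        - (∫ p, inner ℝ (U p) (partialT Φ p) ∂(weightMeasureTime n a 4 t₁ t₂))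
        - (∫ p, inner ℝ (DU p) (gradX Φ p) ∂(weightMeasureTime n a 4 t₁ t₂))
        - (∫ q, inner ℝ (V q (T q)) (Φ (thinPoint q.1, q.2)) ∂(thinMeasureTime n 4 t₁ t₂))
      = ∫ p, inner ℝ (B (DU p)) (Φ p) ∂(weightMeasureTime n a 4 t₁ t₂)

/-- `U` is a weak solution of the backward system with drift `B` and boundary potential `V`. -/
def IsWeakSolution {n : ℕ} (a : ℝ) (B : Grad n →L[ℝ] Val n)
    (V : Thin n × ℝ → Val n →L[ℝ] Val n) (U : Thick n × ℝ → Val n) : Prop :=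
  ∃ (DU : Thick n × ℝ → Grad n) (T : Thin n × ℝ → Val n), IsWeakSolutionWith a B V U DU T

/-- `V` is of class `C¹` on `B₄ × [0, 16)`, with `C¹` norm `sup |V| + sup |DV|` at most `K`. -/
def C1NormLE {n : ℕ} (V : Thin n × ℝ → Val n →L[ℝ] Val n) (K : ℝ) : Prop :=
  ContDiffOn ℝ 1 V (Metric.ball 0 4 ×ˢ Ico 0 16) ∧
    ∀ p ∈ Metric.ball (0 : Thin n) 4 ×ˢ Ico (0 : ℝ) 16,
      ∀ q ∈ Metric.ball (0 : Thin n) 4 ×ˢ Ico (0 : ℝ) 16,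
        ‖V p‖ + ‖fderivWithin ℝ V (Metric.ball 0 4 ×ˢ Ico 0 16) q‖ ≤ K

/-- The mass `∫_{𝔹_r⁺} |U(X, t)|² y^a dX`. -/
def mass {n : ℕ} (a : ℝ) (U : Thick n × ℝ → Val n) (r t : ℝ) : ℝ :=
  ∫ X, ‖U (X, t)‖ ^ 2 ∂(weightMeasure n a r)

/-- The ratio `θ = ∫_{𝔹₄⁺ × [0, 16)} |U|² y^a dX dt / ∫_{𝔹₁⁺} |U(X, 0)|² y^a dX`. -/
def massRatio {n : ℕ} (a : ℝ) (U : Thick n × ℝ → Val n) : ℝ :=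
  (∫ p, ‖U p‖ ^ 2 ∂(weightMeasureTime n a 4 0 16)) / mass a U 1 0

end

noncomputable section

open scoped ENNReal NNReal

/-! ### Coordinates on the thick space -/

/-! Because the system is backward, local energy is almost nondecreasing in time. Differentiating `∫
q²|U|² y^a` and using the equation produces `+2 ∫ q²|∇U|² y^a`. This gradient term absorbs the
drift, the terms containing `∇q`, and the boundary term: a trace inequality with an arbitrarily
small constant in front of the gradient controls the trace. What is left is the Caccioppoli
inequality `exists_caccioppoli`, in which only `U` and the cutoff appear.

The cutoff is then taken of the form `q = φ exp(μ t - (2 - t/T)(1 - η)² / (2κT))` on `0 ≤ t ≤ T`,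
with bumps `η` (equal to 1 on `𝔹₁`) and `φ` (supported in `𝔹₂`). The time derivative of the exponent
is `μ + (1 - η)²/(2κT²)`, while its squared gradient is at most `4(1 - η)²|∇η|²/(κ²T²)`. For large
`κ` the former dominates, so the only error comes from `∇φ`, on whose support `η = 0` and `q²` is of
size `e^{-1/(κT)}`. This is `exists_weighted_decay`. Testing with plateaus in time
(`le_add_of_forall_plateau`) turns it into a comparison of two time slices, and `exists_mass_bound`
follows: with `I` the total energy in the numerator of `θ`, the mass in `𝔹₁⁺` at time 0 is at most
`A` times the mass in `𝔹₂⁺` at time `t` plus `A e^{-c/T} I`, for all `0 ≤ t ≤ T ≤ 1`.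

With `T = 1/(N log(Nθ))` the exponential is at most `1/(Nθ)`, so the error is at most half of the
left side and is absorbed. That the logarithm is at least 1 comes from the same bound with `T = 1`,
integrated over `0 < t < 1`, which gives `θ ≥ 1/(2A)`.

The technical difficulty is that `U` has no time derivative and is not an admissible test function.
`exists_smooth_approx` replaces it by mollifications whose kernel is shifted upward in `y`, so that
it never crosses `{y = 0}`, and which are backward Steklov averages in time. The inequality `f · (f
- g) ≥ (|f|² - |g|²)/2` for difference quotients has exactly the sign that the energy estimate
needs. Both `a > -1` (integrability of `y^a`) and `a < 1` (integrability of `y^{-a}`, needed for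
traces) enter. -/

/-- The coordinate `y` as a continuous linear map. -/
def yCLM (n : ℕ) : Thick n →L[ℝ] ℝ := EuclideanSpace.proj (Fin.last n)

/-- The projection `(x, y) ↦ x` as a continuous linear map. -/
def thinProj (n : ℕ) : Thick n →L[ℝ] Thin n :=
  LinearMap.toContinuousLinearMap
    { toFun := fun X => WithLp.toLp 2 fun i => X i.castSucc
      map_add' := fun _ _ => rfl
      map_smul' := fun _ _ => rfl }

lemma yCLM_apply {n : ℕ} (X : Thick n) : yCLM n X = yCoord X := rfl

lemma thinProj_apply {n : ℕ} (X : Thick n) (i : Fin n) : thinProj n X i = X i.castSucc := rfl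

lemma continuous_yCoord {n : ℕ} : Continuous (yCoord : Thick n → ℝ) := (yCLM n).continuous

lemma measurable_yCoord {n : ℕ} : Measurable (yCoord : Thick n → ℝ) := continuous_yCoord.measurable

/-- The point `(x, y)` of the thick space. -/
def glue {n : ℕ} (x : Thin n) (y : ℝ) : Thick n :=
  WithLp.toLp 2 (Fin.snoc (α := fun _ => ℝ) (fun i => x i) y)

lemma glue_zero {n : ℕ} (x : Thin n) : glue x 0 = thinPoint x := rfl

@[simp] lemma yCoord_glue {n : ℕ} (x : Thin n) (y : ℝ) : yCoord (glue x y) = y := by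
  simp [yCoord, glue]

@[simp] lemma thinProj_glue {n : ℕ} (x : Thin n) (y : ℝ) : thinProj n (glue x y) = x := by
  ext i; simp [thinProj_apply, glue]

@[simp] lemma glue_proj {n : ℕ} (X : Thick n) : glue (thinProj n X) (yCoord X) = X := by
  ext i
  refine Fin.lastCases ?_ (fun i => ?_) i <;> simp [glue, yCoord, thinProj_apply]

lemma glue_eq_add {n : ℕ} (x : Thin n) (y : ℝ) :
    glue x y = thinPoint x + y • EuclideanSpace.single (Fin.last n) 1 := by
  ext i
  refine Fin.lastCases ?_ (fun i => ?_) i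
  · simp [glue, thinPoint]
  · simp [glue, thinPoint, (Fin.castSucc_lt_last i).ne]

lemma norm_glue_sq {n : ℕ} (x : Thin n) (y : ℝ) : ‖glue x y‖ ^ 2 = ‖x‖ ^ 2 + y ^ 2 := by
  rw [EuclideanSpace.norm_sq_eq, EuclideanSpace.norm_sq_eq, Fin.sum_univ_castSucc]
  simp [glue]

lemma norm_thinPoint {n : ℕ} (x : Thin n) : ‖thinPoint x‖ = ‖x‖ := by
  have := norm_glue_sq x 0
  rw [glue_zero] at this
  exact (sq_eq_sq₀ (norm_nonneg _) (norm_nonneg _)).1 (by simpa using this)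

lemma norm_thinProj_le {n : ℕ} (X : Thick n) : ‖thinProj n X‖ ≤ ‖X‖ := by
  have := norm_glue_sq (thinProj n X) (yCoord X)
  rw [glue_proj] at this
  exact abs_le_of_sq_le_sq' (by nlinarith [sq_nonneg (yCoord X)]) (norm_nonneg _) |>.2

lemma abs_yCoord_le {n : ℕ} (X : Thick n) : |yCoord X| ≤ ‖X‖ := by
  have := norm_glue_sq (thinProj n X) (yCoord X)
  rw [glue_proj] at this
  exact abs_le_of_sq_le_sq (by nlinarith [sq_nonneg ‖thinProj n X‖]) (norm_nonneg _)

lemma norm_le_thinProj_add_yCoord {n : ℕ} (X : Thick n) :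
    ‖X‖ ≤ ‖thinProj n X‖ + |yCoord X| := by
  have := norm_glue_sq (thinProj n X) (yCoord X)
  rw [glue_proj] at this
  refine abs_le_of_sq_le_sq' ?_ (by positivity) |>.2
  rw [this, ← sq_abs (yCoord X)]
  nlinarith [norm_nonneg (thinProj n X), abs_nonneg (yCoord X)]

lemma continuous_glue {n : ℕ} : Continuous fun p : Thin n × ℝ => glue p.1 p.2 := by
  have : (fun p : Thin n × ℝ => glue p.1 p.2) = fun p => WithLp.toLp 2 fun i =>
      Fin.lastCases (motive := fun _ => ℝ) p.2 (fun i => p.1 i) i := by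
    ext p i
    refine Fin.lastCases ?_ (fun i => ?_) i <;> simp [glue]
  rw [this]
  refine (PiLp.continuous_toLp 2 _).comp (continuous_pi fun i => ?_)
  refine Fin.lastCases ?_ (fun i => ?_) i
  · simpa using continuous_snd
  · simp only [Fin.lastCases_castSucc]; fun_prop

lemma continuous_thinPoint {n : ℕ} : Continuous (thinPoint : Thin n → Thick n) :=
  continuous_glue.comp (continuous_id.prodMk continuous_const)

/-- The identification `ℝⁿ × ℝ ≃ ℝⁿ⁺¹` of measurable spaces. -/
def glueEquiv (n : ℕ) : (Thin n × ℝ) ≃ᵐ Thick n where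
  toFun p := glue p.1 p.2
  invFun X := (thinProj n X, yCoord X)
  left_inv p := by simp
  right_inv X := by simp
  measurable_toFun := continuous_glue.measurable
  measurable_invFun := ((thinProj n).continuous.prodMk continuous_yCoord).measurable

lemma glueEquiv_apply {n : ℕ} (p : Thin n × ℝ) : glueEquiv n p = glue p.1 p.2 := rfl

lemma measurePreserving_glueEquiv (n : ℕ) :
    MeasurePreserving (glueEquiv n) (volume.prod volume) volume := by
  have h1 : MeasurePreserving (fun p : Thin n × ℝ => (p.2, (WithLp.ofLp p.1 : Fin n → ℝ)))
      (volume.prod volume) (volume.prod volume) := by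
    have := (MeasurePreserving.id (volume : Measure ℝ)).prod
      (PiLp.volume_preserving_ofLp (Fin n))
    exact this.comp Measure.measurePreserving_swap
  have h2 := (volume_preserving_piFinSuccAbove (fun _ : Fin (n + 1) => ℝ) (Fin.last n)).symm
  have h3 := (PiLp.volume_preserving_toLp (Fin (n + 1))).comp (h2.comp h1)
  have h4 : ⇑(glueEquiv n) = WithLp.toLp 2 ∘ (MeasurableEquiv.piFinSuccAbove
      (fun _ : Fin (n + 1) => ℝ) (Fin.last n)).symm ∘
      fun p : Thin n × ℝ => (p.2, (WithLp.ofLp p.1 : Fin n → ℝ)) := by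
    funext p
    ext i
    simp [glueEquiv_apply, glue, MeasurableEquiv.piFinSuccAbove]
  rw [h4]
  exact h3

lemma lintegral_thick {n : ℕ} {f : Thick n → ℝ≥0∞} (hf : Measurable f) :
    ∫⁻ X, f X = ∫⁻ x : Thin n, ∫⁻ y : ℝ, f (glue x y) := by
  rw [← (measurePreserving_glueEquiv n).lintegral_comp_emb (glueEquiv n).measurableEmbedding,
    lintegral_prod (fun p => f (glueEquiv n p)) (hf.comp (glueEquiv n).measurable).aemeasurable]
  rfl

/-! ### The weighted measures on the half-space -/

/-- The density `y^a` on the half-space `{y > 0}`, extended by zero. -/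
def yWeight (n : ℕ) (a : ℝ) (X : Thick n) : ℝ≥0∞ :=
  {X : Thick n | 0 < yCoord X}.indicator (fun X => ENNReal.ofReal (yCoord X ^ a)) X

/-- The measure `y^a dX` on the half-space `{y > 0}`. -/
def halfMeasure (n : ℕ) (a : ℝ) : Measure (Thick n) := volume.withDensity (yWeight n a)

/-- The measure `y^a dX dt` on `{y > 0} × ℝ`. -/
def halfMeasureTime (n : ℕ) (a : ℝ) : Measure (Thick n × ℝ) := (halfMeasure n a).prod volume

lemma measurableSet_upper (n : ℕ) : MeasurableSet {X : Thick n | 0 < yCoord X} :=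
  measurableSet_lt measurable_const measurable_yCoord

lemma measurableSet_halfBall (n : ℕ) (r : ℝ) : MeasurableSet (halfBall n r) :=
  Metric.isOpen_ball.measurableSet.inter (measurableSet_upper n)

lemma measurable_yWeight (n : ℕ) (a : ℝ) : Measurable (yWeight n a) :=
  (((measurable_yCoord.pow_const a).ennreal_ofReal)).indicator (measurableSet_upper n)

lemma yWeight_ne_top {n : ℕ} {a : ℝ} (X : Thick n) : yWeight n a X ≠ ⊤ := by
  unfold yWeight indicator; split_ifs <;> simp

instance (n : ℕ) (a : ℝ) : SigmaFinite (halfMeasure n a) :=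
  SigmaFinite.withDensity_of_ne_top' yWeight_ne_top

instance (n : ℕ) (a : ℝ) : SigmaFinite (halfMeasureTime n a) := by
  unfold halfMeasureTime; infer_instance

lemma halfMeasureTime_eq (n : ℕ) (a : ℝ) :
    halfMeasureTime n a = volume.withDensity fun p : Thick n × ℝ => yWeight n a p.1 := by
  rw [halfMeasureTime, halfMeasure, prod_withDensity_left (measurable_yWeight n a)]
  rfl

/-- With the condition `y > 0` moved into the density, all half-ball integrals become restrictions
of one fixed measure. -/
lemma weightMeasure_eq (n : ℕ) (a r : ℝ) :
    weightMeasure n a r = (halfMeasure n a).restrict (Metric.ball 0 r) := by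
  rw [weightMeasure, halfMeasure, restrict_withDensity Metric.isOpen_ball.measurableSet, halfBall,
    inter_comm, ← Measure.restrict_restrict (measurableSet_upper n),
    ← withDensity_indicator (measurableSet_upper n)]
  rfl

lemma weightMeasureTime_eq (n : ℕ) (a r s t : ℝ) : weightMeasureTime n a r s t =
    (halfMeasureTime n a).restrict (Metric.ball 0 r ×ˢ Ioo s t) := by
  rw [weightMeasureTime, weightMeasure_eq, Measure.prod_restrict, halfMeasureTime]

lemma thinMeasureTime_eq (n : ℕ) (r s t : ℝ) : thinMeasureTime n r s t =
    (volume : Measure (Thin n × ℝ)).restrict (Metric.ball 0 r ×ˢ Ioo s t) := by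
  rw [thinMeasureTime, Measure.prod_restrict]; rfl

lemma ae_halfMeasure_pos (n : ℕ) (a : ℝ) : ∀ᵐ X ∂(halfMeasure n a), 0 < yCoord X := by
  rw [halfMeasure, ae_withDensity_iff (measurable_yWeight n a)]
  refine ae_of_all _ fun X h => ?_
  by_contra hX
  exact h (indicator_of_notMem (by simpa using hX) _)

lemma ae_halfMeasureTime_pos (n : ℕ) (a : ℝ) :
    ∀ᵐ p ∂(halfMeasureTime n a), 0 < yCoord p.1 := by
  rw [halfMeasureTime_eq, ae_withDensity_iff (f := fun p : Thick n × ℝ => yWeight n a p.1)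
    ((measurable_yWeight n a).comp measurable_fst)]
  refine ae_of_all _ fun X h => ?_
  by_contra hX
  exact h (indicator_of_notMem (by simpa using hX) _)

/-- The density `y^a` is positive on `{y > 0}`. This transfers measurability from the weighted
measure to Lebesgue measure, with respect to which mollification is performed. -/
lemma volume_upper_absolutelyContinuous (n : ℕ) (a : ℝ) :
    (volume : Measure (Thick n × ℝ)).restrict {p | 0 < yCoord p.1} ≪ halfMeasureTime n a := by
  have hm : MeasurableSet {p : Thick n × ℝ | 0 < yCoord p.1} :=
    measurable_fst (measurableSet_upper n)
  rw [halfMeasureTime_eq]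
  refine (withDensity_absolutelyContinuous' (f := fun p : Thick n × ℝ => yWeight n a p.1)
    ((measurable_yWeight n a).comp measurable_fst).aemeasurable ?_).trans ?_
  · filter_upwards [ae_restrict_mem hm] with p hp
    simpa [yWeight, indicator, show 0 < yCoord p.1 from hp] using Real.rpow_pos_of_pos hp a
  · rw [← restrict_withDensity hm]
    exact Measure.restrict_le_self.absolutelyContinuous

lemma lintegral_rpow_Ioo {a : ℝ} (ha : -1 < a) {r : ℝ} (hr : 0 ≤ r) :
    ∫⁻ y in Ioo 0 r, ENNReal.ofReal (y ^ a) = ENNReal.ofReal (r ^ (a + 1) / (a + 1)) := by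
  have h1 : IntegrableOn (fun y : ℝ => y ^ a) (Ioo 0 r) := by
    have := (intervalIntegral.intervalIntegrable_rpow' (a := 0) (b := r) ha).1
    exact this.mono_set Ioo_subset_Ioc_self
  rw [← ofReal_integral_eq_lintegral_ofReal h1, ← integral_Ioc_eq_integral_Ioo,
    ← intervalIntegral.integral_of_le hr, integral_rpow (Or.inl ha), Real.zero_rpow (by linarith),
    sub_zero]
  filter_upwards [ae_restrict_mem measurableSet_Ioo] with y hy
  exact Real.rpow_nonneg hy.1.le _

/-- The upper half of the ball lies in `B_r × (0, r)`, and `y^a` is integrable at 0 because `a >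
-1`. -/
lemma halfMeasure_ball_lt_top {n : ℕ} {a : ℝ} (ha : -1 < a) (r : ℝ) :
    halfMeasure n a (Metric.ball 0 r) < ⊤ := by
  have hb : MeasurableSet (Metric.ball (0 : Thick n) r) := Metric.isOpen_ball.measurableSet
  rcases le_or_gt r 0 with hr | hr
  · simp [Metric.ball_eq_empty.2 hr]
  rw [halfMeasure, withDensity_apply _ hb, ← lintegral_indicator hb,
    lintegral_thick ((measurable_yWeight n a).indicator hb)]
  calc _ ≤ ∫⁻ x : Thin n, ∫⁻ y : ℝ, (Metric.ball (0 : Thin n) r).indicator 1 x *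
        (Ioo 0 r).indicator (fun y => ENNReal.ofReal (y ^ a)) y := by
        refine lintegral_mono fun x => lintegral_mono fun y => ?_
        by_cases h : glue x y ∈ Metric.ball (0 : Thick n) r
        · rw [indicator_of_mem h, mem_ball_zero_iff] at *
          have h1 := norm_thinProj_le (glue x y)
          have h2 := (le_abs_self _).trans (abs_yCoord_le (glue x y))
          simp only [thinProj_glue, yCoord_glue] at h1 h2
          rw [indicator_of_mem (by simpa using h1.trans_lt h)]
          by_cases hy : 0 < y
          · rw [indicator_of_mem (show y ∈ Ioo 0 r from ⟨hy, h2.trans_lt h⟩)]; simp [yWeight, indicator, hy]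
          · simp [yWeight, indicator, hy]
        · rw [indicator_of_notMem h]; exact zero_le
    _ < ⊤ := by
        have h1 : ∀ x, (Metric.ball (0 : Thin n) r).indicator (1 : Thin n → ℝ≥0∞) x ≠ ⊤ := by
          intro x; unfold indicator; split_ifs <;> simp
        simp_rw [fun x => lintegral_const_mul' (μ := (volume : Measure ℝ)) _
          ((Ioo 0 r).indicator fun y => ENNReal.ofReal (y ^ a)) (h1 x)]
        rw [lintegral_mul_const _ (measurable_one.indicator Metric.isOpen_ball.measurableSet),
          lintegral_indicator measurableSet_Ioo, lintegral_rpow_Ioo ha hr.le,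
          lintegral_indicator_one Metric.isOpen_ball.measurableSet]
        exact ENNReal.mul_lt_top measure_ball_lt_top ENNReal.ofReal_lt_top

lemma halfMeasureTime_lt_top_of_isBounded {n : ℕ} {a : ℝ} (ha : -1 < a) {s : Set (Thick n × ℝ)}
    (hs : Bornology.IsBounded s) : halfMeasureTime n a s < ⊤ := by
  obtain ⟨r, hr⟩ := hs.subset_ball 0
  refine (measure_mono hr).trans_lt ?_
  rw [show (0 : Thick n × ℝ) = (0, 0) from rfl, ← ball_prod_same, halfMeasureTime, Measure.prod_prod]
  exact ENNReal.mul_lt_top (halfMeasure_ball_lt_top ha r) measure_ball_lt_top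

lemma isFiniteMeasureOnCompacts_halfMeasureTime {n : ℕ} {a : ℝ} (ha : -1 < a) :
    IsFiniteMeasureOnCompacts (halfMeasureTime n a) :=
  ⟨fun _ hK => halfMeasureTime_lt_top_of_isBounded ha hK.isBounded⟩

/-! ### Mollification and approximation in weighted `L²` spaces -/

lemma lintegral_enorm_sq_eq {α F : Type*} [MeasurableSpace α] [NormedAddCommGroup F]
    (μ : Measure α) (f : α → F) : ∫⁻ x, ‖f x‖ₑ ^ 2 ∂μ = eLpNorm f 2 μ ^ 2 := by
  have := eLpNorm_nnreal_pow_eq_lintegral (f := f) (μ := μ) (p := 2) two_ne_zero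
  simp only [NNReal.coe_ofNat, ENNReal.rpow_ofNat, ENNReal.coe_ofNat] at this
  exact this.symm

lemma lintegral_mul_sq_le {α : Type*} [MeasurableSpace α] (μ : Measure α) {f g : α → ℝ≥0∞}
    (hf : AEMeasurable f μ) (hg : AEMeasurable g μ) :
    (∫⁻ x, f x * g x ∂μ) ^ 2 ≤ (∫⁻ x, f x ^ 2 ∂μ) * ∫⁻ x, g x ^ 2 ∂μ := by
  have h := ENNReal.lintegral_mul_le_Lp_mul_Lq μ Real.HolderConjugate.two_two hf hg
  calc _ ≤ _ := pow_le_pow_left₀ zero_le h 2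
    _ = _ := by
      rw [mul_pow, ← ENNReal.rpow_natCast, ← ENNReal.rpow_natCast, ← ENNReal.rpow_mul,
        ← ENNReal.rpow_mul]
      simp

/-- Cauchy–Schwarz after writing `k = k^{1/2} k^{1/2}`. In the applications `k` is a probability
kernel, the weight `y^{-a}`, or a product of the two. -/
lemma lintegral_mul_sq_le_weighted {α : Type*} [MeasurableSpace α] (μ : Measure α)
    {k f : α → ℝ≥0∞} (hk : AEMeasurable k μ) (hf : AEMeasurable f μ) :
    (∫⁻ x, k x * f x ∂μ) ^ 2 ≤ (∫⁻ x, k x ∂μ) * ∫⁻ x, k x * f x ^ 2 ∂μ := by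
  have h := lintegral_mul_sq_le μ (hk.pow_const (1 / 2 : ℝ)) ((hk.pow_const (1 / 2 : ℝ)).mul hf)
  have e1 : ∀ x : ℝ≥0∞, (x ^ (1 / 2 : ℝ)) ^ 2 = x := fun x => by
    rw [← ENNReal.rpow_natCast, ← ENNReal.rpow_mul]; simp
  simp only [Pi.mul_apply, mul_pow, e1, ← mul_assoc, ← sq] at h
  exact h

lemma ENNReal.add_add_sq_le (a b c : ℝ≥0∞) : (a + b + c) ^ 2 ≤ 9 * (a ^ 2 + b ^ 2 + c ^ 2) := by
  have h1 : a + b + c ≤ 3 * max (max a b) c := by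
    have : (3 : ℝ≥0∞) * max (max a b) c = max (max a b) c + max (max a b) c + max (max a b) c := by
      ring
    rw [this]
    gcongr <;> simp
  have h2 : max (max a b) c ^ 2 ≤ a ^ 2 + b ^ 2 + c ^ 2 := by
    rcases max_choice (max a b) c with h | h
    · rw [h]
      rcases max_choice a b with h | h <;> rw [h, add_assoc]
      · exact le_self_add
      · exact le_self_add.trans le_add_self
    · rw [h]; exact le_add_self
  calc _ ≤ (3 * max (max a b) c) ^ 2 := pow_le_pow_left₀ zero_le h1 2
    _ = 9 * max (max a b) c ^ 2 := by rw [mul_pow]; norm_num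
    _ ≤ _ := by gcongr

section Mollify

variable {G F : Type*} [NormedAddCommGroup G] [NormedSpace ℝ G] [FiniteDimensional ℝ G]
  [MeasureSpace G] [BorelSpace G] [(volume : Measure G).IsAddHaarMeasure]
  [NormedAddCommGroup F] [NormedSpace ℝ F]

/-- The average `∫ κ(q - p) f(q) dq` of `f` around `p`. -/
def mollify (κ : G → ℝ) (f : G → F) (p : G) : F := ∫ q, κ (q - p) • f q

omit [NormedSpace ℝ G] [FiniteDimensional ℝ G] [(volume : Measure G).IsAddHaarMeasure] in
lemma integrable_kernel_smul {κ : G → ℝ} (hκ : Continuous κ) (hs : HasCompactSupport κ)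
    {f : G → F} (hf : Integrable f) (p : G) : Integrable fun q => κ (q - p) • f q := by
  obtain ⟨C, hC⟩ := hκ.bounded_above_of_compact_support hs
  refine hf.bdd_smul C ?_ (ae_of_all _ fun q => hC _)
  exact (hκ.comp (continuous_id.sub continuous_const)).aestronglyMeasurable

omit [NormedSpace ℝ G] [FiniteDimensional ℝ G] in
lemma lintegral_kernel_sub (κ : G → ℝ≥0∞) (p : G) : ∫⁻ q, κ (q - p) = ∫⁻ q, κ q :=
  lintegral_sub_right_eq_self κ p

omit [NormedSpace ℝ G] [FiniteDimensional ℝ G] in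
lemma enorm_mollify_sub_sq_le {κ : G → ℝ} (hκ : Continuous κ) (hs : HasCompactSupport κ)
    (h0 : ∀ q, 0 ≤ κ q) (h1 : ∫⁻ q, ENNReal.ofReal (κ q) = 1) [CompleteSpace F] {f : G → F}
    (hf : Integrable f) (p : G) :
    ‖mollify κ f p - f p‖ₑ ^ 2 ≤ ∫⁻ q, ENNReal.ofReal (κ (q - p)) * ‖f q - f p‖ₑ ^ 2 := by
  have hc : Continuous fun q => κ (q - p) := hκ.comp (continuous_id.sub continuous_const)
  have hmass : ∫⁻ q, ENNReal.ofReal (κ (q - p)) = 1 := by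
    rw [lintegral_kernel_sub fun q => ENNReal.ofReal (κ q), h1]
  have hint : Integrable fun q => κ (q - p) :=
    hc.integrable_of_hasCompactSupport (hs.comp_homeomorph (Homeomorph.subRight p))
  have hint1 : ∫ q, κ (q - p) = 1 := by
    rw [integral_eq_lintegral_of_nonneg_ae (ae_of_all _ fun q => h0 _) hint.1, hmass]; rfl
  have he : mollify κ f p - f p = ∫ q, κ (q - p) • (f q - f p) := by
    simp_rw [smul_sub]
    rw [integral_sub (integrable_kernel_smul hκ hs hf p) (hint.smul_const _),
      integral_smul_const, hint1, one_smul]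
    rfl
  have hm : AEMeasurable fun q => ENNReal.ofReal (κ (q - p)) := hc.measurable.ennreal_ofReal.aemeasurable
  calc _ ≤ (∫⁻ q, ENNReal.ofReal (κ (q - p)) * ‖f q - f p‖ₑ) ^ 2 := by
        rw [he]
        refine pow_le_pow_left₀ zero_le ((enorm_integral_le_lintegral_enorm _).trans_eq ?_) 2
        refine lintegral_congr fun q => ?_
        rw [enorm_smul, Real.enorm_eq_ofReal (h0 _)]
    _ ≤ _ := by
        have := lintegral_mul_sq_le_weighted volume hm
          (f := fun q => ‖f q - f p‖ₑ) (hf.1.sub aestronglyMeasurable_const).enorm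
        rwa [hmass, one_mul] at this

/-- Density argument: `f` is close in `L²(W)` to a continuous compactly supported `g`, and `f(q) -
f(p)` is split through `g(q)` and `g(p)`. The bound on `∫ κ(q - p) W(p) dp` controls the term at
`q`, uniform continuity the middle term. The radius depends on `f`, `C` and `ε` only, not on the
kernel, which later allows the parameters of the kernel to be fixed one after another. -/
lemma exists_radius_mollify [CompleteSpace F] {W : G → ℝ≥0∞} (hW : Measurable W)
    [IsFiniteMeasureOnCompacts (volume.withDensity W)] [SFinite (volume.withDensity W)] {f : G → F}
    (hf2 : MemLp f 2 (volume.withDensity W)) (hf1 : Integrable f) (C : ℝ≥0) {ε : ℝ≥0∞}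
    (hε : ε ≠ 0) :
    ∃ r : ℝ, 0 < r ∧ ∀ κ : G → ℝ, Continuous κ → (∀ q, 0 ≤ κ q) →
      Function.support κ ⊆ Metric.ball 0 r → ∫⁻ q, ENNReal.ofReal (κ q) = 1 →
      (∀ q, ∫⁻ p, ENNReal.ofReal (κ (q - p)) ∂(volume.withDensity W) ≤ C * W q) →
      ∫⁻ p, ‖mollify κ f p - f p‖ₑ ^ 2 ∂(volume.withDensity W) ≤ ε := by
  have : ProperSpace G := FiniteDimensional.proper ℝ G
  have : SecondCountableTopology G := inferInstance
  set μ := (volume : Measure G).withDensity W with hμ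
  have hD : (9 * (C + 1) : ℝ≥0∞) ≠ ⊤ := by finiteness
  obtain ⟨η, hη0, hη⟩ : ∃ η : ℝ≥0∞, η ≠ 0 ∧ 9 * (C + 1) * η ^ 2 ≤ ε / 2 := by
    have ht : Tendsto (fun η : ℝ≥0∞ => 9 * (C + 1 : ℝ≥0∞) * η ^ 2) (𝓝[>] 0) (𝓝 0) := by
      have : Tendsto (fun η : ℝ≥0∞ => 9 * (C + 1 : ℝ≥0∞) * η ^ 2) (𝓝 0)
          (𝓝 (9 * (C + 1 : ℝ≥0∞) * 0 ^ 2)) :=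
        ENNReal.Tendsto.const_mul (ENNReal.Tendsto.pow tendsto_id) (Or.inr hD)
      simpa using this.mono_left nhdsWithin_le_nhds
    have hev := ht.eventually (ge_mem_nhds (ENNReal.half_pos hε))
    obtain ⟨η, h1, h2⟩ := (hev.and self_mem_nhdsWithin).exists
    exact ⟨η, (ne_of_gt h2), h1⟩
  obtain ⟨g, hgs, hgη, hgc, hg2⟩ := hf2.exists_hasCompactSupport_eLpNorm_sub_le (by simp) hη0
  -- The kernel radius will be at most 1, so `g(q) - g(p)` vanishes for `p` outside this
  -- neighbourhood whenever `κ(q - p) ≠ 0`.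
  set K := Metric.cthickening 1 (tsupport g) with hK
  have hKc : IsCompact K := hgs.isCompact.cthickening
  have hμK : μ K < ⊤ := hKc.measure_lt_top
  obtain ⟨s, hs0, hs⟩ : ∃ s : ℝ, 0 < s ∧ 9 * (ENNReal.ofReal s ^ 2 * μ K) ≤ ε / 2 := by
    have ht : Tendsto (fun s : ℝ => 9 * (ENNReal.ofReal s ^ 2 * μ K)) (𝓝[>] 0) (𝓝 0) := by
      have h1 : Tendsto (fun s : ℝ => ENNReal.ofReal s) (𝓝[>] 0) (𝓝 0) := by
        have := (ENNReal.continuous_ofReal.tendsto 0)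
        simp only [ENNReal.ofReal_zero] at this
        exact this.mono_left nhdsWithin_le_nhds
      have h2 := ENNReal.Tendsto.const_mul (a := 9) (ENNReal.Tendsto.mul_const
        (ENNReal.Tendsto.pow (n := 2) h1) (Or.inr hμK.ne)) (Or.inr (by simp))
      simpa using h2
    have hev := ht.eventually (ge_mem_nhds (ENNReal.half_pos hε))
    obtain ⟨s, h1, h2⟩ := (hev.and self_mem_nhdsWithin).exists
    exact ⟨s, h2, h1⟩
  obtain ⟨r, hr0, hr⟩ := Metric.uniformContinuous_iff.1
    (hgs.uniformContinuous_of_continuous hgc) s hs0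
  refine ⟨min r 1, by positivity, fun κ hκ h0 hsupp h1 hS => ?_⟩
  have hcs : HasCompactSupport κ := HasCompactSupport.of_support_subset_isCompact
    (isCompact_closedBall 0 (min r 1)) (hsupp.trans Metric.ball_subset_closedBall)
  set k : G → G → ℝ≥0∞ := fun p q => ENNReal.ofReal (κ (q - p)) with hk
  have hkm : Measurable (Function.uncurry k) :=
    (hκ.comp (continuous_snd.sub continuous_fst)).measurable.ennreal_ofReal
  have hkp : ∀ p, Measurable (k p) := fun p => hkm.of_uncurry_left
  have hmass : ∀ p, ∫⁻ q, k p q = 1 := fun p => by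
    rw [← h1]; exact lintegral_kernel_sub (fun q => ENNReal.ofReal (κ q)) p
  have hfg : AEStronglyMeasurable (fun q => f q - g q) volume :=
    hf1.1.sub hgc.aestronglyMeasurable
  have hnear : ∀ p q, k p q * ‖g q - g p‖ₑ ^ 2 ≤
      k p q * (K.indicator (fun _ => ENNReal.ofReal s ^ 2) p) := by
    intro p q
    by_cases hz : κ (q - p) = 0
    · simp [hk, hz]
    have hball := hsupp hz
    rw [mem_ball_zero_iff, ← dist_eq_norm] at hball
    gcongr
    by_cases hp : p ∈ K
    · rw [indicator_of_mem hp]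
      gcongr
      rw [← ofReal_norm, ← dist_eq_norm]
      exact ENNReal.ofReal_le_ofReal (hr (hball.trans_le (min_le_left _ _))).le
    · have hgp : g p = 0 := by
        by_contra h
        exact hp (Metric.self_subset_cthickening _ (subset_tsupport _ h))
      have hgq : g q = 0 := by
        by_contra h
        refine hp (Metric.mem_cthickening_of_dist_le p q 1 _ (subset_tsupport _ h) ?_)
        rw [dist_comm]; exact (hball.trans_le (min_le_right _ _)).le
      simp [hgp, hgq]
  have hpt : ∀ p, ‖mollify κ f p - f p‖ₑ ^ 2 ≤
      9 * ((∫⁻ q, k p q * ‖f q - g q‖ₑ ^ 2) + K.indicator (fun _ => ENNReal.ofReal s ^ 2) p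
        + ‖f p - g p‖ₑ ^ 2) := by
    intro p
    refine (enorm_mollify_sub_sq_le hκ hcs h0 h1 hf1 p).trans ?_
    have hm1 : AEMeasurable (fun q => k p q * ‖f q - g q‖ₑ ^ 2) volume :=
      (hkp p).aemeasurable.mul (hfg.enorm.pow_const 2)
    calc _ ≤ ∫⁻ q, 9 * (k p q * ‖f q - g q‖ₑ ^ 2
          + k p q * (K.indicator (fun _ => ENNReal.ofReal s ^ 2) p)
          + k p q * ‖f p - g p‖ₑ ^ 2) := by
          refine lintegral_mono fun q => ?_
          have h3 : ‖f q - f p‖ₑ ≤ ‖f q - g q‖ₑ + ‖g q - g p‖ₑ + ‖f p - g p‖ₑ := by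
            have : f q - f p = (f q - g q) + (g q - g p) - (f p - g p) := by abel
            rw [this]
            exact (enorm_sub_le).trans (by gcongr; exact enorm_add_le _ _)
          calc k p q * ‖f q - f p‖ₑ ^ 2 ≤ k p q * (9 * (‖f q - g q‖ₑ ^ 2 + ‖g q - g p‖ₑ ^ 2
                + ‖f p - g p‖ₑ ^ 2)) := by
                gcongr
                exact (pow_le_pow_left₀ zero_le h3 2).trans (ENNReal.add_add_sq_le _ _ _)
            _ = 9 * (k p q * ‖f q - g q‖ₑ ^ 2 + k p q * ‖g q - g p‖ₑ ^ 2
                + k p q * ‖f p - g p‖ₑ ^ 2) := by ring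
            _ ≤ _ := by
              have := hnear p q
              gcongr 9 * (_ + ?_ + _)
      _ = _ := by
          rw [lintegral_const_mul' _ _ (by simp), lintegral_add_right _ ((hkp p).mul_const _),
            lintegral_add_right _ ((hkp p).mul_const _), lintegral_mul_const _ (hkp p),
            lintegral_mul_const _ (hkp p), hmass, one_mul, one_mul]
  -- Tonelli moves the kernel onto the weight, where `hS` gives back `C W(q)`.
  have hfirst : ∫⁻ p, (∫⁻ q, k p q * ‖f q - g q‖ₑ ^ 2) ∂μ ≤ C * η ^ 2 := by
    rw [lintegral_lintegral_swap (hkm.aemeasurable.mul ((hfg.enorm.pow_const 2).comp_snd))]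
    calc _ ≤ ∫⁻ q, C * (W q * ‖f q - g q‖ₑ ^ 2) := by
          refine lintegral_mono fun q => ?_
          simp only
          rw [lintegral_mul_const _ hkm.of_uncurry_right, ← mul_assoc]
          gcongr
          exact hS q
      _ = C * ∫⁻ q, ‖f q - g q‖ₑ ^ 2 ∂μ := by
          rw [lintegral_const_mul' _ _ (by simp), hμ,
            lintegral_withDensity_eq_lintegral_mul₀ hW.aemeasurable (hfg.enorm.pow_const 2)]
          rfl
      _ ≤ _ := by
          rw [lintegral_enorm_sq_eq μ fun q => f q - g q]
          gcongr
          exact hgη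
  have hfgμ : AEStronglyMeasurable (fun q => f q - g q) μ := hf2.1.sub hg2.1
  calc _ ≤ ∫⁻ p, 9 * ((∫⁻ q, k p q * ‖f q - g q‖ₑ ^ 2)
          + K.indicator (fun _ => ENNReal.ofReal s ^ 2) p + ‖f p - g p‖ₑ ^ 2) ∂μ :=
        lintegral_mono hpt
    _ = 9 * ((∫⁻ p, (∫⁻ q, k p q * ‖f q - g q‖ₑ ^ 2) ∂μ) + ENNReal.ofReal s ^ 2 * μ K
          + ∫⁻ p, ‖f p - g p‖ₑ ^ 2 ∂μ) := by
        rw [lintegral_const_mul' _ _ (by simp), lintegral_add_right' _ (hfgμ.enorm.pow_const 2),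
          lintegral_add_right _ (measurable_const.indicator hKc.measurableSet),
          lintegral_indicator_const hKc.measurableSet]
    _ ≤ 9 * (C * η ^ 2 + ENNReal.ofReal s ^ 2 * μ K + η ^ 2) := by
        have : ∫⁻ p, ‖f p - g p‖ₑ ^ 2 ∂μ ≤ η ^ 2 := by
          rw [lintegral_enorm_sq_eq μ fun q => f q - g q]
          gcongr
          exact hgη
        gcongr
    _ = 9 * (C + 1) * η ^ 2 + 9 * (ENNReal.ofReal s ^ 2 * μ K) := by ring
    _ ≤ ε / 2 + ε / 2 := by gcongr
    _ = ε := ENNReal.add_halves ε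

end Mollify

/-! ### One-dimensional kernels -/

/-- A smooth step from `0` to `1` on `[0, δ]`. -/
def smoothStep (δ τ : ℝ) : ℝ := Real.smoothTransition (τ / δ)

/-- The derivative of the smooth step: a kernel supported in `[0, δ]`. -/
def stepKernel (δ τ : ℝ) : ℝ := deriv Real.smoothTransition (τ / δ) / δ

/-- A smooth version of the kernel `h⁻¹ 1_{[-h, 0]}`. -/
def boxKernel (δ h τ : ℝ) : ℝ := (smoothStep δ (τ + h) - smoothStep δ τ) / h

lemma contDiff_smoothTransition : ContDiff ℝ ∞ Real.smoothTransition :=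
  Real.smoothTransition.contDiff

lemma contDiff_deriv_smoothTransition : ContDiff ℝ ∞ (deriv Real.smoothTransition) :=
  contDiff_smoothTransition.iterate_deriv 1

lemma contDiff_smoothStep (δ : ℝ) : ContDiff ℝ ∞ (smoothStep δ) :=
  contDiff_smoothTransition.comp (contDiff_id.div_const δ)

lemma contDiff_stepKernel (δ : ℝ) : ContDiff ℝ ∞ (stepKernel δ) :=
  (contDiff_deriv_smoothTransition.comp (contDiff_id.div_const δ)).div_const δ

lemma contDiff_boxKernel (δ h : ℝ) : ContDiff ℝ ∞ (boxKernel δ h) :=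
  (((contDiff_smoothStep δ).comp (contDiff_id.add contDiff_const)).sub
    (contDiff_smoothStep δ)).div_const h

lemma hasDerivAt_smoothStep (δ τ : ℝ) : HasDerivAt (smoothStep δ) (stepKernel δ τ) τ := by
  have h1 : HasDerivAt Real.smoothTransition (deriv Real.smoothTransition (τ / δ)) (τ / δ) :=
    (contDiff_smoothTransition.differentiable (by simp)).differentiableAt.hasDerivAt
  have h2 := h1.comp τ ((hasDerivAt_id τ).div_const δ)
  rw [mul_one_div] at h2
  exact h2

lemma hasDerivAt_boxKernel (δ h τ : ℝ) :
    HasDerivAt (boxKernel δ h) ((stepKernel δ (τ + h) - stepKernel δ τ) / h) τ :=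
  ((hasDerivAt_smoothStep δ (τ + h)).comp_add_const τ h |>.sub
    (hasDerivAt_smoothStep δ τ)).div_const h

lemma smoothStep_of_nonpos {δ τ : ℝ} (hδ : 0 < δ) (hτ : τ ≤ 0) : smoothStep δ τ = 0 :=
  Real.smoothTransition.zero_of_nonpos (div_nonpos_of_nonpos_of_nonneg hτ hδ.le)

lemma smoothStep_of_ge {δ τ : ℝ} (hδ : 0 < δ) (hτ : δ ≤ τ) : smoothStep δ τ = 1 :=
  Real.smoothTransition.one_of_one_le ((one_le_div hδ).2 hτ)

lemma monotone_smoothStep {δ : ℝ} (hδ : 0 < δ) : Monotone (smoothStep δ) := fun _ _ h =>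
  Real.smoothTransition.monotone (by gcongr)

lemma stepKernel_nonneg {δ : ℝ} (hδ : 0 < δ) (τ : ℝ) : 0 ≤ stepKernel δ τ :=
  div_nonneg Real.smoothTransition.monotone.deriv_nonneg hδ.le

lemma deriv_smoothTransition_eq_zero {x : ℝ} (hx : x ∉ Icc (0 : ℝ) 1) :
    deriv Real.smoothTransition x = 0 := by
  rw [mem_Icc, not_and_or, not_le, not_le] at hx
  rcases hx with hx | hx
  · have : Real.smoothTransition =ᶠ[𝓝 x] fun _ => 0 := by
      filter_upwards [gt_mem_nhds hx] with y hy using Real.smoothTransition.zero_of_nonpos hy.le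
    rw [this.deriv_eq]; simp
  · have : Real.smoothTransition =ᶠ[𝓝 x] fun _ => 1 := by
      filter_upwards [lt_mem_nhds hx] with y hy using Real.smoothTransition.one_of_one_le hy.le
    rw [this.deriv_eq]; simp

lemma stepKernel_eq_zero {δ τ : ℝ} (hδ : 0 < δ) (hτ : τ ∉ Icc 0 δ) : stepKernel δ τ = 0 := by
  rw [stepKernel, deriv_smoothTransition_eq_zero, zero_div]
  contrapose! hτ
  rw [mem_Icc, div_le_one hδ] at hτ
  exact ⟨by simpa using (le_div_iff₀ hδ).1 hτ.1, hτ.2⟩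

lemma exists_stepKernel_le : ∃ M : ℝ, 0 ≤ M ∧ ∀ δ, 0 < δ → ∀ τ, stepKernel δ τ ≤ M / δ := by
  have hc : HasCompactSupport (deriv Real.smoothTransition) :=
    HasCompactSupport.of_support_subset_isCompact isCompact_Icc fun x hx => by
      by_contra h; exact hx (deriv_smoothTransition_eq_zero h)
  obtain ⟨M, hM⟩ := contDiff_deriv_smoothTransition.continuous.bounded_above_of_compact_support hc
  refine ⟨M, (norm_nonneg _).trans (hM 0), fun δ hδ τ => ?_⟩
  unfold stepKernel
  gcongr
  exact (le_abs_self _).trans (hM _)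

lemma lintegral_eq_one_of_Icc {f : ℝ → ℝ} (hf : Continuous f) (h0 : ∀ x, 0 ≤ f x) {c d : ℝ}
    (hcd : c ≤ d) (hs : ∀ x ∉ Icc c d, f x = 0) (h1 : ∫ x in c..d, f x = 1) :
    ∫⁻ x, ENNReal.ofReal (f x) = 1 := by
  have hcs : HasCompactSupport f := HasCompactSupport.of_support_subset_isCompact
    (isCompact_Icc (a := c) (b := d)) fun x hx => by by_contra h; exact hx (hs x h)
  rw [← ofReal_integral_eq_lintegral_ofReal (hf.integrable_of_hasCompactSupport hcs)
    (ae_of_all _ h0), ← setIntegral_eq_integral_of_forall_compl_eq_zero hs,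
    integral_Icc_eq_integral_Ioc, ← intervalIntegral.integral_of_le hcd, h1, ENNReal.ofReal_one]

lemma lintegral_stepKernel {δ : ℝ} (hδ : 0 < δ) : ∫⁻ τ, ENNReal.ofReal (stepKernel δ τ) = 1 := by
  refine lintegral_eq_one_of_Icc (contDiff_stepKernel δ).continuous (stepKernel_nonneg hδ) hδ.le
    (fun x hx => stepKernel_eq_zero hδ hx) ?_
  rw [intervalIntegral.integral_eq_sub_of_hasDerivAt (fun τ _ => hasDerivAt_smoothStep δ τ)
    ((contDiff_stepKernel δ).continuous.intervalIntegrable _ _), smoothStep_of_ge hδ le_rfl,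
    smoothStep_of_nonpos hδ le_rfl, sub_zero]

lemma boxKernel_nonneg {δ h : ℝ} (hδ : 0 < δ) (hh : 0 < h) (τ : ℝ) : 0 ≤ boxKernel δ h τ :=
  div_nonneg (sub_nonneg.2 (monotone_smoothStep hδ (by linarith))) hh.le

lemma boxKernel_eq_zero {δ h τ : ℝ} (hδ : 0 < δ) (hh : 0 < h) (hτ : τ ∉ Icc (-h) δ) :
    boxKernel δ h τ = 0 := by
  rw [mem_Icc, not_and_or, not_le, not_le] at hτ
  unfold boxKernel
  rcases hτ with hτ | hτ
  · rw [smoothStep_of_nonpos hδ (by linarith), smoothStep_of_nonpos hδ (by linarith)]; simp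
  · rw [smoothStep_of_ge hδ (by linarith), smoothStep_of_ge hδ (by linarith)]; simp

lemma lintegral_boxKernel {δ h : ℝ} (hδ : 0 < δ) (hh : 0 < h) :
    ∫⁻ τ, ENNReal.ofReal (boxKernel δ h τ) = 1 := by
  refine lintegral_eq_one_of_Icc (contDiff_boxKernel δ h).continuous (boxKernel_nonneg hδ hh)
    (c := -h) (d := δ) (by linarith) (fun x hx => boxKernel_eq_zero hδ hh hx) ?_
  have hi : ∀ c d, IntervalIntegrable (smoothStep δ) volume c d :=
    (contDiff_smoothStep δ).continuous.intervalIntegrable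
  have h1 : ∫ τ in (-h)..δ, smoothStep δ (τ + h) = ∫ τ in (0 : ℝ)..(δ + h), smoothStep δ τ := by
    rw [intervalIntegral.integral_comp_add_right]; simp
  have h2 : ∫ τ in (-h)..0, smoothStep δ τ = 0 := by
    rw [intervalIntegral.integral_congr (g := fun _ => 0)]
    · simp
    · intro τ hτ
      rw [uIcc_of_le (by linarith)] at hτ
      exact smoothStep_of_nonpos hδ hτ.2
  have h3 : ∫ τ in δ..(δ + h), smoothStep δ τ = h := by
    rw [intervalIntegral.integral_congr (g := fun _ => 1)]
    · simp
    · intro τ hτ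
      rw [uIcc_of_le (by linarith)] at hτ
      exact smoothStep_of_ge hδ hτ.1
  have h4 := intervalIntegral.integral_add_adjacent_intervals (hi (-h) 0) (hi 0 δ)
  have h5 := intervalIntegral.integral_add_adjacent_intervals (hi 0 δ) (hi δ (δ + h))
  have hic : IntervalIntegrable (fun τ => smoothStep δ (τ + h)) volume (-h) δ :=
    ((contDiff_smoothStep δ).continuous.comp (continuous_id.add continuous_const)).intervalIntegrable
      _ _
  simp only [boxKernel]
  rw [intervalIntegral.integral_div, intervalIntegral.integral_sub hic (hi _ _), h1, ← h4, ← h5,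
    h2, h3]
  field_simp
  ring

/-- The kernel in the variable `y`, supported in `[δ, 2δ]`. -/
def yKernel (δ y : ℝ) : ℝ := stepKernel δ (2 * δ - y)

/-- A cutoff supported in `[-2δ, 2δ]`, with derivative `-yKernel δ` on `[-δ, ∞)`. -/
def yCutoff (δ y : ℝ) : ℝ := smoothStep δ (2 * δ - y) * smoothStep δ (y + 2 * δ)

lemma contDiff_yKernel (δ : ℝ) : ContDiff ℝ ∞ (yKernel δ) :=
  (contDiff_stepKernel δ).comp (contDiff_const.sub contDiff_id)

lemma contDiff_yCutoff (δ : ℝ) : ContDiff ℝ ∞ (yCutoff δ) :=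
  ((contDiff_smoothStep δ).comp (contDiff_const.sub contDiff_id)).mul
    ((contDiff_smoothStep δ).comp (contDiff_id.add contDiff_const))

lemma yKernel_nonneg {δ : ℝ} (hδ : 0 < δ) (y : ℝ) : 0 ≤ yKernel δ y := stepKernel_nonneg hδ _

lemma yKernel_eq_zero {δ y : ℝ} (hδ : 0 < δ) (hy : y ∉ Icc δ (2 * δ)) : yKernel δ y = 0 := by
  refine stepKernel_eq_zero hδ fun h => hy ⟨?_, ?_⟩ <;> linarith [h.1, h.2]

lemma lintegral_yKernel {δ : ℝ} (hδ : 0 < δ) : ∫⁻ y, ENNReal.ofReal (yKernel δ y) = 1 := by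
  rw [← lintegral_stepKernel hδ]
  exact lintegral_sub_left_eq_self (fun y => ENNReal.ofReal (stepKernel δ y)) (2 * δ)

lemma yCutoff_nonneg (δ y : ℝ) : 0 ≤ yCutoff δ y :=
  mul_nonneg (Real.smoothTransition.nonneg _) (Real.smoothTransition.nonneg _)

lemma yCutoff_le_one (δ y : ℝ) : yCutoff δ y ≤ 1 :=
  mul_le_one₀ (Real.smoothTransition.le_one _) (Real.smoothTransition.nonneg _)
    (Real.smoothTransition.le_one _)

lemma yCutoff_eq_zero {δ y : ℝ} (hδ : 0 < δ) (hy : y ∉ Icc (-(2 * δ)) (2 * δ)) :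
    yCutoff δ y = 0 := by
  rw [mem_Icc, not_and_or, not_le, not_le] at hy
  unfold yCutoff
  rcases hy with hy | hy
  · rw [smoothStep_of_nonpos (τ := y + _) hδ (by linarith), mul_zero]
  · rw [smoothStep_of_nonpos hδ (by linarith), zero_mul]

lemma yCutoff_zero {δ : ℝ} (hδ : 0 < δ) : yCutoff δ 0 = 1 := by
  unfold yCutoff
  rw [smoothStep_of_ge hδ (by linarith), smoothStep_of_ge hδ (by linarith), mul_one]

/-- For `y > 0` the second factor of the cutoff is constantly 1; it serves only to make the support
compact below `{y = 0}`. -/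
lemma hasDerivAt_yCutoff {δ y : ℝ} (hδ : 0 < δ) (hy : 0 < y) :
    HasDerivAt (yCutoff δ) (-yKernel δ y) y := by
  have h1 : HasDerivAt (fun y => smoothStep δ (2 * δ - y)) (-yKernel δ y) y := by
    exact (hasDerivAt_smoothStep δ (2 * δ - y)).comp_const_sub (2 * δ) y
  refine h1.congr_of_eventuallyEq ?_
  filter_upwards [lt_mem_nhds hy] with z hz
  rw [yCutoff, smoothStep_of_ge (τ := z + _) hδ (by linarith), mul_one]

/-- The shifted kernel is compatible with the weight uniformly in `δ`. If `y ≥ 4δ`, the support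
forces `y/2 ≤ z ≤ y`, and there `z^a ≤ 2 y^a` since `a > -1`. If `y < 4δ`, the kernel is at most
`M/δ` and `∫₀^y z^a dz = y^{a+1}/(a+1)`, where `y/δ < 4`. -/
lemma exists_lintegral_yKernel_le {a : ℝ} (ha : -1 < a) : ∃ C : ℝ≥0,
    ∀ δ, 0 < δ → ∀ y, 0 < y →
      ∫⁻ z in Ioi 0, ENNReal.ofReal (yKernel δ (y - z)) * ENNReal.ofReal (z ^ a) ≤
        C * ENNReal.ofReal (y ^ a) := by
  obtain ⟨M, hM0, hM⟩ := exists_stepKernel_le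
  have ha1 : 0 < a + 1 := by linarith
  have hC : 0 ≤ 2 + 4 * M / (a + 1) := by positivity
  refine ⟨(2 + 4 * M / (a + 1)).toNNReal, fun δ hδ y hy => ?_⟩
  change _ ≤ ENNReal.ofReal _ * _
  rw [← ENNReal.ofReal_mul hC]
  have hya : 0 < y ^ a := Real.rpow_pos_of_pos hy a
  rcases le_or_gt (4 * δ) y with h | h
  · calc _ ≤ ∫⁻ z in Ioi 0, ENNReal.ofReal (yKernel δ (y - z)) * ENNReal.ofReal (2 * y ^ a) := by
          refine setLIntegral_mono' measurableSet_Ioi fun z hz => ?_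
          by_cases hk : yKernel δ (y - z) = 0
          · simp [hk]
          have hmem : y - z ∈ Icc δ (2 * δ) := by
            by_contra h'; exact hk (yKernel_eq_zero hδ h')
          have hz1 : y / 2 ≤ z := by linarith [hmem.2]
          have hz2 : z ≤ y := by linarith [hmem.1]
          gcongr
          rcases le_or_gt 0 a with ha0 | ha0
          · have := Real.rpow_le_rpow (show (0 : ℝ) ≤ z from le_of_lt hz) hz2 ha0
            linarith
          · calc z ^ a ≤ (y / 2) ^ a := Real.rpow_le_rpow_of_nonpos (by linarith) hz1 ha0.le
              _ = 2 ^ (-a) * y ^ a := by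
                rw [Real.div_rpow hy.le (by norm_num), Real.rpow_neg (by norm_num)]
                field_simp
              _ ≤ 2 * y ^ a := by
                gcongr
                calc (2 : ℝ) ^ (-a) ≤ 2 ^ (1 : ℝ) :=
                      Real.rpow_le_rpow_of_exponent_le (by norm_num) (by linarith)
                  _ = 2 := Real.rpow_one 2
      _ ≤ ∫⁻ z, ENNReal.ofReal (yKernel δ (y - z)) * ENNReal.ofReal (2 * y ^ a) :=
          setLIntegral_le_lintegral _ _
      _ = ENNReal.ofReal (2 * y ^ a) := by
          rw [lintegral_mul_const' _ _ ENNReal.ofReal_ne_top,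
            lintegral_sub_left_eq_self (fun z => ENNReal.ofReal (yKernel δ z)),
            lintegral_yKernel hδ, one_mul]
      _ ≤ _ := by
          refine ENNReal.ofReal_le_ofReal ?_
          have : 0 ≤ 4 * M / (a + 1) := by positivity
          nlinarith
  · calc _ ≤ ∫⁻ z in Ioi 0, (Ioo 0 y).indicator
            (fun z => ENNReal.ofReal (M / δ) * ENNReal.ofReal (z ^ a)) z := by
          refine setLIntegral_mono' measurableSet_Ioi fun z hz => ?_
          by_cases hk : yKernel δ (y - z) = 0
          · simp [hk]
          have hmem : y - z ∈ Icc δ (2 * δ) := by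
            by_contra h'; exact hk (yKernel_eq_zero hδ h')
          rw [indicator_of_mem (show z ∈ Ioo 0 y from ⟨hz, by linarith [hmem.1]⟩)]
          gcongr
          exact hM δ hδ _
      _ = ENNReal.ofReal (M / δ) * ENNReal.ofReal (y ^ (a + 1) / (a + 1)) := by
          rw [setLIntegral_indicator measurableSet_Ioo,
            inter_eq_left.2 (Ioo_subset_Ioi_self), lintegral_const_mul' _ _ (by simp),
            lintegral_rpow_Ioo ha hy.le]
      _ ≤ _ := by
          rw [← ENNReal.ofReal_mul (by positivity)]
          refine ENNReal.ofReal_le_ofReal ?_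
          rw [Real.rpow_add_one hy.ne']
          have h1 : y / δ ≤ 4 := by rw [div_le_iff₀ hδ]; linarith
          calc M / δ * (y ^ a * y / (a + 1)) = M / (a + 1) * y ^ a * (y / δ) := by
                field_simp
            _ ≤ M / (a + 1) * y ^ a * 4 := by gcongr
            _ = 4 * M / (a + 1) * y ^ a := by ring
            _ ≤ _ := by gcongr; linarith

/-! ### Product kernels on the thick space-time and on the thin space-time -/

/-- A smooth probability kernel on `ℝⁿ` supported in the ball of radius `δ`. -/
def thinKernel (n : ℕ) (δ : ℝ) (hδ : 0 < δ) : Thin n → ℝ :=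
  (⟨δ / 2, δ, half_pos hδ, half_lt_self hδ⟩ : ContDiffBump (0 : Thin n)).normed volume

section ThinKernel

variable {n : ℕ} {δ : ℝ} (hδ : 0 < δ)

lemma contDiff_thinKernel : ContDiff ℝ ∞ (thinKernel n δ hδ) := ContDiffBump.contDiff_normed _

lemma thinKernel_nonneg (x : Thin n) : 0 ≤ thinKernel n δ hδ x := ContDiffBump.nonneg_normed _ _

lemma support_thinKernel : Function.support (thinKernel n δ hδ) = Metric.ball 0 δ :=
  ContDiffBump.support_normed_eq _

lemma lintegral_thinKernel : ∫⁻ x, ENNReal.ofReal (thinKernel n δ hδ x) = 1 := by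
  have hi : Integrable (thinKernel n δ hδ) := ContDiffBump.integrable_normed _
  rw [← ofReal_integral_eq_lintegral_ofReal hi (ae_of_all _ (thinKernel_nonneg hδ))]
  simp [thinKernel, ContDiffBump.integral_normed]

end ThinKernel

/-- The kernel `χ(x) k(y) T(t)` on the thick space-time. -/
def prodKernel {n : ℕ} (χ : Thin n → ℝ) (k T : ℝ → ℝ) (q : Thick n × ℝ) : ℝ :=
  χ (thinProj n q.1) * k (yCoord q.1) * T q.2

lemma contDiff_prodKernel {n : ℕ} {χ : Thin n → ℝ} {k T : ℝ → ℝ} (hχ : ContDiff ℝ ∞ χ)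
    (hk : ContDiff ℝ ∞ k) (hT : ContDiff ℝ ∞ T) : ContDiff ℝ ∞ (prodKernel χ k T) :=
  ((hχ.comp ((thinProj n).contDiff.comp contDiff_fst)).mul
    (hk.comp ((yCLM n).contDiff.comp contDiff_fst))).mul (hT.comp contDiff_snd)

lemma prodKernel_nonneg {n : ℕ} {χ : Thin n → ℝ} {k T : ℝ → ℝ} (hχ : ∀ x, 0 ≤ χ x)
    (hk : ∀ y, 0 ≤ k y) (hT : ∀ t, 0 ≤ T t) (q : Thick n × ℝ) : 0 ≤ prodKernel χ k T q :=
  mul_nonneg (mul_nonneg (hχ _) (hk _)) (hT _)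

lemma mem_of_prodKernel_ne_zero {n : ℕ} {χ : Thin n → ℝ} {k T : ℝ → ℝ} {r₁ r₂ r₃ : ℝ}
    (hχ : Function.support χ ⊆ Metric.ball 0 r₁) (hk : ∀ y, k y ≠ 0 → |y| ≤ r₂)
    (hT : ∀ t, T t ≠ 0 → |t| ≤ r₃) {q : Thick n × ℝ} (hq : prodKernel χ k T q ≠ 0) :
    ‖q.1‖ < r₁ + r₂ ∧ |q.2| ≤ r₃ := by
  unfold prodKernel at hq
  have h1 := left_ne_zero_of_mul hq
  have h2 := hχ (left_ne_zero_of_mul h1)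
  rw [mem_ball_zero_iff] at h2
  have h3 := hk _ (right_ne_zero_of_mul h1)
  exact ⟨(norm_le_thinProj_add_yCoord q.1).trans_lt (by linarith), hT _ (right_ne_zero_of_mul hq)⟩

lemma hasCompactSupport_prodKernel {n : ℕ} {χ : Thin n → ℝ} {k T : ℝ → ℝ} {r₁ r₂ r₃ : ℝ}
    (hχ : Function.support χ ⊆ Metric.ball 0 r₁) (hk : ∀ y, k y ≠ 0 → |y| ≤ r₂)
    (hT : ∀ t, T t ≠ 0 → |t| ≤ r₃) : HasCompactSupport (prodKernel χ k T) := by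
  refine HasCompactSupport.of_support_subset_isCompact
    ((isCompact_closedBall (0 : Thick n) (r₁ + r₂)).prod (isCompact_closedBall (0 : ℝ) r₃))
    fun q hq => ?_
  have := mem_of_prodKernel_ne_zero hχ hk hT hq
  exact ⟨mem_closedBall_zero_iff.2 this.1.le, mem_closedBall_zero_iff.2 this.2⟩

lemma lintegral_halfMeasure {n : ℕ} {a : ℝ} {f : Thick n → ℝ≥0∞} (hf : Measurable f) :
    ∫⁻ X, f X ∂(halfMeasure n a) =
      ∫⁻ x : Thin n, ∫⁻ y in Ioi 0, ENNReal.ofReal (y ^ a) * f (glue x y) := by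
  rw [halfMeasure, lintegral_withDensity_eq_lintegral_mul _ (measurable_yWeight n a) hf,
    lintegral_thick ((measurable_yWeight n a).mul hf)]
  refine lintegral_congr fun x => ?_
  rw [← lintegral_indicator measurableSet_Ioi]
  refine lintegral_congr fun y => ?_
  by_cases hy : 0 < y <;> simp [yWeight, indicator, hy]

lemma lintegral_prodKernel {n : ℕ} {χ : Thin n → ℝ} {k T : ℝ → ℝ} (hχ : Measurable χ)
    (hk : Measurable k) (hT : Measurable T) (hχ0 : ∀ x, 0 ≤ χ x) (hk0 : ∀ y, 0 ≤ k y)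
    (hχ1 : ∫⁻ x, ENNReal.ofReal (χ x) = 1) (hk1 : ∫⁻ y, ENNReal.ofReal (k y) = 1)
    (hT1 : ∫⁻ t, ENNReal.ofReal (T t) = 1) :
    ∫⁻ q, ENNReal.ofReal (prodKernel χ k T q) = 1 := by
  have hm : Measurable fun X : Thick n => ENNReal.ofReal (χ (thinProj n X) * k (yCoord X)) :=
    ((hχ.comp (thinProj n).continuous.measurable).mul (hk.comp measurable_yCoord)).ennreal_ofReal
  simp only [prodKernel, ENNReal.ofReal_mul (mul_nonneg (hχ0 _) (hk0 _))]
  change ∫⁻ q : Thick n × ℝ, _ ∂(volume.prod volume) = 1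
  rw [lintegral_prod_mul (f := fun X : Thick n => ENNReal.ofReal (χ (thinProj n X) * k (yCoord X)))
    (g := fun t => ENNReal.ofReal (T t)) hm.aemeasurable hT.ennreal_ofReal.aemeasurable, hT1,
    mul_one, lintegral_thick hm]
  simp only [thinProj_glue, yCoord_glue, ENNReal.ofReal_mul (hχ0 _)]
  simp_rw [lintegral_const_mul' _ _ ENNReal.ofReal_ne_top, hk1, mul_one, hχ1]

/-- Only the factor in `y` interacts with the weight; the other two integrate to 1. When the
`y`-coordinate of `q` is not positive, both sides vanish because `k` is supported in `y > 0`. -/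
lemma lintegral_prodKernel_halfMeasureTime_le {n : ℕ} {a : ℝ} {χ : Thin n → ℝ} {k T : ℝ → ℝ}
    (hχ : Measurable χ) (hk : Measurable k) (hT : Measurable T) (hχ0 : ∀ x, 0 ≤ χ x)
    (hk0 : ∀ y, 0 ≤ k y) (hk2 : ∀ y, y ≤ 0 → k y = 0) (hχ1 : ∫⁻ x, ENNReal.ofReal (χ x) = 1)
    (hT1 : ∫⁻ t, ENNReal.ofReal (T t) = 1) {C : ℝ≥0}
    (hC : ∀ y, 0 < y → ∫⁻ z in Ioi 0, ENNReal.ofReal (k (y - z)) * ENNReal.ofReal (z ^ a) ≤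
        C * ENNReal.ofReal (y ^ a)) (q : Thick n × ℝ) :
    ∫⁻ p, ENNReal.ofReal (prodKernel χ k T (q - p)) ∂(halfMeasureTime n a) ≤
      C * yWeight n a q.1 := by
  have hm : Measurable fun X : Thick n =>
      ENNReal.ofReal (χ (thinProj n (q.1 - X)) * k (yCoord (q.1 - X))) :=
    ((hχ.comp ((thinProj n).continuous.measurable.comp (measurable_const.sub measurable_id))).mul
      (hk.comp (measurable_yCoord.comp (measurable_const.sub measurable_id)))).ennreal_ofReal
  simp only [prodKernel, ENNReal.ofReal_mul (mul_nonneg (hχ0 _) (hk0 _)), halfMeasureTime,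
    Prod.fst_sub, Prod.snd_sub]
  rw [lintegral_prod_mul (f := fun X : Thick n =>
      ENNReal.ofReal (χ (thinProj n (q.1 - X)) * k (yCoord (q.1 - X))))
    (g := fun t => ENNReal.ofReal (T (q.2 - t))) hm.aemeasurable
    (hT.comp (measurable_const.sub measurable_id)).ennreal_ofReal.aemeasurable,
    lintegral_sub_left_eq_self (fun t => ENNReal.ofReal (T t)), hT1, mul_one,
    lintegral_halfMeasure hm]
  have hsub : ∀ x y, yCoord (q.1 - glue x y) = yCoord q.1 - y := fun x y => by
    rw [← yCLM_apply, map_sub, yCLM_apply, yCLM_apply, yCoord_glue]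
  simp only [map_sub, thinProj_glue, hsub, ENNReal.ofReal_mul (hχ0 _)]
  have hre : ∀ (x : Thin n), ∫⁻ y in Ioi 0, ENNReal.ofReal (y ^ a) *
      (ENNReal.ofReal (χ (thinProj n q.1 - x)) * ENNReal.ofReal (k (yCoord q.1 - y))) =
      ENNReal.ofReal (χ (thinProj n q.1 - x)) *
        ∫⁻ y in Ioi 0, ENNReal.ofReal (k (yCoord q.1 - y)) * ENNReal.ofReal (y ^ a) := fun x => by
    rw [← lintegral_const_mul' _ _ ENNReal.ofReal_ne_top]
    refine lintegral_congr fun y => ?_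
    ring
  have hχm : Measurable fun x => ENNReal.ofReal (χ (thinProj n q.1 - x)) :=
    (hχ.comp (measurable_const.sub measurable_id)).ennreal_ofReal
  simp_rw [hre]
  rw [lintegral_mul_const _ hχm,
    lintegral_sub_left_eq_self (fun x => ENNReal.ofReal (χ x)), hχ1, one_mul]
  by_cases hq : 0 < yCoord q.1
  · simpa [yWeight, indicator, hq] using hC _ hq
  · rw [setLIntegral_congr_fun (g := fun _ => 0) measurableSet_Ioi]
    · simp
    · intro y hy
      simp only
      rw [hk2 _ (by linarith [show (0 : ℝ) < y from hy]), ENNReal.ofReal_zero, zero_mul]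

/-- The kernel `χ(x) T(t)` on the thin space-time. -/
def thinProdKernel {n : ℕ} (χ : Thin n → ℝ) (T : ℝ → ℝ) (q : Thin n × ℝ) : ℝ := χ q.1 * T q.2

lemma lintegral_thinProdKernel {n : ℕ} {χ : Thin n → ℝ} {T : ℝ → ℝ} (hχ : Measurable χ)
    (hT : Measurable T) (hχ0 : ∀ x, 0 ≤ χ x) (hχ1 : ∫⁻ x, ENNReal.ofReal (χ x) = 1)
    (hT1 : ∫⁻ t, ENNReal.ofReal (T t) = 1) :
    ∫⁻ q, ENNReal.ofReal (thinProdKernel χ T q) = 1 := by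
  simp only [thinProdKernel, ENNReal.ofReal_mul (hχ0 _)]
  change ∫⁻ q : Thin n × ℝ, _ ∂(volume.prod volume) = 1
  rw [lintegral_prod_mul (f := fun x => ENNReal.ofReal (χ x))
    (g := fun t => ENNReal.ofReal (T t)) hχ.ennreal_ofReal.aemeasurable
    hT.ennreal_ofReal.aemeasurable, hχ1, hT1, one_mul]

instance isAddHaarMeasure_volume_thin (n : ℕ) :
    (volume : Measure (Thin n × ℝ)).IsAddHaarMeasure :=
  inferInstanceAs ((volume : Measure (Thin n)).prod (volume : Measure ℝ)).IsAddHaarMeasure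

/-! ### Smoothness and derivatives of mollifications -/

section MollifySmooth

variable {G F : Type*} [NormedAddCommGroup G] [NormedSpace ℝ G] [FiniteDimensional ℝ G]
  [MeasureSpace G] [BorelSpace G] [(volume : Measure G).IsAddHaarMeasure]
  [NormedAddCommGroup F] [NormedSpace ℝ F]

open ContinuousLinearMap in
omit [NormedSpace ℝ G] [FiniteDimensional ℝ G] [BorelSpace G]
  [(volume : Measure G).IsAddHaarMeasure] in
lemma mollify_eq_convolution (κ : G → ℝ) (f : G → F) :
    mollify κ f = convolution f (fun z => κ (-z)) (lsmul ℝ ℝ : ℝ →L[ℝ] F →L[ℝ] F).flip volume := by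
  ext p
  simp [mollify, convolution]

omit [FiniteDimensional ℝ G] [(volume : Measure G).IsAddHaarMeasure] in
lemma contDiff_mollify {κ : G → ℝ} (hκ : ContDiff ℝ ∞ κ) (hs : HasCompactSupport κ) {f : G → F}
    (hf : Integrable f) : ContDiff ℝ ∞ (mollify κ f) := by
  rw [mollify_eq_convolution]
  exact (hs.comp_homeomorph (Homeomorph.neg G)).contDiff_convolution_right _ hf.locallyIntegrable
    (hκ.comp contDiff_neg)

/-- The derivative falls on the kernel; the sign comes from the convention `κ(q - p)`, in which `p`
enters negatively. -/
lemma fderiv_mollify_apply [CompleteSpace F] {κ : G → ℝ} (hκ : ContDiff ℝ ∞ κ)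
    (hs : HasCompactSupport κ) {f : G → F} (hf : Integrable f) (p v : G) :
    fderiv ℝ (mollify κ f) p v = - mollify (fun z => fderiv ℝ κ z v) f p := by
  have hd : ∀ z, fderiv ℝ (fun z => κ (-z)) z v = -fderiv ℝ κ (-z) v := fun z => by
    have h1 : HasFDerivAt κ (fderiv ℝ κ (-z)) (-z) :=
      (hκ.differentiable (by simp)).differentiableAt.hasFDerivAt
    have h2 := h1.comp z (hasFDerivAt_id z).neg
    rw [show (fun z => κ (-z)) = κ ∘ Neg.neg from rfl, HasFDerivAt.fderiv h2]
    simp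
  have hs' : HasCompactSupport fun z => κ (-z) := hs.comp_homeomorph (Homeomorph.neg G)
  have hκ' : ContDiff ℝ ∞ fun z => κ (-z) := hκ.comp contDiff_neg
  have h := hs'.hasFDerivAt_convolution_right
    (ContinuousLinearMap.lsmul ℝ ℝ : ℝ →L[ℝ] F →L[ℝ] F).flip hf.locallyIntegrable
    (hκ'.of_le (by simp)) p
  rw [mollify_eq_convolution, h.fderiv, convolution_precompR_apply _ hf.locallyIntegrable
    (hs'.fderiv ℝ) (hκ'.continuous_fderiv (by simp))]
  simp only [convolution, mollify, hd]
  simp [integral_neg]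

end MollifySmooth

/-! ### Derivatives of product kernels and weighted estimates in space-time -/

section SpaceTime

variable {n : ℕ} {F : Type*} [NormedAddCommGroup F] [NormedSpace ℝ F]

lemma thinProj_single_last : thinProj n (EuclideanSpace.single (Fin.last n) 1) = 0 := by
  ext i; simp [thinProj_apply, (Fin.castSucc_lt_last i).ne]

lemma yCoord_sub (X Y : Thick n) : yCoord (X - Y) = yCoord X - yCoord Y := rfl

lemma fderiv_prod_apply_eq_of_hasDerivAt {G : Type*} [NormedAddCommGroup G] [NormedSpace ℝ G]
    {f : G → F} {p v : G} {c : F} (hf : DifferentiableAt ℝ f p)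
    (h : HasDerivAt (fun s : ℝ => f (p + s • v)) c 0) : fderiv ℝ f p v = c := by
  have h1 : HasDerivAt (fun s : ℝ => p + s • v) v 0 := by
    simpa using ((hasDerivAt_id (0 : ℝ)).smul_const v).const_add p
  have h2 : HasFDerivAt f (fderiv ℝ f p) (p + (0 : ℝ) • v) := by simpa using hf.hasFDerivAt
  exact (h2.comp_hasDerivAt 0 h1).unique h

lemma partialX_last_prodKernel {χ : Thin n → ℝ} {k T : ℝ → ℝ} (hχ : ContDiff ℝ ∞ χ)
    (hk : ContDiff ℝ ∞ k) (hT : ContDiff ℝ ∞ T) {q : Thick n × ℝ} {c : ℝ}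
    (hc : HasDerivAt k c (yCoord q.1)) :
    partialX (prodKernel χ k T) (Fin.last n) q = χ (thinProj n q.1) * c * T q.2 := by
  refine fderiv_prod_apply_eq_of_hasDerivAt
    ((contDiff_prodKernel hχ hk hT).differentiable (by simp)).differentiableAt ?_
  have h1 : (fun s : ℝ => prodKernel χ k T (q + s • (EuclideanSpace.single (Fin.last n) 1, 0))) =
      fun s => χ (thinProj n q.1) * k (yCoord q.1 + s) * T q.2 := by
    funext s
    have h2 : yCoord (q.1 + s • EuclideanSpace.single (Fin.last n) (1 : ℝ)) = yCoord q.1 + s := by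
      simp [yCoord]
    simp [prodKernel, thinProj_single_last, h2]
  rw [h1]
  have h3 : HasDerivAt (fun s => k (yCoord q.1 + s)) c 0 := by
    refine HasDerivAt.comp_const_add (yCoord q.1) 0 ?_
    simpa using hc
  exact (h3.const_mul _).mul_const _

lemma partialT_prodKernel {χ : Thin n → ℝ} {k T : ℝ → ℝ} (hχ : ContDiff ℝ ∞ χ)
    (hk : ContDiff ℝ ∞ k) (hT : ContDiff ℝ ∞ T) {q : Thick n × ℝ} {c : ℝ}
    (hc : HasDerivAt T c q.2) :
    partialT (prodKernel χ k T) q = χ (thinProj n q.1) * k (yCoord q.1) * c := by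
  refine fderiv_prod_apply_eq_of_hasDerivAt
    ((contDiff_prodKernel hχ hk hT).differentiable (by simp)).differentiableAt ?_
  have h1 : (fun s : ℝ => prodKernel χ k T (q + s • ((0 : Thick n), (1 : ℝ)))) =
      fun s => χ (thinProj n q.1) * k (yCoord q.1) * T (q.2 + s) := by
    funext s
    simp [prodKernel]
  rw [h1]
  have h3 : HasDerivAt (fun s => T (q.2 + s)) c 0 := by
    refine HasDerivAt.comp_const_add q.2 0 ?_
    simpa using hc
  exact h3.const_mul _

/-- The box kernel is the Steklov average over `[t - h, t]`, smoothed at scale `δ`. Its time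
derivative is therefore an exact backward difference quotient, of the mollification at the finer
scale `δ`. -/
lemma partialT_mollify_box [CompleteSpace F] {χ : Thin n → ℝ} {k : ℝ → ℝ} {δ h r₁ r₂ : ℝ}
    (hδ : 0 < δ) (hh : 0 < h) (hχ : ContDiff ℝ ∞ χ) (hk : ContDiff ℝ ∞ k)
    (hχs : Function.support χ ⊆ Metric.ball 0 r₁) (hks : ∀ y, k y ≠ 0 → |y| ≤ r₂)
    {f : Thick n × ℝ → F} (hf : Integrable f) (p : Thick n × ℝ) :
    partialT (mollify (prodKernel χ k (boxKernel δ h)) f) p =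
      h⁻¹ • (mollify (prodKernel χ k (stepKernel δ)) f p -
        mollify (prodKernel χ k (stepKernel δ)) f (p.1, p.2 - h)) := by
  have hTs : ∀ t, boxKernel δ h t ≠ 0 → |t| ≤ δ + h := fun t ht => by
    have : t ∈ Icc (-h) δ := by by_contra h'; exact ht (boxKernel_eq_zero hδ hh h')
    exact abs_le.2 ⟨by linarith [this.1], by linarith [this.2]⟩
  have hSs : ∀ t, stepKernel δ t ≠ 0 → |t| ≤ δ := fun t ht => by
    have : t ∈ Icc 0 δ := by by_contra h'; exact ht (stepKernel_eq_zero hδ h')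
    exact abs_le.2 ⟨by linarith [this.1], by linarith [this.2]⟩
  have hstep := contDiff_prodKernel hχ hk (contDiff_stepKernel δ)
  have hstepc : HasCompactSupport (prodKernel χ k (stepKernel δ)) :=
    hasCompactSupport_prodKernel hχs hks hSs
  have hd : ∀ z : Thick n × ℝ, fderiv ℝ (prodKernel χ k (boxKernel δ h)) z (0, 1) =
      h⁻¹ * (prodKernel χ k (stepKernel δ) (z.1, z.2 + h) - prodKernel χ k (stepKernel δ) z) := by
    intro z
    have := partialT_prodKernel hχ hk (contDiff_boxKernel δ h) (q := z)
      (hasDerivAt_boxKernel δ h z.2)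
    rw [partialT] at this
    rw [this]
    simp only [prodKernel]
    ring
  rw [partialT, fderiv_mollify_apply (contDiff_prodKernel hχ hk (contDiff_boxKernel δ h))
    (hasCompactSupport_prodKernel hχs hks hTs) hf]
  simp only [hd]
  have hi1 := integrable_kernel_smul hstep.continuous hstepc hf p
  have hi2 := integrable_kernel_smul hstep.continuous hstepc hf (p.1, p.2 - h)
  have h2 : ∀ q : Thick n × ℝ, ((q - p).1, (q - p).2 + h) = q - (p.1, p.2 - h) := fun q => by
    ext <;> simp; ring
  simp only [mollify, h2, mul_smul, sub_smul]
  rw [integral_smul, integral_sub hi2 hi1, ← smul_neg, neg_sub]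

omit [NormedSpace ℝ F] in
-- Cauchy–Schwarz with `1 = y^{-a} y^a`: the weight `y^{-a}` has finite mass on bounded sets because
-- `-a > -1`.
lemma integrable_of_memLp_halfMeasureTime {a : ℝ} (ha' : a < 1) {f : Thick n × ℝ → F}
    {S : Set (Thick n × ℝ)} (hS : Bornology.IsBounded S) (hSm : MeasurableSet S)
    (hSy : ∀ p ∈ S, 0 < yCoord p.1) (hf0 : ∀ p ∉ S, f p = 0)
    (hf : MemLp f 2 (halfMeasureTime n a)) : Integrable f := by
  have hSf : S.indicator f = f := indicator_eq_self.2 fun p hp => by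
    by_contra h; exact hp (hf0 p h)
  have hm : AEStronglyMeasurable f (volume.restrict S) :=
    (hf.1.mono_ac (volume_upper_absolutelyContinuous n a)).mono_measure
      (Measure.restrict_mono (fun p hp => hSy p hp) le_rfl)
  rw [← hSf, integrable_indicator_iff hSm]
  refine ⟨hm, ?_⟩
  have hW : ∀ b : ℝ, Measurable fun p : Thick n × ℝ => yWeight n b p.1 := fun b =>
    (measurable_yWeight n b).comp measurable_fst
  have hmul : ∀ p ∈ S, yWeight n (-a) p.1 * yWeight n a p.1 = 1 := fun p hp => by
    have hp' := hSy p hp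
    simp only [yWeight, indicator, mem_ofPred_eq, hp', if_true]
    rw [← ENNReal.ofReal_mul (by positivity), ← Real.rpow_add hp']
    simp
  have hCS := lintegral_mul_sq_le_weighted (volume.restrict S) (hW (-a)).aemeasurable
    (f := fun p => yWeight n a p.1 * ‖f p‖ₑ) ((hW a).aemeasurable.mul hm.enorm)
  have e1 : ∫⁻ p in S, yWeight n (-a) p.1 * (yWeight n a p.1 * ‖f p‖ₑ) = ∫⁻ p in S, ‖f p‖ₑ :=
    setLIntegral_congr_fun hSm fun p hp => by rw [← mul_assoc, hmul p hp, one_mul]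
  have e2 : ∫⁻ p in S, yWeight n (-a) p.1 * (yWeight n a p.1 * ‖f p‖ₑ) ^ 2 =
      ∫⁻ p in S, yWeight n a p.1 * ‖f p‖ₑ ^ 2 :=
    setLIntegral_congr_fun hSm fun p hp => by
      rw [mul_pow, sq (yWeight n a p.1), ← mul_assoc, ← mul_assoc, hmul p hp, one_mul]
  have e3 : ∫⁻ p in S, yWeight n (-a) p.1 < ⊤ := by
    rw [← withDensity_apply _ hSm, ← halfMeasureTime_eq]
    exact halfMeasureTime_lt_top_of_isBounded (by linarith) hS
  have e4 : ∫⁻ p in S, yWeight n a p.1 * ‖f p‖ₑ ^ 2 < ⊤ := by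
    have h1 : ∫⁻ p in S, yWeight n a p.1 * ‖f p‖ₑ ^ 2 =
        ∫⁻ p in S, ‖f p‖ₑ ^ 2 ∂(halfMeasureTime n a) := by
      rw [halfMeasureTime_eq, restrict_withDensity hSm,
        lintegral_withDensity_eq_lintegral_mul₀ (hW a).aemeasurable (hm.enorm.pow_const 2)]
      rfl
    rw [h1]
    refine (setLIntegral_le_lintegral _ _).trans_lt ?_
    rw [lintegral_enorm_sq_eq]
    exact ENNReal.pow_lt_top hf.2
  rw [e1, e2] at hCS
  have := hCS.trans_lt (ENNReal.mul_lt_top e3 e4)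
  exact (ENNReal.pow_lt_top_iff.1 this).resolve_right (by simp)

/-- This bounds the error between the value of a mollification on `{y = 0}` and the mollified trace.
Cauchy–Schwarz against `k y^{-a}` gives the factor `∫₀^{2δ} y^{-a} dy`, which tends to 0 with `δ`;
Tonelli and `∫ k dp ≤ 1` give the rest. -/
lemma lintegral_trace_remainder_le {a : ℝ} (ha' : a < 1) {χ : Thin n → ℝ} {T : ℝ → ℝ} {δ : ℝ}
    (hδ : 0 < δ) (hχ : Measurable χ) (hT : Measurable T) (hχ0 : ∀ x, 0 ≤ χ x) (hT0 : ∀ x, 0 ≤ T x)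
    (hχ1 : ∫⁻ x, ENNReal.ofReal (χ x) = 1) (hT1 : ∫⁻ t, ENNReal.ofReal (T t) = 1)
    {g : Thick n × ℝ → F} (hg0 : ∀ p, yCoord p.1 ≤ 0 → g p = 0) (hg : AEStronglyMeasurable g) :
    ∫⁻ p : Thin n × ℝ, ‖∫ q, prodKernel χ (yCutoff δ) T (q - (thinPoint p.1, p.2)) • g q‖ₑ ^ 2 ≤
      ENNReal.ofReal ((2 * δ) ^ (1 - a) / (1 - a)) * ∫⁻ q, ‖g q‖ₑ ^ 2 ∂(halfMeasureTime n a) := by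
  have hb := (contDiff_yCutoff δ).continuous.measurable
  have hkm : Measurable (prodKernel χ (yCutoff δ) T) :=
    ((hχ.comp ((thinProj n).continuous.measurable.comp measurable_fst)).mul
      (hb.comp (measurable_yCoord.comp measurable_fst))).mul (hT.comp measurable_snd)
  have hk0 := prodKernel_nonneg hχ0 (yCutoff_nonneg δ) hT0
  have hW : ∀ b : ℝ, Measurable fun p : Thick n × ℝ => yWeight n b p.1 := fun b =>
    (measurable_yWeight n b).comp measurable_fst
  have hmul : ∀ p : Thick n × ℝ, 0 < yCoord p.1 → yWeight n (-a) p.1 * yWeight n a p.1 = 1 := by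
    intro p hp'
    simp only [yWeight, indicator, mem_ofPred_eq, hp', if_true]
    rw [← ENNReal.ofReal_mul (by positivity), ← Real.rpow_add hp']
    simp
  set k : Thin n × ℝ → Thick n × ℝ → ℝ≥0∞ := fun p q =>
    ENNReal.ofReal (prodKernel χ (yCutoff δ) T (q - (thinPoint p.1, p.2))) with hk
  have hkm2 : Measurable (Function.uncurry k) := by
    refine (hkm.comp (measurable_snd.sub ?_)).ennreal_ofReal
    exact (continuous_thinPoint.measurable.comp (measurable_fst.comp measurable_fst)).prodMk
      (measurable_snd.comp measurable_fst)
  have hthinP : ∀ x : Thin n, thinProj n (thinPoint x) = x := fun x => by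
    rw [← glue_zero, thinProj_glue]
  have hthinY : ∀ x : Thin n, yCoord (thinPoint x) = 0 := fun x => by
    rw [← glue_zero, yCoord_glue]
  have hmass : ∀ p, ∫⁻ q, k p q * yWeight n (-a) q.1 ≤
      ENNReal.ofReal ((2 * δ) ^ (1 - a) / (1 - a)) := by
    intro p
    have h1 : ∀ q : Thick n × ℝ, k p q * yWeight n (-a) q.1 =
        (ENNReal.ofReal (χ (thinProj n q.1 - p.1)) * ENNReal.ofReal (yCutoff δ (yCoord q.1))
          * yWeight n (-a) q.1) * ENNReal.ofReal (T (q.2 - p.2)) := by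
      intro q
      simp only [hk, prodKernel, Prod.fst_sub, Prod.snd_sub, map_sub, hthinP, yCoord_sub, hthinY,
        sub_zero]
      rw [ENNReal.ofReal_mul (mul_nonneg (hχ0 _) (yCutoff_nonneg _ _)), ENNReal.ofReal_mul (hχ0 _)]
      ring
    simp_rw [h1]
    have hm1 : Measurable fun X : Thick n => ENNReal.ofReal (χ (thinProj n X - p.1)) *
        ENNReal.ofReal (yCutoff δ (yCoord X)) :=
      (hχ.comp ((thinProj n).continuous.measurable.sub_const _)).ennreal_ofReal.mul
        (hb.comp measurable_yCoord).ennreal_ofReal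
    have hm2 : Measurable fun X : Thick n => ENNReal.ofReal (χ (thinProj n X - p.1)) *
        ENNReal.ofReal (yCutoff δ (yCoord X)) * yWeight n (-a) X := hm1.mul (measurable_yWeight n _)
    change ∫⁻ q : Thick n × ℝ, _ ∂(volume.prod volume) ≤ _
    rw [lintegral_prod_mul (f := fun X : Thick n => ENNReal.ofReal (χ (thinProj n X - p.1)) *
        ENNReal.ofReal (yCutoff δ (yCoord X)) * yWeight n (-a) X)
      (g := fun t => ENNReal.ofReal (T (t - p.2))) hm2.aemeasurable
      (hT.comp (measurable_id.sub_const _)).ennreal_ofReal.aemeasurable,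
      lintegral_sub_right_eq_self (fun t => ENNReal.ofReal (T t)), hT1, mul_one,
      lintegral_thick hm2]
    simp only [thinProj_glue, yCoord_glue]
    calc _ ≤ ∫⁻ x, ENNReal.ofReal (χ (x - p.1)) *
          ENNReal.ofReal ((2 * δ) ^ (1 - a) / (1 - a)) := by
          refine lintegral_mono fun x => ?_
          simp only [mul_assoc]
          rw [lintegral_const_mul' _ _ ENNReal.ofReal_ne_top]
          gcongr
          have h3 := lintegral_rpow_Ioo (a := -a) (by linarith) (r := 2 * δ) (by positivity)
          rw [show (1 : ℝ) - a = -a + 1 by ring, ← h3, ← lintegral_indicator measurableSet_Ioo]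
          have h4 : ∀ᵐ y : ℝ, y ≠ 2 * δ := by simp [ae_iff, measure_singleton]
          refine lintegral_mono_ae ?_
          filter_upwards [h4] with y hy
          by_cases hy0 : 0 < y
          · by_cases hy1 : y < 2 * δ
            · rw [indicator_of_mem (show y ∈ Ioo 0 (2 * δ) from ⟨hy0, hy1⟩)]
              simp only [yWeight, indicator, mem_ofPred_eq, yCoord_glue, hy0, if_true]
              refine mul_le_of_le_one_left zero_le ?_
              exact ENNReal.ofReal_le_one.2 (yCutoff_le_one _ _)
            · rw [yCutoff_eq_zero hδ]
              · simp
              · exact fun h => hy (le_antisymm h.2 (not_lt.1 hy1))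
          · simp [yWeight, indicator, hy0]
      _ = _ := by
          rw [lintegral_mul_const' _ _ ENNReal.ofReal_ne_top,
            lintegral_sub_right_eq_self (fun x => ENNReal.ofReal (χ x)), hχ1, one_mul]
  have hmass2 : ∀ q : Thick n × ℝ, ∫⁻ p, k p q ≤ 1 := by
    intro q
    calc _ ≤ ∫⁻ p : Thin n × ℝ, ENNReal.ofReal (χ (thinProj n q.1 - p.1)) *
            ENNReal.ofReal (T (q.2 - p.2)) := by
          refine lintegral_mono fun p => ?_
          simp only [hk, prodKernel, Prod.fst_sub, Prod.snd_sub, map_sub, hthinP, yCoord_sub,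
            hthinY, sub_zero]
          rw [ENNReal.ofReal_mul (mul_nonneg (hχ0 _) (yCutoff_nonneg _ _))]
          gcongr
          exact mul_le_of_le_one_right (hχ0 _) (yCutoff_le_one _ _)
      _ = 1 := by
          change ∫⁻ q : Thin n × ℝ, _ ∂(volume.prod volume) = _
          rw [lintegral_prod_mul (f := fun x => ENNReal.ofReal (χ (thinProj n q.1 - x)))
            (g := fun t => ENNReal.ofReal (T (q.2 - t)))
            (hχ.comp (measurable_id.const_sub _)).ennreal_ofReal.aemeasurable
            (hT.comp (measurable_id.const_sub _)).ennreal_ofReal.aemeasurable,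
            lintegral_sub_left_eq_self (fun t => ENNReal.ofReal (T t)),
            lintegral_sub_left_eq_self (fun t => ENNReal.ofReal (χ t)), hχ1, hT1, one_mul]
  have hpt : ∀ p : Thin n × ℝ,
      ‖∫ q, prodKernel χ (yCutoff δ) T (q - (thinPoint p.1, p.2)) • g q‖ₑ ^ 2 ≤
        ENNReal.ofReal ((2 * δ) ^ (1 - a) / (1 - a)) *
          ∫⁻ q, k p q * (yWeight n a q.1 * ‖g q‖ₑ ^ 2) := by
    intro p
    have hCS := lintegral_mul_sq_le_weighted volume
      ((hkm2.of_uncurry_left (x := p)).mul (hW (-a))).aemeasurable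
      (f := fun q => yWeight n a q.1 * ‖g q‖ₑ) ((hW a).aemeasurable.mul hg.enorm)
    have e1 : ∀ q, k p q * yWeight n (-a) q.1 * (yWeight n a q.1 * ‖g q‖ₑ) = k p q * ‖g q‖ₑ := by
      intro q
      rcases lt_or_ge 0 (yCoord q.1) with hq | hq
      · rw [mul_assoc, ← mul_assoc (yWeight n (-a) q.1), hmul q hq, one_mul]
      · simp [hg0 q hq]
    have e2 : ∀ q, k p q * yWeight n (-a) q.1 * (yWeight n a q.1 * ‖g q‖ₑ) ^ 2 =
        k p q * (yWeight n a q.1 * ‖g q‖ₑ ^ 2) := by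
      intro q
      rcases lt_or_ge 0 (yCoord q.1) with hq | hq
      · rw [mul_pow, sq (yWeight n a q.1), mul_assoc, ← mul_assoc (yWeight n (-a) q.1),
          ← mul_assoc (yWeight n (-a) q.1), hmul q hq, one_mul]
      · simp [hg0 q hq]
    simp only [Pi.mul_apply] at hCS
    simp_rw [e1, e2] at hCS
    calc _ ≤ (∫⁻ q, k p q * ‖g q‖ₑ) ^ 2 := by
          refine pow_le_pow_left₀ zero_le ((enorm_integral_le_lintegral_enorm _).trans_eq ?_) 2
          refine lintegral_congr fun q => ?_
          rw [enorm_smul, Real.enorm_eq_ofReal (hk0 _)]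
      _ ≤ _ := hCS.trans (by gcongr; exact hmass p)
  have hgm : AEMeasurable (fun q : Thick n × ℝ => yWeight n a q.1 * ‖g q‖ₑ ^ 2) :=
    (hW a).aemeasurable.mul (hg.enorm.pow_const 2)
  calc _ ≤ ∫⁻ p : Thin n × ℝ, ENNReal.ofReal ((2 * δ) ^ (1 - a) / (1 - a)) *
          ∫⁻ q, k p q * (yWeight n a q.1 * ‖g q‖ₑ ^ 2) := lintegral_mono hpt
    _ = ENNReal.ofReal ((2 * δ) ^ (1 - a) / (1 - a)) *
          ∫⁻ q, (∫⁻ p, k p q) * (yWeight n a q.1 * ‖g q‖ₑ ^ 2) := by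
        rw [lintegral_const_mul' _ _ ENNReal.ofReal_ne_top, lintegral_lintegral_swap
          (AEMeasurable.mul (f := Function.uncurry k) hkm2.aemeasurable hgm.comp_snd)]
        congr 1
        refine lintegral_congr fun q => ?_
        rw [lintegral_mul_const _ hkm2.of_uncurry_right]
    _ ≤ ENNReal.ofReal ((2 * δ) ^ (1 - a) / (1 - a)) *
          ∫⁻ q, yWeight n a q.1 * ‖g q‖ₑ ^ 2 := by
        exact mul_le_mul' le_rfl
          (lintegral_mono fun q => mul_le_of_le_one_left zero_le (hmass2 q))
    _ = _ := by
        rw [halfMeasureTime_eq, lintegral_withDensity_eq_lintegral_mul₀ (hW a).aemeasurable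
          (hg.enorm.pow_const 2)]
        rfl

end SpaceTime

/-! ### Pairings in `L²` -/

section Pairing

variable {α E : Type*} [MeasurableSpace α] {μ : Measure α} [NormedAddCommGroup E]
  [InnerProductSpace ℝ E]

lemma integrable_inner_of_memLp {f g : α → E} (hf : MemLp f 2 μ) (hg : MemLp g 2 μ) :
    Integrable (fun x => inner ℝ (f x) (g x)) μ := by
  refine (L2.integrable_inner (𝕜 := ℝ) (hf.toLp f) (hg.toLp g)).congr ?_
  filter_upwards [hf.coeFn_toLp, hg.coeFn_toLp] with x h1 h2
  rw [h1, h2]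

lemma integrable_norm_sq_of_memLp {f : α → E} (hf : MemLp f 2 μ) :
    Integrable (fun x => ‖f x‖ ^ 2) μ := by
  simpa [real_inner_self_eq_norm_sq] using integrable_inner_of_memLp hf hf

lemma abs_integral_inner_le {f g : α → E} (hf : MemLp f 2 μ) (hg : MemLp g 2 μ) :
    |∫ x, inner ℝ (f x) (g x) ∂μ| ≤ (eLpNorm f 2 μ).toReal * (eLpNorm g 2 μ).toReal := by
  have h1 := norm_inner_le_norm (𝕜 := ℝ) (hf.toLp f) (hg.toLp g)
  rw [Lp.norm_toLp, Lp.norm_toLp, L2.inner_def] at h1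
  convert h1 using 1
  rw [Real.norm_eq_abs]
  congr 1
  refine integral_congr_ae ?_
  filter_upwards [hf.coeFn_toLp, hg.coeFn_toLp] with x h1 h2
  rw [h1, h2]

lemma toReal_eLpNorm_two_sq {f : α → E} (hf : MemLp f 2 μ) :
    (eLpNorm f 2 μ).toReal ^ 2 = ∫ x, ‖f x‖ ^ 2 ∂μ := by
  have h1 : ‖hf.toLp f‖ ^ 2 = ∫ x, ‖f x‖ ^ 2 ∂μ := by
    rw [← real_inner_self_eq_norm_sq, L2.inner_def]
    refine integral_congr_ae ?_
    filter_upwards [hf.coeFn_toLp] with x h1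
    rw [h1, real_inner_self_eq_norm_sq]
  rw [← h1, Lp.norm_toLp]

lemma memLp_smul_of_bdd {f : α → E} (hf : MemLp f 2 μ) {c : α → ℝ}
    (hc : AEStronglyMeasurable c μ) {M : ℝ} (hM : ∀ x, |c x| ≤ M) :
    MemLp (fun x => c x • f x) 2 μ := by
  refine (hf.const_smul M).mono (hc.smul hf.1) (ae_of_all _ fun x => ?_)
  rw [norm_smul, Pi.smul_apply, norm_smul]
  gcongr
  exact (hM x).trans (le_abs_self _)

omit [InnerProductSpace ℝ E] in
lemma eLpNorm_two_le_of_lintegral {f : α → E} {s : ℝ≥0∞}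
    (h : ∫⁻ x, ‖f x‖ₑ ^ 2 ∂μ ≤ s ^ 2) : eLpNorm f 2 μ ≤ s := by
  rw [lintegral_enorm_sq_eq] at h
  exact le_of_not_gt fun h' => not_lt_of_ge h (ENNReal.pow_lt_pow_left two_ne_zero h')

lemma tendsto_integral_inner {f : α → E} {v : ℕ → α → E} {w : α → E} (hf : MemLp f 2 μ)
    (hv : ∀ j, MemLp (v j) 2 μ) (hw : MemLp w 2 μ)
    (h : Tendsto (fun j => eLpNorm (v j - w) 2 μ) atTop (𝓝 0)) :
    Tendsto (fun j => ∫ x, inner ℝ (f x) (v j x) ∂μ) atTop (𝓝 (∫ x, inner ℝ (f x) (w x) ∂μ)) := by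
  rw [tendsto_iff_norm_sub_tendsto_zero]
  have h1 : Tendsto (fun j => (eLpNorm f 2 μ).toReal * (eLpNorm (v j - w) 2 μ).toReal) atTop
      (𝓝 0) := by
    have := ((ENNReal.tendsto_toReal (by simp)).comp h).const_mul (eLpNorm f 2 μ).toReal
    simpa using this
  refine squeeze_zero (fun _ => norm_nonneg _) (fun j => ?_) h1
  rw [← integral_sub (integrable_inner_of_memLp hf (hv j)) (integrable_inner_of_memLp hf hw)]
  simp only [← inner_sub_right]
  exact abs_integral_inner_le hf ((hv j).sub hw)

lemma tendsto_integral_norm_sq {v : ℕ → α → E} {w : α → E}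
    (hv : ∀ j, MemLp (v j) 2 μ) (hw : MemLp w 2 μ)
    (h : Tendsto (fun j => eLpNorm (v j - w) 2 μ) atTop (𝓝 0)) :
    Tendsto (fun j => ∫ x, ‖v j x‖ ^ 2 ∂μ) atTop (𝓝 (∫ x, ‖w x‖ ^ 2 ∂μ)) := by
  have hd : Tendsto (fun j => ∫ x, ‖(v j - w) x‖ ^ 2 ∂μ) atTop (𝓝 0) := by
    have h1 := ((ENNReal.tendsto_toReal (by simp)).comp h).pow 2
    simp only [ENNReal.toReal_zero, ne_eq, OfNat.ofNat_ne_zero, not_false_eq_true, zero_pow] at h1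
    exact h1.congr fun j => toReal_eLpNorm_two_sq ((hv j).sub hw)
  have hi := tendsto_integral_inner hw hv hw h
  have h2 := (hd.add (hi.const_mul 2)).sub_const (∫ x, ‖w x‖ ^ 2 ∂μ)
  simp only [real_inner_self_eq_norm_sq] at h2
  rw [show 0 + 2 * ∫ x, ‖w x‖ ^ 2 ∂μ - ∫ x, ‖w x‖ ^ 2 ∂μ = ∫ x, ‖w x‖ ^ 2 ∂μ by ring] at h2
  refine h2.congr fun j => ?_
  rw [← integral_const_mul, ← integral_add (integrable_norm_sq_of_memLp ((hv j).sub hw))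
    ((integrable_inner_of_memLp hw (hv j)).const_mul 2), sub_eq_iff_eq_add, ← integral_add
    (integrable_norm_sq_of_memLp (hv j)) (integrable_norm_sq_of_memLp hw)]
  refine integral_congr_ae (ae_of_all _ fun x => ?_)
  simp only [Pi.sub_apply, norm_sub_sq_real, real_inner_comm]
  ring

end Pairing

/-! ### Backward difference quotients in time -/

section TimeShift

variable {n : ℕ} {a : ℝ} {E : Type*} [NormedAddCommGroup E] [InnerProductSpace ℝ E]

lemma measurePreserving_timeShift (n : ℕ) (a h : ℝ) :
    MeasurePreserving (fun p : Thick n × ℝ => (p.1, p.2 - h)) (halfMeasureTime n a)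
      (halfMeasureTime n a) :=
  (MeasurePreserving.id _).prod (measurePreserving_sub_right volume h)

lemma integral_timeShift (F : Thick n × ℝ → ℝ) (h : ℝ) :
    ∫ p, F (p.1, p.2 - h) ∂(halfMeasureTime n a) = ∫ p, F p ∂(halfMeasureTime n a) := by
  refine (measurePreserving_timeShift n a h).integral_comp ?_ F
  exact (MeasurableEquiv.prodCongr (MeasurableEquiv.refl _)
    (MeasurableEquiv.subRight h)).measurableEmbedding

/-- For `u = f` this is `f · (f - f_h) ≥ (|f|² - |f_h|²)/2`, with `f_h` the time translate of `f`,
followed by a shift of the time variable that moves the difference onto `w`. Replacing `f` by `u`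
inside the quotient costs `‖u - f‖/h`, so `u` must be close to `f` relative to `h`. -/
lemma integral_inner_backward_difference_ge {f u : Thick n × ℝ → E}
    (hf : MemLp f 2 (halfMeasureTime n a)) (hu : MemLp u 2 (halfMeasureTime n a)) {h : ℝ}
    (hh : 0 < h) {w : Thick n × ℝ → ℝ} (hw : Continuous w) (hw0 : ∀ p, 0 ≤ w p) {M : ℝ}
    (hM : ∀ p, |w p| ≤ M) :
    (2 * h)⁻¹ * ∫ p, ‖f p‖ ^ 2 * (w p - w (p.1, p.2 + h)) ∂(halfMeasureTime n a)
      - 2 * M / h * ((eLpNorm f 2 (halfMeasureTime n a)).toReal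
        * (eLpNorm (u - f) 2 (halfMeasureTime n a)).toReal)
      ≤ ∫ p, inner ℝ (w p • f p) (h⁻¹ • (u p - u (p.1, p.2 - h))) ∂(halfMeasureTime n a) := by
  set μ := halfMeasureTime n a with hμ
  have hM0 : 0 ≤ M := (abs_nonneg _).trans (hM 0)
  have hsh := measurePreserving_timeShift n a h
  set e := u - f with he
  have hem : MemLp e 2 μ := hu.sub hf
  obtain ⟨fh, hfhd⟩ : ∃ fh : Thick n × ℝ → E, fh = fun p => f (p.1, p.2 - h) := ⟨_, rfl⟩
  obtain ⟨eh, hehd⟩ : ∃ eh : Thick n × ℝ → E, eh = fun p => e (p.1, p.2 - h) := ⟨_, rfl⟩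
  have hfh : MemLp fh 2 μ := hfhd ▸ hf.comp_measurePreserving hsh
  have heh : MemLp eh 2 μ := hehd ▸ hem.comp_measurePreserving hsh
  have hwf : MemLp (fun p => w p • f p) 2 μ := memLp_smul_of_bdd hf hw.aestronglyMeasurable hM
  have hwc : Continuous fun p : Thick n × ℝ => w (p.1, p.2 + h) := by fun_prop
  have i1 := integrable_inner_of_memLp hwf (hf.sub hfh)
  have i2 := integrable_inner_of_memLp hwf (hem.sub heh)
  have hf2 := integrable_norm_sq_of_memLp hf
  have hfh2 := integrable_norm_sq_of_memLp hfh
  have j1 : Integrable (fun p => ‖f p‖ ^ 2 * w p) μ :=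
    hf2.mul_bdd (c := M) hw.aestronglyMeasurable (ae_of_all _ hM)
  have j2 : Integrable (fun p => ‖fh p‖ ^ 2 * w p) μ :=
    hfh2.mul_bdd (c := M) hw.aestronglyMeasurable (ae_of_all _ hM)
  have j3 : Integrable (fun p => ‖f p‖ ^ 2 * w (p.1, p.2 + h)) μ :=
    hf2.mul_bdd (c := M) hwc.aestronglyMeasurable (ae_of_all _ fun p => hM _)
  have e1 : ∫ p, inner ℝ (w p • f p) (h⁻¹ • (u p - u (p.1, p.2 - h))) ∂μ =
      h⁻¹ * (∫ p, inner ℝ (w p • f p) ((f - fh) p) ∂μ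
        + ∫ p, inner ℝ (w p • f p) ((e - eh) p) ∂μ) := by
    rw [← integral_add i1 i2, ← integral_const_mul]
    refine integral_congr_ae (ae_of_all _ fun p => ?_)
    simp only [he, hfhd, hehd, Pi.sub_apply, inner_smul_right, ← inner_add_right]
    congr 2
    abel
  have e2 : ∫ p, ‖fh p‖ ^ 2 * w p ∂μ = ∫ p, ‖f p‖ ^ 2 * w (p.1, p.2 + h) ∂μ := by
    rw [← integral_timeShift (fun p => ‖f p‖ ^ 2 * w (p.1, p.2 + h)) h]
    simp [hfhd, hμ]
  have l1 : 2⁻¹ * ∫ p, ‖f p‖ ^ 2 * (w p - w (p.1, p.2 + h)) ∂μ ≤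
      ∫ p, inner ℝ (w p • f p) ((f - fh) p) ∂μ := by
    simp_rw [mul_sub]
    rw [integral_sub j1 j3, ← e2, ← integral_sub j1 j2, ← integral_const_mul]
    refine integral_mono ((j1.sub j2).const_mul _) i1 fun p => ?_
    simp only [Pi.sub_apply, inner_smul_left, inner_sub_right, real_inner_self_eq_norm_sq]
    have := real_inner_le_norm (f p) (fh p)
    have h3 : 0 ≤ w p := hw0 p
    simp only [conj_trivial]
    nlinarith [sq_nonneg (‖f p‖ - ‖fh p‖), mul_le_mul_of_nonneg_left this h3,
      mul_nonneg h3 (sq_nonneg (‖f p‖ - ‖fh p‖))]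
  have l2 : |∫ p, inner ℝ (w p • f p) ((e - eh) p) ∂μ| ≤
      2 * M * ((eLpNorm f 2 μ).toReal * (eLpNorm e 2 μ).toReal) := by
    refine (abs_integral_inner_le hwf (hem.sub heh)).trans ?_
    have n1 : (eLpNorm (fun p => w p • f p) 2 μ).toReal ≤ M * (eLpNorm f 2 μ).toReal := by
      have h1 : eLpNorm (fun p => w p • f p) 2 μ ≤ eLpNorm (M • f) 2 μ := by
        refine eLpNorm_mono_ae (ae_of_all _ fun p => ?_)
        rw [norm_smul, Pi.smul_apply, norm_smul]
        gcongr
        exact (hM p).trans (le_abs_self _)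
      have h2 := ENNReal.toReal_mono (hf.const_smul M).2.ne h1
      rwa [eLpNorm_const_smul, ENNReal.toReal_mul, Real.enorm_eq_ofReal hM0,
        ENNReal.toReal_ofReal hM0] at h2
    have n2 : (eLpNorm (e - eh) 2 μ).toReal ≤ 2 * (eLpNorm e 2 μ).toReal := by
      have h1 := eLpNorm_sub_le hem.1 heh.1 (p := 2) (by norm_num)
      have h3 : eLpNorm eh 2 μ = eLpNorm e 2 μ :=
        hehd ▸ eLpNorm_comp_measurePreserving hem.1 hsh
      rw [h3] at h1
      have h2 := ENNReal.toReal_mono (ENNReal.add_ne_top.2 ⟨hem.2.ne, hem.2.ne⟩) h1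
      rw [ENNReal.toReal_add hem.2.ne hem.2.ne] at h2
      linarith
    calc _ ≤ (M * (eLpNorm f 2 μ).toReal) * (2 * (eLpNorm e 2 μ).toReal) := by gcongr
      _ = _ := by ring
  rw [e1]
  have l3 := (abs_le.1 l2).1
  rw [mul_inv, mul_comm 2⁻¹, mul_assoc, div_mul_eq_mul_div, div_eq_inv_mul, ← mul_sub]
  gcongr
  linarith

/-- Dominated convergence: the difference quotients of `ζ²` are bounded by its Lipschitz constant
and tend to `-2ζ ∂_tζ` before halving. -/
lemma tendsto_backward_difference {f : Thick n × ℝ → E} (hf : MemLp f 2 (halfMeasureTime n a))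
    {ζ : Thick n × ℝ → ℝ} (hζ : ContDiff ℝ ∞ ζ) (hζs : HasCompactSupport ζ) :
    Tendsto (fun h : ℝ => (2 * h)⁻¹ *
      ∫ p, ‖f p‖ ^ 2 * (ζ p ^ 2 - ζ (p.1, p.2 + h) ^ 2) ∂(halfMeasureTime n a)) (𝓝[>] 0)
      (𝓝 (-∫ p, ‖f p‖ ^ 2 * (ζ p * partialT ζ p) ∂(halfMeasureTime n a))) := by
  have hw : ContDiff ℝ ∞ fun p => ζ p ^ 2 := hζ.pow 2
  have hws : HasCompactSupport fun p => ζ p ^ 2 := hζs.comp_left (g := fun x : ℝ => x ^ 2) (by simp)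
  obtain ⟨L, hL⟩ := (hw.lipschitzWith_of_hasCompactSupport hws (by simp))
  have hf2 := integrable_norm_sq_of_memLp hf
  simp_rw [← integral_const_mul, ← integral_neg]
  refine tendsto_integral_filter_of_dominated_convergence (fun p => ‖f p‖ ^ 2 * L) ?_ ?_
    (hf2.mul_const _) ?_
  · filter_upwards with h
    have hc : Continuous fun p : Thick n × ℝ => ζ p ^ 2 - ζ (p.1, p.2 + h) ^ 2 := by
      have := hζ.continuous
      fun_prop
    exact (hf2.1.mul hc.aestronglyMeasurable).const_mul _
  · filter_upwards [self_mem_nhdsWithin] with h hh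
    refine ae_of_all _ fun p => ?_
    have h1 := hL.dist_le_mul p (p.1, p.2 + h)
    rw [Real.dist_eq, Prod.dist_eq] at h1
    simp only [dist_self, Real.dist_eq, sub_add_cancel_left, abs_neg, abs_of_pos (show 0 < h from hh),
      max_eq_right (le_of_lt (show 0 < h from hh))] at h1
    have hh' : (0 : ℝ) < h := hh
    rw [Real.norm_eq_abs, abs_mul, abs_mul, abs_of_nonneg (sq_nonneg ‖f p‖),
      abs_of_pos (by positivity : 0 < (2 * h)⁻¹)]
    calc (2 * h)⁻¹ * (‖f p‖ ^ 2 * |ζ p ^ 2 - ζ (p.1, p.2 + h) ^ 2|)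
        ≤ (2 * h)⁻¹ * (‖f p‖ ^ 2 * (L * h)) := by gcongr
      _ = ‖f p‖ ^ 2 * L / 2 := by field_simp
      _ ≤ _ := by
        have : 0 ≤ ‖f p‖ ^ 2 * (L : ℝ) := by positivity
        linarith
  · refine ae_of_all _ fun p => ?_
    have hd : HasDerivAt (fun s : ℝ => ζ (p.1, p.2 + s)) (partialT ζ p) 0 := by
      have h1 : HasDerivAt (fun s : ℝ => (p.1, p.2 + s)) ((0 : Thick n), (1 : ℝ)) 0 :=
        (hasDerivAt_const _ _).prodMk ((hasDerivAt_id (0 : ℝ)).const_add p.2)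
      have h2 : HasFDerivAt ζ (fderiv ℝ ζ p) (p.1, p.2 + 0) := by
        simpa using (hζ.differentiable (by simp)).differentiableAt.hasFDerivAt
      exact h2.comp_hasDerivAt 0 h1
    have hd2 := (hd.pow 2).tendsto_slope_zero_right
    simp only [zero_add, add_zero, Nat.cast_ofNat, Nat.add_one_sub_one, pow_one, smul_eq_mul,
      Pi.pow_apply] at hd2
    have hd3 := (hd2.const_mul (-(‖f p‖ ^ 2) / 2))
    have e : -(‖f p‖ ^ 2 * (ζ p * partialT ζ p)) =
        -(‖f p‖ ^ 2) / 2 * (2 * ζ (p.1, p.2) * partialT ζ p) := by ring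
    rw [e]
    refine hd3.congr fun h => ?_
    rw [mul_inv]
    ring

end TimeShift

/-! ### Truncation of a weak solution -/

/-- The restriction of `f` to `𝔹₃⁺ × (0, 9)`, extended by zero. -/
def trunc {n : ℕ} {F : Type*} [Zero F] (f : Thick n × ℝ → F) : Thick n × ℝ → F :=
  (halfBall n 3 ×ˢ Ioo (0 : ℝ) 9).indicator f

/-- The restriction of `f` to `B₃ × (0, 9)`, extended by zero. -/
def thinTrunc {n : ℕ} {F : Type*} [Zero F] (f : Thin n × ℝ → F) : Thin n × ℝ → F :=
  (Metric.ball (0 : Thin n) 3 ×ˢ Ioo (0 : ℝ) 9).indicator f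

section Trunc

variable {n : ℕ} {a : ℝ} {F : Type*} [NormedAddCommGroup F]

lemma measurableSet_truncDomain (n : ℕ) : MeasurableSet (halfBall n 3 ×ˢ Ioo (0 : ℝ) 9) :=
  (measurableSet_halfBall n 3).prod measurableSet_Ioo

lemma isBounded_truncDomain (n : ℕ) : Bornology.IsBounded (halfBall n 3 ×ˢ Ioo (0 : ℝ) 9) :=
  (Metric.isBounded_ball.subset inter_subset_left).prod (Metric.isBounded_Ioo _ _)

lemma trunc_eq_zero_of_nonpos (f : Thick n × ℝ → F) {p : Thick n × ℝ} (hp : yCoord p.1 ≤ 0) :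
    trunc f p = 0 :=
  indicator_of_notMem (fun h => not_lt_of_ge hp h.1.2) _

lemma memLp_trunc {f : Thick n × ℝ → F} (hf : MemLp f 2 (weightMeasureTime n a 3 0 9)) :
    MemLp (trunc f) 2 (halfMeasureTime n a) := by
  rw [trunc, memLp_indicator_iff_restrict (measurableSet_truncDomain n)]
  rw [weightMeasureTime_eq] at hf
  exact hf.mono_measure (Measure.restrict_mono (prod_mono_left inter_subset_left) le_rfl)

lemma integrable_trunc (ha' : a < 1) {f : Thick n × ℝ → F}
    (hf : MemLp f 2 (weightMeasureTime n a 3 0 9)) : Integrable (trunc f) :=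
  integrable_of_memLp_halfMeasureTime ha' (isBounded_truncDomain n) (measurableSet_truncDomain n)
    (fun _ hp => hp.1.2) (fun _ hp => indicator_of_notMem hp _) (memLp_trunc hf)

lemma memLp_thinTrunc {f : Thin n × ℝ → F} (hf : MemLp f 2 (thinMeasureTime n 3 0 9)) :
    MemLp (thinTrunc f) 2 volume := by
  rw [thinTrunc, memLp_indicator_iff_restrict (Metric.isOpen_ball.measurableSet.prod
    measurableSet_Ioo), ← thinMeasureTime_eq]
  exact hf

lemma integrable_thinTrunc {f : Thin n × ℝ → F} (hf : MemLp f 2 (thinMeasureTime n 3 0 9)) :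
    Integrable (thinTrunc f) := by
  have hm : MeasurableSet (Metric.ball (0 : Thin n) 3 ×ˢ Ioo (0 : ℝ) 9) :=
    Metric.isOpen_ball.measurableSet.prod measurableSet_Ioo
  rw [thinTrunc, integrable_indicator_iff hm, IntegrableOn, ← thinMeasureTime_eq]
  have : IsFiniteMeasure (thinMeasureTime n 3 0 9) := by
    unfold thinMeasureTime
    have : IsFiniteMeasure (volume.restrict (Metric.ball (0 : Thin n) 3)) :=
      ⟨by simpa using measure_ball_lt_top⟩
    infer_instance
  exact hf.integrable (by norm_num)

end Trunc

/-! ### The weak gradient and the trace under mollification -/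

section WeakGradient

variable {n : ℕ} {U : Thick n × ℝ → Val n} {DU : Thick n × ℝ → Grad n} {T : Thin n × ℝ → Val n}

lemma partialX_eq_zero_of_notMem {F : Type*} [NormedAddCommGroup F] [NormedSpace ℝ F]
    {f : Thick n × ℝ → F} {p : Thick n × ℝ} (hp : p ∉ tsupport f) (i : Fin (n + 1)) :
    partialX f i p = 0 := by
  rw [partialX, fderiv_of_notMem_tsupport ℝ hp]; rfl

lemma partialT_eq_zero_of_notMem {F : Type*} [NormedAddCommGroup F] [NormedSpace ℝ F]
    {f : Thick n × ℝ → F} {p : Thick n × ℝ} (hp : p ∉ tsupport f) : partialT f p = 0 := by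
  rw [partialT, fderiv_of_notMem_tsupport ℝ hp]; rfl

lemma continuous_partialX {F : Type*} [NormedAddCommGroup F] [NormedSpace ℝ F]
    {f : Thick n × ℝ → F} (hf : ContDiff ℝ ∞ f) (i : Fin (n + 1)) : Continuous (partialX f i) :=
  (hf.continuous_fderiv (by simp)).clm_apply continuous_const

lemma continuous_partialT {F : Type*} [NormedAddCommGroup F] [NormedSpace ℝ F]
    {f : Thick n × ℝ → F} (hf : ContDiff ℝ ∞ f) : Continuous (partialT f) :=
  (hf.continuous_fderiv (by simp)).clm_apply continuous_const

lemma integrable_grad_apply {D : Thick n × ℝ → Grad n} (hD : Integrable D) (i : Fin (n + 1)) :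
    Integrable fun q => D q i :=
  (PiLp.proj 2 (𝕜 := ℝ) (fun _ : Fin (n + 1) => Val n) i).integrable_comp hD

/-- Test functions supported in `𝔹₃ × (0, 9)` do not see the truncation. The truncated functions are
globally integrable, so the integrals can be read as mollifications. -/
lemma HasWeakGradientAndTrace.integral_trunc (hg : HasWeakGradientAndTrace U DU T)
    (iU : Integrable (trunc U)) (iD : Integrable (trunc DU)) {ψ : Thick n × ℝ → ℝ}
    (hψ : ContDiff ℝ ∞ ψ) (hψc : HasCompactSupport ψ)
    (hψs : tsupport ψ ⊆ Metric.ball 0 3 ×ˢ Ioo 0 9) (i : Fin (n + 1)) :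
    (∫ q, partialX ψ i q • trunc U q) + ∫ q, ψ q • trunc DU q i =
      if i = Fin.last n then - ∫ q : Thin n × ℝ, ψ (thinPoint q.1, q.2) • thinTrunc T q else 0 := by
  have h := hg ψ hψ hψc (hψs.trans (prod_mono (Metric.ball_subset_ball (by norm_num))
    (Ioo_subset_Ioo le_rfl (by norm_num)))) i
  obtain ⟨C, hC⟩ := hψ.continuous.bounded_above_of_compact_support hψc
  obtain ⟨C', hC'⟩ := (continuous_partialX hψ i).bounded_above_of_compact_support
    (HasCompactSupport.of_support_subset_isCompact hψc.isCompact fun q hq => by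
      by_contra h'; exact hq (partialX_eq_zero_of_notMem h' i))
  have i1 : Integrable fun q => partialX ψ i q • trunc U q :=
    iU.bdd_smul C' (continuous_partialX hψ i).aestronglyMeasurable (ae_of_all _ hC')
  have i2 : Integrable fun q => ψ q • trunc DU q i :=
    (integrable_grad_apply iD i).bdd_smul C hψ.continuous.aestronglyMeasurable (ae_of_all _ hC)
  have e1 : (∫ q, partialX ψ i q • trunc U q) + ∫ q, ψ q • trunc DU q i =
      ∫ p in halfBall n 4 ×ˢ Ioo (0 : ℝ) 16, (partialX ψ i p • U p + ψ p • DU p i) := by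
    rw [← integral_add i1 i2, ← integral_indicator
      ((measurableSet_halfBall n 4).prod measurableSet_Ioo)]
    refine integral_congr_ae (ae_of_all _ fun q => ?_)
    by_cases hq : q ∈ halfBall n 3 ×ˢ Ioo (0 : ℝ) 9
    · have hq' : q ∈ halfBall n 4 ×ˢ Ioo (0 : ℝ) 16 :=
        ⟨⟨Metric.ball_subset_ball (by norm_num) hq.1.1, hq.1.2⟩, hq.2.1, hq.2.2.trans (by norm_num)⟩
      simp [trunc, indicator_of_mem hq, indicator_of_mem hq']
    · have h0 : (halfBall n 4 ×ˢ Ioo (0 : ℝ) 16).indicator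
          (fun p => partialX ψ i p • U p + ψ p • DU p i) q = 0 := by
        by_cases hq' : q ∈ halfBall n 4 ×ˢ Ioo (0 : ℝ) 16
        · have hs : q ∉ tsupport ψ := fun hs => hq ⟨⟨(hψs hs).1, hq'.1.2⟩, (hψs hs).2⟩
          rw [indicator_of_mem hq', partialX_eq_zero_of_notMem hs, image_eq_zero_of_notMem_tsupport hs]
          simp
        · exact indicator_of_notMem hq' _
      rw [h0]
      simp [trunc, indicator_of_notMem hq]
  have e2 : ∫ q : Thin n × ℝ, ψ (thinPoint q.1, q.2) • thinTrunc T q =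
      ∫ q in Metric.ball (0 : Thin n) 4 ×ˢ Ioo (0 : ℝ) 16, ψ (thinPoint q.1, q.2) • T q := by
    rw [← integral_indicator (Metric.isOpen_ball.measurableSet.prod measurableSet_Ioo)]
    refine integral_congr_ae (ae_of_all _ fun q => ?_)
    by_cases hq : q ∈ Metric.ball (0 : Thin n) 3 ×ˢ Ioo (0 : ℝ) 9
    · have hq' : q ∈ Metric.ball (0 : Thin n) 4 ×ˢ Ioo (0 : ℝ) 16 :=
        ⟨Metric.ball_subset_ball (by norm_num) hq.1, hq.2.1, hq.2.2.trans (by norm_num)⟩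
      simp [thinTrunc, indicator_of_mem hq, indicator_of_mem hq']
    · have hs : ψ (thinPoint q.1, q.2) = 0 := by
        refine image_eq_zero_of_notMem_tsupport fun hs => hq ⟨?_, (hψs hs).2⟩
        have := (hψs hs).1
        rw [mem_ball_zero_iff] at this ⊢
        rwa [← norm_thinPoint]
      simp [thinTrunc, indicator, hs]
  rw [e1, h, e2]

lemma mollify_grad_apply {κ : Thick n × ℝ → ℝ} (hκ : Continuous κ) (hs : HasCompactSupport κ)
    {D : Thick n × ℝ → Grad n} (hD : Integrable D) (p : Thick n × ℝ) (i : Fin (n + 1)) :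
    mollify κ D p i = mollify κ (fun q => D q i) p := by
  have := (PiLp.proj 2 (𝕜 := ℝ) (fun _ : Fin (n + 1) => Val n) i).integral_comp_comm
    (integrable_kernel_smul hκ hs hD p)
  exact this.symm

lemma contDiff_kernel_translate {κ : Thick n × ℝ → ℝ} (hκ : ContDiff ℝ ∞ κ) (p : Thick n × ℝ) :
    ContDiff ℝ ∞ fun q => κ (q - p) := hκ.comp (contDiff_id.sub contDiff_const)

lemma hasCompactSupport_kernel_translate {κ : Thick n × ℝ → ℝ} (hs : HasCompactSupport κ)
    (p : Thick n × ℝ) : HasCompactSupport fun q => κ (q - p) :=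
  hs.comp_homeomorph (Homeomorph.subRight p)

lemma partialX_kernel_translate (κ : Thick n × ℝ → ℝ) (p q : Thick n × ℝ) (i : Fin (n + 1)) :
    partialX (fun q => κ (q - p)) i q = partialX κ i (q - p) := by
  rw [partialX, partialX, fderiv_comp_sub]

lemma tsupport_kernel_translate_subset {κ : Thick n × ℝ → ℝ} {r s τ : ℝ}
    (hκ : ∀ z, κ z ≠ 0 → ‖z.1‖ ≤ r ∧ |z.2| ≤ s) (hr : r < 1) (hs : s < τ) (hs1 : s < 1)
    {p : Thick n × ℝ} (hp : p ∈ Metric.closedBall (0 : Thick n) 2 ×ˢ Icc τ 2) :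
    tsupport (fun q => κ (q - p)) ⊆ Metric.ball 0 3 ×ˢ Ioo 0 9 := by
  have h1 : tsupport (fun q => κ (q - p)) ⊆ Metric.closedBall p.1 r ×ˢ Metric.closedBall p.2 s := by
    refine closure_minimal (fun q hq => ?_) (Metric.isClosed_closedBall.prod
      Metric.isClosed_closedBall)
    have := hκ _ hq
    refine ⟨?_, ?_⟩
    · rw [Metric.mem_closedBall, dist_eq_norm]; exact this.1
    · rw [Metric.mem_closedBall, Real.dist_eq]; exact this.2
  refine h1.trans fun q hq => ⟨?_, ?_⟩
  · rw [mem_ball_zero_iff]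
    have h2 := hq.1
    rw [Metric.mem_closedBall, dist_eq_norm] at h2
    have h3 := mem_closedBall_zero_iff.1 hp.1
    have h4 := norm_le_norm_sub_add q.1 p.1
    linarith
  · have h2 := hq.2
    rw [Metric.mem_closedBall, Real.dist_eq, abs_le] at h2
    have h3 := hp.2
    constructor <;> linarith [h3.1, h3.2]

/-- The kernel lives in `y > 0`, so its translate by a point `p` with positive height vanishes on
`{y = 0}`. No boundary term appears, and the derivative commutes with the mollification. -/
lemma partialX_mollify_trunc (hg : HasWeakGradientAndTrace U DU T)
    (iU : Integrable (trunc U)) (iD : Integrable (trunc DU)) {κ : Thick n × ℝ → ℝ}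
    (hκ : ContDiff ℝ ∞ κ) (hκc : HasCompactSupport κ) {r s τ : ℝ}
    (hκs : ∀ z, κ z ≠ 0 → ‖z.1‖ ≤ r ∧ |z.2| ≤ s) (hκ0 : ∀ z : Thick n × ℝ, yCoord z.1 ≤ 0 → κ z = 0)
    (hr : r < 1) (hs : s < τ) (hs1 : s < 1) {p : Thick n × ℝ}
    (hp : p ∈ Metric.closedBall (0 : Thick n) 2 ×ˢ Icc τ 2) (hp0 : 0 < yCoord p.1)
    (i : Fin (n + 1)) :
    partialX (mollify κ (trunc U)) i p = mollify κ (fun q => trunc DU q i) p := by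
  have h := hg.integral_trunc iU iD (contDiff_kernel_translate hκ p)
    (hasCompactSupport_kernel_translate hκc p)
    (tsupport_kernel_translate_subset hκs hr hs hs1 hp) i
  have h0 : ∀ q : Thin n × ℝ, κ ((thinPoint q.1, q.2) - p) = 0 := fun q => by
    refine hκ0 _ ?_
    rw [Prod.fst_sub, yCoord_sub, ← glue_zero, yCoord_glue]
    linarith
  simp only [h0, zero_smul, integral_zero, neg_zero, ite_self, partialX_kernel_translate] at h
  rw [partialX, fderiv_mollify_apply hκ hκc iU]
  simp only [mollify]
  exact neg_eq_of_add_eq_zero_right h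

/-- The weak gradient identity is tested with the cutoff in `y`, which is 1 at `y = 0` and whose
derivative is `-yKernel` for `y > 0`: the derivative term produces the mollification of `U` at the
boundary point, the boundary term produces the mollified trace. -/
lemma mollify_trunc_thinPoint (hg : HasWeakGradientAndTrace U DU T)
    (iU : Integrable (trunc U)) (iD : Integrable (trunc DU)) {χ : Thin n → ℝ} {S : ℝ → ℝ}
    {δ : ℝ} (hδ : 0 < δ) (hχ : ContDiff ℝ ∞ χ) (hS : ContDiff ℝ ∞ S) {s τ : ℝ}
    (hχs : Function.support χ ⊆ Metric.ball 0 δ) (hSs : ∀ t, S t ≠ 0 → |t| ≤ s)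
    (hr : 3 * δ < 1) (hs : s < τ) (hs1 : s < 1) {p : Thin n × ℝ}
    (hp : p ∈ Metric.closedBall (0 : Thin n) 2 ×ˢ Icc τ 2) :
    mollify (prodKernel χ (yKernel δ) S) (trunc U) (thinPoint p.1, p.2) =
      mollify (thinProdKernel χ S) (thinTrunc T) p +
      ∫ q, prodKernel χ (yCutoff δ) S (q - (thinPoint p.1, p.2)) • trunc DU q (Fin.last n) := by
  have hb : ∀ y, yCutoff δ y ≠ 0 → |y| ≤ 2 * δ := fun y hy => by
    have : y ∈ Icc (-(2 * δ)) (2 * δ) := by by_contra h'; exact hy (yCutoff_eq_zero hδ h')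
    exact abs_le.2 this
  have hκ := contDiff_prodKernel hχ (contDiff_yCutoff δ) hS
  have hκc : HasCompactSupport (prodKernel χ (yCutoff δ) S) :=
    hasCompactSupport_prodKernel hχs hb hSs
  have h := hg.integral_trunc iU iD (contDiff_kernel_translate hκ (thinPoint p.1, p.2))
    (hasCompactSupport_kernel_translate hκc _)
    (tsupport_kernel_translate_subset (r := 3 * δ) (s := s) (τ := τ) (fun z hz => by
      have := mem_of_prodKernel_ne_zero hχs hb hSs hz
      exact ⟨this.1.le.trans (by linarith), this.2⟩) hr hs hs1
      ⟨by simpa [norm_thinPoint] using hp.1, hp.2⟩) (Fin.last n)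
  rw [if_pos rfl] at h
  have hthinP : ∀ x : Thin n, thinProj n (thinPoint x) = x := fun x => by
    rw [← glue_zero, thinProj_glue]
  have hthinY : ∀ x : Thin n, yCoord (thinPoint x) = 0 := fun x => by
    rw [← glue_zero, yCoord_glue]
  have e1 : ∫ q, partialX (fun q => prodKernel χ (yCutoff δ) S (q - (thinPoint p.1, p.2)))
      (Fin.last n) q • trunc U q =
      - mollify (prodKernel χ (yKernel δ) S) (trunc U) (thinPoint p.1, p.2) := by
    rw [mollify, ← integral_neg]
    refine integral_congr_ae (ae_of_all _ fun q => ?_)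
    simp only
    rcases le_or_gt (yCoord q.1) 0 with hq | hq
    · simp [trunc_eq_zero_of_nonpos U hq]
    · have hc : HasDerivAt (yCutoff δ) (-yKernel δ (yCoord q.1))
          (yCoord (q - (thinPoint p.1, p.2)).1) := by
        rw [Prod.fst_sub, yCoord_sub, hthinY, sub_zero]
        exact hasDerivAt_yCutoff hδ hq
      rw [partialX_kernel_translate, partialX_last_prodKernel hχ (contDiff_yCutoff δ) hS hc,
        ← neg_smul]
      congr 1
      simp only [prodKernel, Prod.fst_sub, yCoord_sub, hthinY, sub_zero]
      ring
  have e2 : ∫ q : Thin n × ℝ, prodKernel χ (yCutoff δ) S ((thinPoint q.1, q.2) -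
      (thinPoint p.1, p.2)) • thinTrunc T q = mollify (thinProdKernel χ S) (thinTrunc T) p := by
    refine integral_congr_ae (ae_of_all _ fun q => ?_)
    simp only [prodKernel, thinProdKernel, Prod.fst_sub, Prod.snd_sub, map_sub, hthinP, yCoord_sub,
      hthinY, sub_zero, yCutoff_zero hδ, mul_one]
  rw [e1, e2] at h
  rw [eq_comm, ← sub_eq_zero, ← sub_eq_zero.2 h]
  abel

end WeakGradient

/-! ### Smooth approximation of a weak solution -/

section Approximation

variable {n : ℕ} {a : ℝ}

lemma abs_le_of_yKernel_ne_zero {δ y : ℝ} (hδ : 0 < δ) (hy : yKernel δ y ≠ 0) : |y| ≤ 2 * δ := by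
  have : y ∈ Icc δ (2 * δ) := by by_contra h'; exact hy (yKernel_eq_zero hδ h')
  exact abs_le.2 ⟨by linarith [this.1], this.2⟩

lemma abs_le_of_boxKernel_ne_zero {δ h t : ℝ} (hδ : 0 < δ) (hh : 0 < h)
    (ht : boxKernel δ h t ≠ 0) : |t| ≤ δ + h := by
  have : t ∈ Icc (-h) δ := by by_contra h'; exact ht (boxKernel_eq_zero hδ hh h')
  exact abs_le.2 ⟨by linarith [this.1], by linarith [this.2]⟩

lemma abs_le_of_stepKernel_ne_zero {δ t : ℝ} (hδ : 0 < δ) (ht : stepKernel δ t ≠ 0) :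
    |t| ≤ δ := by
  have : t ∈ Icc 0 δ := by by_contra h'; exact ht (stepKernel_eq_zero hδ h')
  exact abs_le.2 ⟨by linarith [this.1], by linarith [this.2]⟩

/-- The bound `2r` on the time support accommodates the box kernel, whose support lies in `|t| ≤ δ +
h`, when both `δ` and `h` are at most `r`. -/
lemma exists_radius_mollify_prodKernel (ha : -1 < a) {F : Type*}
    [NormedAddCommGroup F] [NormedSpace ℝ F] [CompleteSpace F] {f : Thick n × ℝ → F}
    (hf2 : MemLp f 2 (halfMeasureTime n a)) (hf1 : Integrable f) {ε : ℝ≥0∞} (hε : ε ≠ 0) :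
    ∃ r : ℝ, 0 < r ∧ ∀ (δ : ℝ) (hδ : 0 < δ) (S : ℝ → ℝ), ContDiff ℝ ∞ S → (∀ t, 0 ≤ S t) →
      ∫⁻ t, ENNReal.ofReal (S t) = 1 → (∀ t, S t ≠ 0 → |t| ≤ 2 * r) → δ ≤ r →
      ∫⁻ p, ‖mollify (prodKernel (thinKernel n δ hδ) (yKernel δ) S) f p - f p‖ₑ ^ 2
        ∂(halfMeasureTime n a) ≤ ε := by
  obtain ⟨C, hC⟩ := exists_lintegral_yKernel_le ha
  have hfin := isFiniteMeasureOnCompacts_halfMeasureTime (n := n) ha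
  have hsf : SFinite (halfMeasureTime n a) := inferInstance
  rw [halfMeasureTime_eq] at hf2 hfin hsf ⊢
  obtain ⟨r, hr, H⟩ := exists_radius_mollify (W := fun p : Thick n × ℝ => yWeight n a p.1)
    ((measurable_yWeight n a).comp measurable_fst) hf2 hf1 C hε
  refine ⟨r / 4, by positivity, fun δ hδ S hS hS0 hS1 hSs hδr => ?_⟩
  have hκ := contDiff_prodKernel (n := n) (contDiff_thinKernel hδ) (contDiff_yKernel δ) hS
  refine H _ hκ.continuous (prodKernel_nonneg (thinKernel_nonneg hδ) (yKernel_nonneg hδ) hS0) ?_ ?_ ?_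
  · intro q hq
    have := mem_of_prodKernel_ne_zero (support_thinKernel hδ).subset
      (fun y => abs_le_of_yKernel_ne_zero hδ) hSs hq
    rw [mem_ball_zero_iff, Prod.norm_def, max_lt_iff]
    exact ⟨by linarith [this.1], by rw [Real.norm_eq_abs]; linarith [this.2]⟩
  · exact lintegral_prodKernel (contDiff_thinKernel hδ).continuous.measurable
      (contDiff_yKernel δ).continuous.measurable hS.continuous.measurable (thinKernel_nonneg hδ)
      (yKernel_nonneg hδ) (lintegral_thinKernel hδ) (lintegral_yKernel hδ) hS1
  · intro q
    rw [← halfMeasureTime_eq]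
    exact lintegral_prodKernel_halfMeasureTime_le (contDiff_thinKernel hδ).continuous.measurable
      (contDiff_yKernel δ).continuous.measurable hS.continuous.measurable (thinKernel_nonneg hδ)
      (yKernel_nonneg hδ) (fun y hy => yKernel_eq_zero hδ fun h => by linarith [h.1])
      (lintegral_thinKernel hδ) hS1 (hC δ hδ) q

lemma exists_radius_mollify_thinProdKernel {F : Type*}
    [NormedAddCommGroup F] [NormedSpace ℝ F] [CompleteSpace F] {f : Thin n × ℝ → F}
    (hf2 : MemLp f 2 volume) (hf1 : Integrable f) {ε : ℝ≥0∞} (hε : ε ≠ 0) :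
    ∃ r : ℝ, 0 < r ∧ ∀ (δ : ℝ) (hδ : 0 < δ) (S : ℝ → ℝ), ContDiff ℝ ∞ S → (∀ t, 0 ≤ S t) →
      ∫⁻ t, ENNReal.ofReal (S t) = 1 → (∀ t, S t ≠ 0 → |t| ≤ 2 * r) → δ ≤ r →
      ∫⁻ p, ‖mollify (thinProdKernel (thinKernel n δ hδ) S) f p - f p‖ₑ ^ 2 ≤ ε := by
  have hv : (volume : Measure (Thin n × ℝ)).withDensity 1 = volume := withDensity_one
  have hfin : IsFiniteMeasureOnCompacts (volume.withDensity (1 : Thin n × ℝ → ℝ≥0∞)) := by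
    rw [hv]; infer_instance
  have hsf : SFinite (volume.withDensity (1 : Thin n × ℝ → ℝ≥0∞)) := by
    rw [hv]; infer_instance
  rw [← hv] at hf2
  obtain ⟨r, hr, H⟩ := exists_radius_mollify measurable_one hf2 hf1 1 hε
  rw [hv] at H
  refine ⟨r / 4, by positivity, fun δ hδ S hS hS0 hS1 hSs hδr => ?_⟩
  have hκ : Continuous (thinProdKernel (thinKernel n δ hδ) S) :=
    ((contDiff_thinKernel hδ).continuous.comp continuous_fst).mul (hS.continuous.comp continuous_snd)
  have h1 : ∫⁻ q, ENNReal.ofReal (thinProdKernel (thinKernel n δ hδ) S q) = 1 :=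
    lintegral_thinProdKernel (contDiff_thinKernel hδ).continuous.measurable
      hS.continuous.measurable (thinKernel_nonneg hδ) (lintegral_thinKernel hδ) hS1
  refine H _ hκ (fun q => mul_nonneg (thinKernel_nonneg hδ _) (hS0 _)) ?_ h1 ?_
  · intro q hq
    have h2 := (support_thinKernel hδ).subset (left_ne_zero_of_mul hq)
    have h3 := hSs _ (right_ne_zero_of_mul hq)
    rw [mem_ball_zero_iff] at h2
    rw [mem_ball_zero_iff, Prod.norm_def, max_lt_iff]
    exact ⟨by linarith, by rw [Real.norm_eq_abs]; linarith⟩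
  · intro q
    rw [lintegral_sub_left_eq_self (fun p => ENNReal.ofReal (thinProdKernel (thinKernel n δ hδ) S p)),
      h1]
    simp

lemma exists_small_trace_remainder (ha' : a < 1) {A ε : ℝ≥0∞} (hA : A ≠ ⊤) (hε : ε ≠ 0) {r : ℝ}
    (hr : 0 < r) :
    ∃ δ : ℝ, 0 < δ ∧ δ ≤ r ∧ ENNReal.ofReal ((2 * δ) ^ (1 - a) / (1 - a)) * A ≤ ε := by
  have h1 : Tendsto (fun δ : ℝ => ENNReal.ofReal ((2 * δ) ^ (1 - a) / (1 - a)) * A) (𝓝 0) (𝓝 0) := by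
    have h2 : Tendsto (fun δ : ℝ => (2 * δ) ^ (1 - a) / (1 - a)) (𝓝 0) (𝓝 0) := by
      have : Continuous fun δ : ℝ => (2 * δ) ^ (1 - a) / (1 - a) :=
        ((continuous_const.mul continuous_id).rpow_const fun _ => Or.inr (by linarith)).div_const _
      have h3 := this.tendsto 0
      rwa [mul_zero, Real.zero_rpow (by linarith), zero_div] at h3
    have h4 := ENNReal.Tendsto.mul_const (b := A) (ENNReal.tendsto_ofReal h2) (Or.inr hA)
    simpa using h4
  have h5 := ((h1.mono_left nhdsWithin_le_nhds).eventually
    (ge_mem_nhds (pos_iff_ne_zero.2 hε))).and (Ioo_mem_nhdsGT hr)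
  obtain ⟨δ, h6, h7⟩ := h5.exists
  exact ⟨δ, h7.1, h7.2.le, h6⟩

/-- The mollification approximates `U`, its gradient and its trace simultaneously in `L²`. The time
derivative does not converge; only the lower bound in the last clause survives, which stands in for
`∫ ζ² U · ∂_tU = -∫ |U|² ζ ∂_tζ`. The set `𝔹₂ × [τ, 2]` contains the supports of the cutoffs used
later and stays away from time 0, where the backward average would leave the domain. -/
theorem exists_smooth_approx (ha : -1 < a) (ha' : a < 1) {U : Thick n × ℝ → Val n}
    {DU : Thick n × ℝ → Grad n} {T : Thin n × ℝ → Val n} (hg : HasWeakGradientAndTrace U DU T)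
    (mU : MemLp U 2 (weightMeasureTime n a 3 0 9)) (mD : MemLp DU 2 (weightMeasureTime n a 3 0 9))
    (mT : MemLp T 2 (thinMeasureTime n 3 0 9)) {ζ : Thick n × ℝ → ℝ} (hζ : ContDiff ℝ ∞ ζ)
    (hζc : HasCompactSupport ζ) {τ ε : ℝ} (hτ : 0 < τ) (hε : 0 < ε) :
    ∃ v : Thick n × ℝ → Val n, ContDiff ℝ ∞ v ∧
      ∫⁻ p, ‖v p - trunc U p‖ₑ ^ 2 ∂(halfMeasureTime n a) ≤ ENNReal.ofReal ε ∧
      ∫⁻ p in Metric.closedBall 0 2 ×ˢ Icc τ 2, ‖gradX v p - trunc DU p‖ₑ ^ 2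
        ∂(halfMeasureTime n a) ≤ ENNReal.ofReal ε ∧
      ∫⁻ q in Metric.closedBall (0 : Thin n) 2 ×ˢ Icc τ 2,
        ‖v (thinPoint q.1, q.2) - thinTrunc T q‖ₑ ^ 2 ≤ ENNReal.ofReal ε ∧
      -(∫ p, ‖trunc U p‖ ^ 2 * (ζ p * partialT ζ p) ∂(halfMeasureTime n a)) - ε ≤
        ∫ p, inner ℝ (ζ p ^ 2 • trunc U p) (partialT v p) ∂(halfMeasureTime n a) := by
  set μ := halfMeasureTime n a with hμ
  have iU := integrable_trunc ha' mU
  have iD := integrable_trunc ha' mD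
  have iT := integrable_thinTrunc mT
  have tU : MemLp (trunc U) 2 μ := memLp_trunc mU
  have tD : MemLp (trunc DU) 2 μ := memLp_trunc mD
  have tT := memLp_thinTrunc mT
  have hεe : ENNReal.ofReal ε ≠ 0 := by simpa using hε
  have hε18 : ENNReal.ofReal (ε / 18) ≠ 0 := by simpa using hε
  obtain ⟨r₁, hr₁, H₁⟩ := exists_radius_mollify_prodKernel ha tU iU hεe
  obtain ⟨r₂, hr₂, H₂⟩ := exists_radius_mollify_prodKernel ha tD iD hεe
  obtain ⟨r₃, hr₃, H₃⟩ := exists_radius_mollify_thinProdKernel tT iT hε18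
  have hlim := tendsto_backward_difference tU hζ hζc
  -- The averaging length `h` is fixed first; the smoothing scale `δ` is chosen afterwards, small
  -- compared with `h`.
  have hpos : 0 < min (min r₁ r₂) (min r₃ (min (τ / 4) (1 / 4))) := by positivity
  obtain ⟨h, hh1, hh0, hh2⟩ := ((hlim.eventually (lt_mem_nhds (show
    -(∫ p, ‖trunc U p‖ ^ 2 * (ζ p * partialT ζ p) ∂μ) - ε / 2 <
      -∫ p, ‖trunc U p‖ ^ 2 * (ζ p * partialT ζ p) ∂μ by linarith))).and
    (Ioo_mem_nhdsGT hpos)).exists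
  simp only [lt_min_iff] at hh2
  obtain ⟨⟨hhr₁, hhr₂⟩, hhr₃, hhτ, hh4⟩ := hh2
  obtain ⟨M, hM⟩ : ∃ M : ℝ, ∀ p, |ζ p ^ 2| ≤ M := by
    obtain ⟨M, hM⟩ := hζ.continuous.bounded_above_of_compact_support hζc
    refine ⟨M ^ 2, fun p => ?_⟩
    rw [abs_pow]
    exact pow_le_pow_left₀ (abs_nonneg _) (hM p) 2
  have hM0 : 0 ≤ M := (abs_nonneg _).trans (hM 0)
  set A := (eLpNorm (trunc U) 2 μ).toReal with hA
  have hA0 : 0 ≤ A := ENNReal.toReal_nonneg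
  -- Chosen so that the error `2M/h · A · σ` of the difference quotient is at most `ε/2`.
  set σ := ε * h / (4 * (M + 1) * (A + 1)) with hσ
  have hσ0 : 0 < σ := by positivity
  obtain ⟨r₄, hr₄, H₄⟩ := exists_radius_mollify_prodKernel ha tU iU
    (ε := ENNReal.ofReal σ ^ 2) (by simpa using hσ0)
  have hDfin : ∫⁻ q, ‖trunc DU q‖ₑ ^ 2 ∂μ ≠ ⊤ := by
    rw [lintegral_enorm_sq_eq]
    exact (ENNReal.pow_lt_top tD.2).ne
  obtain ⟨δ, hδ, hδr, hδD⟩ := exists_small_trace_remainder ha' hDfin hε18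
    (show 0 < min h r₄ by positivity)
  obtain ⟨hδh, hδr₄⟩ := le_min_iff.1 hδr
  have hχ := contDiff_thinKernel (n := n) hδ
  have hk := contDiff_yKernel δ
  have hβ := contDiff_boxKernel δ h
  have hρ := contDiff_stepKernel δ
  have hβ0 := boxKernel_nonneg hδ hh0
  have hβ1 := lintegral_boxKernel hδ hh0
  have hχs : Function.support (thinKernel n δ hδ) ⊆ Metric.ball 0 δ := (support_thinKernel hδ).subset
  have hks : ∀ y, yKernel δ y ≠ 0 → |y| ≤ 2 * δ := fun y => abs_le_of_yKernel_ne_zero hδ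
  have hβs : ∀ t, boxKernel δ h t ≠ 0 → |t| ≤ δ + h := fun t => abs_le_of_boxKernel_ne_zero hδ hh0
  have hρs : ∀ t, stepKernel δ t ≠ 0 → |t| ≤ δ := fun t => abs_le_of_stepKernel_ne_zero hδ
  set κ : Thick n × ℝ → ℝ := prodKernel (thinKernel n δ hδ) (yKernel δ) (boxKernel δ h) with hκd
  set κ₀ : Thick n × ℝ → ℝ := prodKernel (thinKernel n δ hδ) (yKernel δ) (stepKernel δ) with hκ₀d
  have hκ : ContDiff ℝ ∞ κ := contDiff_prodKernel hχ hk hβ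
  have hκ₀ : ContDiff ℝ ∞ κ₀ := contDiff_prodKernel hχ hk hρ
  have hκc : HasCompactSupport κ := hasCompactSupport_prodKernel hχs hks hβs
  have hκ₀c : HasCompactSupport κ₀ := hasCompactSupport_prodKernel hχs hks hρs
  have hRm : MeasurableSet (Metric.closedBall (0 : Thick n) 2 ×ˢ Icc τ 2) :=
    Metric.isClosed_closedBall.measurableSet.prod measurableSet_Icc
  have hRm' : MeasurableSet (Metric.closedBall (0 : Thin n) 2 ×ˢ Icc τ 2) :=
    Metric.isClosed_closedBall.measurableSet.prod measurableSet_Icc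
  refine ⟨mollify κ (trunc U), contDiff_mollify hκ hκc iU, ?_, ?_, ?_, ?_⟩
  · exact H₁ δ hδ _ hβ hβ0 hβ1 (fun t ht => (hβs t ht).trans (by linarith)) (by linarith)
  · calc _ ≤ ∫⁻ p in Metric.closedBall 0 2 ×ˢ Icc τ 2,
            ‖mollify κ (trunc DU) p - trunc DU p‖ₑ ^ 2 ∂μ := by
          refine lintegral_mono_ae ?_
          filter_upwards [ae_restrict_mem hRm, ae_restrict_of_ae (ae_halfMeasureTime_pos n a)]
            with p hp hp0
          have : gradX (mollify κ (trunc U)) p = mollify κ (trunc DU) p := by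
            refine PiLp.ext fun i => ?_
            rw [mollify_grad_apply hκ.continuous hκc iD]
            exact partialX_mollify_trunc hg iU iD hκ hκc (r := 3 * δ) (s := δ + h) (fun z hz => by
              have := mem_of_prodKernel_ne_zero hχs hks hβs hz
              exact ⟨by linarith [this.1], this.2⟩)
              (fun z hz => by
                simp only [hκd, prodKernel]
                rw [yKernel_eq_zero hδ fun h => by linarith [h.1], mul_zero, zero_mul])
              (by linarith) (by linarith) (by linarith) hp hp0 i
          rw [this]
      _ ≤ ∫⁻ p, ‖mollify κ (trunc DU) p - trunc DU p‖ₑ ^ 2 ∂μ := setLIntegral_le_lintegral _ _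
      _ ≤ _ := H₂ δ hδ _ hβ hβ0 hβ1 (fun t ht => (hβs t ht).trans (by linarith)) (by linarith)
  · set R : Thin n × ℝ → Val n := fun p =>
      ∫ q, prodKernel (thinKernel n δ hδ) (yCutoff δ) (boxKernel δ h) (q - (thinPoint p.1, p.2)) •
        trunc DU q (Fin.last n) with hR
    set m := mollify (thinProdKernel (thinKernel n δ hδ) (boxKernel δ h)) (thinTrunc T) with hm
    have hv : ∀ p ∈ Metric.closedBall (0 : Thin n) 2 ×ˢ Icc τ 2,
        mollify κ (trunc U) (thinPoint p.1, p.2) = m p + R p := fun p hp =>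
      mollify_trunc_thinPoint hg iU iD hδ hχ hβ hχs hβs (by linarith) (by linarith) (by linarith) hp
    have hm1 : ∫⁻ p, ‖m p - thinTrunc T p‖ₑ ^ 2 ≤ ENNReal.ofReal (ε / 18) :=
      H₃ δ hδ _ hβ hβ0 hβ1 (fun t ht => (hβs t ht).trans (by linarith)) (by linarith)
    have hgm : AEStronglyMeasurable (fun q => trunc DU q (Fin.last n)) :=
      (integrable_grad_apply iD _).1
    have hR1 : ∫⁻ p, ‖R p‖ₑ ^ 2 ≤ ENNReal.ofReal (ε / 18) := by
      refine (lintegral_trace_remainder_le ha' hδ hχ.continuous.measurable hβ.continuous.measurable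
        (thinKernel_nonneg hδ) hβ0 (lintegral_thinKernel hδ) hβ1
        (fun p hp => by rw [trunc_eq_zero_of_nonpos DU hp]; rfl) hgm).trans (le_trans ?_ hδD)
      gcongr with q
      exact enorm_le_iff_norm_le.2 (PiLp.norm_apply_le (trunc DU q) (Fin.last n))
    have hmm : AEMeasurable (fun p => ‖m p - thinTrunc T p‖ₑ ^ 2) volume := by
      refine (AEStronglyMeasurable.enorm ?_).pow_const 2
      refine (Continuous.aestronglyMeasurable ?_).sub iT.1
      have hcs : HasCompactSupport (thinProdKernel (thinKernel n δ hδ) (boxKernel δ h)) := by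
        refine HasCompactSupport.of_support_subset_isCompact
          ((isCompact_closedBall (0 : Thin n) δ).prod (isCompact_closedBall (0 : ℝ) (δ + h)))
          fun q hq => ⟨Metric.ball_subset_closedBall (hχs (left_ne_zero_of_mul hq)), ?_⟩
        exact mem_closedBall_zero_iff.2 (hβs _ (right_ne_zero_of_mul hq))
      exact (contDiff_mollify ((hχ.comp contDiff_fst).mul (hβ.comp contDiff_snd)) hcs iT).continuous
    calc _ ≤ ∫⁻ q in Metric.closedBall (0 : Thin n) 2 ×ˢ Icc τ 2,
            9 * (‖m q - thinTrunc T q‖ₑ ^ 2 + ‖R q‖ₑ ^ 2) := by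
          refine setLIntegral_mono' hRm' fun q hq => ?_
          rw [hv q hq, show m q + R q - thinTrunc T q = (m q - thinTrunc T q) + R q by abel]
          have h1 := ENNReal.add_add_sq_le ‖m q - thinTrunc T q‖ₑ ‖R q‖ₑ 0
          simp only [add_zero, ne_eq, OfNat.ofNat_ne_zero, not_false_eq_true, zero_pow] at h1
          exact (pow_le_pow_left₀ zero_le (enorm_add_le _ _) 2).trans h1
      _ ≤ ∫⁻ q, 9 * (‖m q - thinTrunc T q‖ₑ ^ 2 + ‖R q‖ₑ ^ 2) := setLIntegral_le_lintegral _ _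
      _ = 9 * ((∫⁻ q, ‖m q - thinTrunc T q‖ₑ ^ 2) + ∫⁻ q, ‖R q‖ₑ ^ 2) := by
          rw [lintegral_const_mul' _ _ (by simp), lintegral_add_left' hmm]
      _ ≤ 9 * (ENNReal.ofReal (ε / 18) + ENNReal.ofReal (ε / 18)) := by gcongr
      _ = ENNReal.ofReal ε := by
          rw [← ENNReal.ofReal_add (by positivity) (by positivity),
            show (9 : ℝ≥0∞) = ENNReal.ofReal 9 by simp, ← ENNReal.ofReal_mul (by norm_num)]
          congr 1
          ring
  · have hu : ContDiff ℝ ∞ (mollify κ₀ (trunc U)) := contDiff_mollify hκ₀ hκ₀c iU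
    have hue : eLpNorm (mollify κ₀ (trunc U) - trunc U) 2 μ ≤ ENNReal.ofReal σ := by
      refine eLpNorm_two_le_of_lintegral ?_
      exact H₄ δ hδ _ hρ (stepKernel_nonneg hδ) (lintegral_stepKernel hδ)
        (fun t ht => (hρs t ht).trans (by linarith)) hδr₄
    have hud : MemLp (mollify κ₀ (trunc U) - trunc U) 2 μ :=
      ⟨hu.continuous.aestronglyMeasurable.sub tU.1, hue.trans_lt ENNReal.ofReal_lt_top⟩
    have hum : MemLp (mollify κ₀ (trunc U)) 2 μ := by simpa using hud.add tU
    have key := integral_inner_backward_difference_ge tU hum hh0 (w := fun p => ζ p ^ 2)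
      (hζ.continuous.pow 2) (fun p => sq_nonneg _) hM
    have hσ1 : (eLpNorm (mollify κ₀ (trunc U) - trunc U) 2 μ).toReal ≤ σ :=
      ENNReal.toReal_le_of_le_ofReal hσ0.le hue
    have herr : 2 * M / h * (A * (eLpNorm (mollify κ₀ (trunc U) - trunc U) 2 μ).toReal) ≤ ε / 2 := by
      calc _ ≤ 2 * M / h * (A * σ) := by gcongr
        _ = (M / (M + 1)) * (A / (A + 1)) * (ε / 2) := by
          rw [hσ]; field_simp; ring
        _ ≤ 1 * 1 * (ε / 2) := by
          gcongr
          · exact div_le_one_of_le₀ (by linarith) (by linarith)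
          · exact div_le_one_of_le₀ (by linarith) (by linarith)
        _ = ε / 2 := by ring
    have hpt : ∀ p, partialT (mollify κ (trunc U)) p =
        h⁻¹ • (mollify κ₀ (trunc U) p - mollify κ₀ (trunc U) (p.1, p.2 - h)) :=
      partialT_mollify_box hδ hh0 hχ hk hχs hks iU
    simp only [hpt]
    linarith

end Approximation

/-! ### A weighted trace inequality for smooth functions -/

/-- Write `g(0) = g(y) - ∫₀^y g'`, bound the integral by Cauchy–Schwarz with `y^{-a}`, and average
over `y ∈ (0, δ)` with respect to `y^a dy`. -/
lemma enorm_sq_zero_le_lintegral_rpow {E : Type*} [NormedAddCommGroup E] [NormedSpace ℝ E]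
    [CompleteSpace E] {a : ℝ} (ha : -1 < a) (ha' : a < 1) {δ : ℝ} (hδ : 0 < δ) {g g' : ℝ → E}
    (hg : ∀ y, HasDerivAt g (g' y) y) (hg' : Continuous g') :
    ‖g 0‖ₑ ^ 2 ≤
      9 * (ENNReal.ofReal (δ ^ (a + 1) / (a + 1)))⁻¹ *
        (∫⁻ y in Ioi 0, ENNReal.ofReal (y ^ a) * ‖g y‖ₑ ^ 2) +
      9 * ENNReal.ofReal (δ ^ (-a + 1) / (-a + 1)) *
        ∫⁻ y in Ioi 0, ENNReal.ofReal (y ^ a) * ‖g' y‖ₑ ^ 2 := by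
  have hgc : Continuous g := continuous_iff_continuousAt.2 fun y => (hg y).continuousAt
  have hrm : ∀ b : ℝ, Measurable fun y : ℝ => ENNReal.ofReal (y ^ b) := fun b =>
    (measurable_id.pow_const b).ennreal_ofReal
  set W := ENNReal.ofReal (δ ^ (a + 1) / (a + 1)) with hW
  have hW0 : W ≠ 0 := by
    have : 0 < δ ^ (a + 1) / (a + 1) := div_pos (Real.rpow_pos_of_pos hδ _) (by linarith)
    simpa [hW] using this
  have hWt : W ≠ ⊤ := ENNReal.ofReal_ne_top
  set D := ENNReal.ofReal (δ ^ (-a + 1) / (-a + 1)) *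
    ∫⁻ y in Ioi 0, ENNReal.ofReal (y ^ a) * ‖g' y‖ₑ ^ 2 with hD
  have h1 : (∫⁻ y in Ioo 0 δ, ‖g' y‖ₑ) ^ 2 ≤ D := by
    have hCS := lintegral_mul_sq_le_weighted (volume.restrict (Ioo 0 δ)) (hrm (-a)).aemeasurable
      (f := fun y => ENNReal.ofReal (y ^ a) * ‖g' y‖ₑ)
      ((hrm a).mul hg'.enorm.measurable).aemeasurable
    have hmul : ∀ y ∈ Ioo (0 : ℝ) δ, ENNReal.ofReal (y ^ (-a)) * ENNReal.ofReal (y ^ a) = 1 := by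
      intro y hy
      rw [← ENNReal.ofReal_mul (Real.rpow_nonneg hy.1.le _), ← Real.rpow_add hy.1]
      simp
    have e1 : ∫⁻ y in Ioo 0 δ, ENNReal.ofReal (y ^ (-a)) * (ENNReal.ofReal (y ^ a) * ‖g' y‖ₑ) =
        ∫⁻ y in Ioo 0 δ, ‖g' y‖ₑ :=
      setLIntegral_congr_fun measurableSet_Ioo fun y hy => by rw [← mul_assoc, hmul y hy, one_mul]
    have e2 : ∫⁻ y in Ioo 0 δ, ENNReal.ofReal (y ^ (-a)) *
        (ENNReal.ofReal (y ^ a) * ‖g' y‖ₑ) ^ 2 =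
        ∫⁻ y in Ioo 0 δ, ENNReal.ofReal (y ^ a) * ‖g' y‖ₑ ^ 2 :=
      setLIntegral_congr_fun measurableSet_Ioo fun y hy => by
        rw [mul_pow, sq (ENNReal.ofReal (y ^ a)), ← mul_assoc, ← mul_assoc, hmul y hy, one_mul]
    rw [e1, e2, lintegral_rpow_Ioo (by linarith) hδ.le] at hCS
    refine hCS.trans ?_
    rw [hD]
    gcongr
    exact Ioo_subset_Ioi_self
  have h2 : ∀ y ∈ Ioo (0 : ℝ) δ, ‖g 0‖ₑ ^ 2 ≤ 9 * (‖g y‖ₑ ^ 2 + D) := by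
    intro y hy
    have hint : ∫ s in (0 : ℝ)..y, g' s = g y - g 0 :=
      intervalIntegral.integral_eq_sub_of_hasDerivAt (fun s _ => hg s) (hg'.intervalIntegrable _ _)
    have h3 : ‖g 0‖ₑ ≤ ‖g y‖ₑ + (∫⁻ y in Ioo 0 δ, ‖g' y‖ₑ) + 0 := by
      have : g 0 = g y - ∫ s in (0 : ℝ)..y, g' s := by rw [hint]; abel
      rw [this, add_zero]
      refine enorm_sub_le.trans ?_
      gcongr
      rw [intervalIntegral.integral_of_le hy.1.le]
      refine (enorm_integral_le_lintegral_enorm _).trans ?_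
      exact lintegral_mono_set fun s hs => ⟨hs.1, hs.2.trans_lt hy.2⟩
    calc _ ≤ (‖g y‖ₑ + (∫⁻ y in Ioo 0 δ, ‖g' y‖ₑ) + 0) ^ 2 := pow_le_pow_left₀ zero_le h3 2
      _ ≤ 9 * (‖g y‖ₑ ^ 2 + (∫⁻ y in Ioo 0 δ, ‖g' y‖ₑ) ^ 2 + 0 ^ 2) := ENNReal.add_add_sq_le _ _ _
      _ ≤ _ := by
        rw [zero_pow two_ne_zero, add_zero]
        gcongr
  have h3 : W * ‖g 0‖ₑ ^ 2 ≤
      9 * (∫⁻ y in Ioi 0, ENNReal.ofReal (y ^ a) * ‖g y‖ₑ ^ 2) + W * (9 * D) := by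
    have hgm : Measurable fun y => ENNReal.ofReal (y ^ a) * ‖g y‖ₑ ^ 2 :=
      (hrm a).mul (hgc.enorm.measurable.pow_const 2)
    calc W * ‖g 0‖ₑ ^ 2 = ∫⁻ y in Ioo 0 δ, ENNReal.ofReal (y ^ a) * ‖g 0‖ₑ ^ 2 := by
          rw [lintegral_mul_const _ (hrm a), lintegral_rpow_Ioo ha hδ.le]
      _ ≤ ∫⁻ y in Ioo 0 δ, (9 * (ENNReal.ofReal (y ^ a) * ‖g y‖ₑ ^ 2) +
            ENNReal.ofReal (y ^ a) * (9 * D)) := by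
          refine setLIntegral_mono' measurableSet_Ioo fun y hy => ?_
          calc _ ≤ ENNReal.ofReal (y ^ a) * (9 * (‖g y‖ₑ ^ 2 + D)) := by gcongr; exact h2 y hy
            _ = _ := by ring
      _ = 9 * (∫⁻ y in Ioo 0 δ, ENNReal.ofReal (y ^ a) * ‖g y‖ₑ ^ 2) + W * (9 * D) := by
          rw [lintegral_add_left (hgm.const_mul 9), lintegral_const_mul _ hgm,
            lintegral_mul_const _ (hrm a), lintegral_rpow_Ioo ha hδ.le]
      _ ≤ _ := by
          gcongr
          exact Ioo_subset_Ioi_self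
  calc ‖g 0‖ₑ ^ 2 = W⁻¹ * (W * ‖g 0‖ₑ ^ 2) := by
        rw [← mul_assoc, ENNReal.inv_mul_cancel hW0 hWt, one_mul]
    _ ≤ W⁻¹ * (9 * (∫⁻ y in Ioi 0, ENNReal.ofReal (y ^ a) * ‖g y‖ₑ ^ 2) + W * (9 * D)) := by gcongr
    _ = 9 * W⁻¹ * (∫⁻ y in Ioi 0, ENNReal.ofReal (y ^ a) * ‖g y‖ₑ ^ 2) + (W⁻¹ * W) * (9 * D) := by
        ring
    _ = _ := by rw [ENNReal.inv_mul_cancel hW0 hWt, one_mul, hD, mul_assoc 9 (ENNReal.ofReal _)]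

lemma hasDerivAt_glue {n : ℕ} {E : Type*} [NormedAddCommGroup E] [NormedSpace ℝ E]
    {g : Thick n × ℝ → E} (hg : ContDiff ℝ ∞ g) (x : Thin n) (t y : ℝ) :
    HasDerivAt (fun y => g (glue x y, t)) (partialX g (Fin.last n) (glue x y, t)) y := by
  have h1 : HasDerivAt (fun y : ℝ => (glue x y, t))
      (EuclideanSpace.single (Fin.last n) (1 : ℝ), (0 : ℝ)) y := by
    refine HasDerivAt.prodMk ?_ (hasDerivAt_const _ _)
    rw [show glue x = fun y => thinPoint x + y • EuclideanSpace.single (Fin.last n) (1 : ℝ) from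
      funext fun y => glue_eq_add x y]
    simpa using ((hasDerivAt_id y).smul_const (EuclideanSpace.single (Fin.last n) (1 : ℝ))).const_add
      (thinPoint x)
  have h2 : HasFDerivAt g (fderiv ℝ g (glue x y, t)) (glue x y, t) :=
    (hg.differentiable (by simp)).differentiableAt.hasFDerivAt
  exact h2.comp_hasDerivAt y h1

/-- The one-dimensional inequality is applied on each vertical line and integrated. The gradient
coefficient is of order `δ^{1-a}`, hence can be made smaller than `ε`, at the price of a large `C`.
-/
lemma exists_trace_inequality (n : ℕ) {a : ℝ} (ha : -1 < a) (ha' : a < 1) {ε : ℝ} (hε : 0 < ε) :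
    ∃ C : ℝ≥0, ∀ {E : Type} [NormedAddCommGroup E] [NormedSpace ℝ E] [CompleteSpace E]
      {g : Thick n × ℝ → E}, ContDiff ℝ ∞ g →
      ∫⁻ q : Thin n × ℝ, ‖g (thinPoint q.1, q.2)‖ₑ ^ 2 ≤
        C * ∫⁻ p, ‖g p‖ₑ ^ 2 ∂(halfMeasureTime n a) +
        ENNReal.ofReal ε * ∫⁻ p, ‖partialX g (Fin.last n) p‖ₑ ^ 2 ∂(halfMeasureTime n a) := by
  obtain ⟨δ, hδ, -, hδε⟩ := exists_small_trace_remainder ha' (A := 9) (ε := ENNReal.ofReal ε)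
    (r := 1) (by simp) (by simpa using hε) one_pos
  set δ' := 2 * δ with hδ'
  have hδ'0 : 0 < δ' := by positivity
  have hpos : 0 < δ' ^ (a + 1) / (a + 1) := div_pos (Real.rpow_pos_of_pos hδ'0 _) (by linarith)
  refine ⟨9 * (Real.toNNReal (δ' ^ (a + 1) / (a + 1)))⁻¹, fun {E} _ _ _ {g} hg => ?_⟩
  have hW : ((9 * (Real.toNNReal (δ' ^ (a + 1) / (a + 1)))⁻¹ : ℝ≥0) : ℝ≥0∞) =
      9 * (ENNReal.ofReal (δ' ^ (a + 1) / (a + 1)))⁻¹ := by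
    rw [ENNReal.coe_mul, ENNReal.coe_inv (by simpa using hpos)]
    rfl
  have hgy := continuous_partialX hg (Fin.last n)
  have m1 : Measurable fun p => ‖g p‖ₑ ^ 2 := hg.continuous.enorm.measurable.pow_const 2
  have m2 : Measurable fun p => ‖partialX g (Fin.last n) p‖ₑ ^ 2 := hgy.enorm.measurable.pow_const 2
  have hexp : ∀ f : Thick n × ℝ → ℝ≥0∞, Measurable f → ∫⁻ p, f p ∂(halfMeasureTime n a) =
      ∫⁻ q : Thin n × ℝ, ∫⁻ y in Ioi 0, ENNReal.ofReal (y ^ a) * f (glue q.1 y, q.2) := by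
    intro f hf
    have hm : Measurable fun q : Thin n × ℝ =>
        ∫⁻ y in Ioi 0, ENNReal.ofReal (y ^ a) * f (glue q.1 y, q.2) := by
      refine Measurable.lintegral_prod_right' (f := fun z : (Thin n × ℝ) × ℝ =>
        ENNReal.ofReal (z.2 ^ a) * f (glue z.1.1 z.2, z.1.2)) ?_
      refine (measurable_snd.pow_const a).ennreal_ofReal.mul (hf.comp ?_)
      exact (continuous_glue.measurable.comp ((measurable_fst.comp measurable_fst).prodMk
        measurable_snd)).prodMk (measurable_snd.comp measurable_fst)
    rw [halfMeasureTime, lintegral_prod_symm' _ hf]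
    change _ = ∫⁻ q : Thin n × ℝ, _ ∂(volume.prod volume)
    rw [lintegral_prod_symm' _ hm]
    refine lintegral_congr fun t => ?_
    exact lintegral_halfMeasure (f := fun X => f (X, t))
      (hf.comp (measurable_id.prodMk measurable_const))
  have hm : Measurable fun q : Thin n × ℝ =>
      ∫⁻ y in Ioi 0, ENNReal.ofReal (y ^ a) * ‖g (glue q.1 y, q.2)‖ₑ ^ 2 := by
    refine Measurable.lintegral_prod_right' (f := fun z : (Thin n × ℝ) × ℝ =>
      ENNReal.ofReal (z.2 ^ a) * ‖g (glue z.1.1 z.2, z.1.2)‖ₑ ^ 2) ?_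
    refine (measurable_snd.pow_const a).ennreal_ofReal.mul (m1.comp ?_)
    exact (continuous_glue.measurable.comp ((measurable_fst.comp measurable_fst).prodMk
      measurable_snd)).prodMk (measurable_snd.comp measurable_fst)
  have hδε2 : 9 * ENNReal.ofReal (δ' ^ (-a + 1) / (-a + 1)) ≤ ENNReal.ofReal ε := by
    rw [mul_comm, show -a + 1 = 1 - a by ring]
    exact hδε
  rw [hW, hexp _ m1, hexp _ m2, ← lintegral_const_mul' _ _ ENNReal.ofReal_ne_top,
    ← lintegral_const_mul _ hm, ← lintegral_add_left (hm.const_mul _)]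
  refine lintegral_mono fun q => ?_
  have h1 := enorm_sq_zero_le_lintegral_rpow ha ha' hδ'0 (g := fun y => g (glue q.1 y, q.2))
    (fun y => hasDerivAt_glue hg q.1 q.2 y)
    (hgy.comp ((continuous_glue.comp (continuous_const.prodMk continuous_id)).prodMk
      continuous_const))
  simp only [glue_zero] at h1
  refine h1.trans ?_
  gcongr

/-! ### Product rules for cut-off functions -/

section Products

variable {G E : Type*} [NormedAddCommGroup G] [NormedSpace ℝ G] [NormedAddCommGroup E]
  [NormedSpace ℝ E]

lemma fderiv_smul_apply_of_contDiff {ζ : G → ℝ} {v : G → E} (hζ : ContDiff ℝ ∞ ζ)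
    (hv : ContDiff ℝ ∞ v) (p e : G) : fderiv ℝ (fun p => ζ p • v p) p e =
      fderiv ℝ ζ p e • v p + ζ p • fderiv ℝ v p e := by
  have h1 := (hζ.differentiable (by simp)).differentiableAt (x := p)
  have h2 := (hv.differentiable (by simp)).differentiableAt (x := p)
  rw [fderiv_fun_smul h1 h2]
  simp [add_comm]

lemma fderiv_sq_smul_apply_of_contDiff {ζ : G → ℝ} {v : G → E} (hζ : ContDiff ℝ ∞ ζ)
    (hv : ContDiff ℝ ∞ v) (p e : G) : fderiv ℝ (fun p => ζ p ^ 2 • v p) p e =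
      (2 * ζ p * fderiv ℝ ζ p e) • v p + ζ p ^ 2 • fderiv ℝ v p e := by
  have h1 := (hζ.differentiable (by simp)).differentiableAt (x := p)
  rw [fderiv_smul_apply_of_contDiff (hζ.pow 2) hv, fderiv_fun_pow 2 h1]
  simp

end Products

/-! ### Convergence in `L²` from bounds on the squared integral -/

section L2

variable {α E : Type*} [MeasurableSpace α] {μ : Measure α} [NormedAddCommGroup E]

lemma tendsto_eLpNorm_of_lintegral [InnerProductSpace ℝ E] {f : ℕ → α → E} {c : ℝ≥0∞} (hc : c ≠ ⊤) {e : ℕ → ℝ}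
    (he : Tendsto e atTop (𝓝 0))
    (h : ∀ j, ∫⁻ x, ‖f j x‖ₑ ^ 2 ∂μ ≤ c * ENNReal.ofReal (e j)) :
    Tendsto (fun j => eLpNorm (f j) 2 μ) atTop (𝓝 0) := by
  have h1 : Tendsto (fun j => (c * ENNReal.ofReal (e j)) ^ (1 / 2 : ℝ)) atTop (𝓝 0) := by
    have h2 := ENNReal.Tendsto.const_mul (a := c) (ENNReal.tendsto_ofReal he) (Or.inr hc)
    have h3 := (ENNReal.continuous_rpow_const (y := (1 / 2 : ℝ))).tendsto (c * ENNReal.ofReal 0)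
    rw [ENNReal.ofReal_zero, mul_zero, ENNReal.zero_rpow_of_pos (by norm_num)] at h3
    rw [ENNReal.ofReal_zero, mul_zero] at h2
    exact h3.comp h2
  refine tendsto_of_tendsto_of_tendsto_of_le_of_le tendsto_const_nhds h1 (fun _ => zero_le)
    fun j => eLpNorm_two_le_of_lintegral ((h j).trans_eq ?_)
  rw [← ENNReal.rpow_natCast, ← ENNReal.rpow_mul]
  simp

lemma lintegral_enorm_sq_eq_ofReal {f : α → E} (hf : MemLp f 2 μ) :
    ∫⁻ x, ‖f x‖ₑ ^ 2 ∂μ = ENNReal.ofReal (∫ x, ‖f x‖ ^ 2 ∂μ) := by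
  rw [ofReal_integral_eq_lintegral_ofReal (hf.integrable_norm_pow (by norm_num))
    (ae_of_all _ fun x => sq_nonneg _)]
  refine lintegral_congr fun x => ?_
  rw [ENNReal.ofReal_pow (norm_nonneg _), ofReal_norm]

lemma lintegral_smul_sub_le [NormedSpace ℝ E] {c : α → ℝ} {v w : α → E} {M : ℝ}
    (hM : ∀ x, |c x| ≤ M) {S : Set α} (hS : MeasurableSet S) (hcS : ∀ x ∉ S, c x = 0) :
    ∫⁻ x, ‖((fun x => c x • v x) - fun x => c x • w x) x‖ₑ ^ 2 ∂μ ≤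
      ENNReal.ofReal M ^ 2 * ∫⁻ x in S, ‖v x - w x‖ₑ ^ 2 ∂μ := by
  rw [← lintegral_const_mul' _ _ (by simp), ← lintegral_indicator hS]
  refine lintegral_mono fun x => ?_
  by_cases hx : x ∈ S
  · rw [indicator_of_mem hx, Pi.sub_apply, ← smul_sub, enorm_smul, mul_pow]
    gcongr
    rw [Real.enorm_eq_ofReal_abs]
    exact ENNReal.ofReal_le_ofReal (hM x)
  · simp [hcS x hx]

end L2

/-! ### The weak formulation for truncated solutions and the bound on the potential -/

section WeakForm

variable {n : ℕ} {a : ℝ}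

lemma integral_weightMeasureTime_eq {τ : ℝ} (hτ : 0 < τ) {F F' : Thick n × ℝ → ℝ}
    (h1 : ∀ p ∉ Metric.closedBall (0 : Thick n) 2 ×ˢ Icc τ 2, F p = 0)
    (h2 : ∀ p ∉ Metric.closedBall (0 : Thick n) 2 ×ˢ Icc τ 2, F' p = 0)
    (h3 : ∀ p ∈ halfBall n 3 ×ˢ Ioo (0 : ℝ) 9, F p = F' p) :
    ∫ p, F p ∂(weightMeasureTime n a 4 0 9) = ∫ p, F' p ∂(halfMeasureTime n a) := by
  have h4 : ∀ p ∉ Metric.ball (0 : Thick n) 4 ×ˢ Ioo (0 : ℝ) 9, F p = 0 := fun p hp => h1 p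
    fun h => hp ⟨Metric.closedBall_subset_ball (by norm_num) h.1, hτ.trans_le h.2.1,
      h.2.2.trans_lt (by norm_num)⟩
  rw [weightMeasureTime_eq, setIntegral_eq_integral_of_forall_compl_eq_zero h4]
  refine integral_congr_ae ?_
  filter_upwards [ae_halfMeasureTime_pos n a] with p hp
  by_cases hR : p ∈ Metric.closedBall (0 : Thick n) 2 ×ˢ Icc τ 2
  · exact h3 p ⟨⟨Metric.closedBall_subset_ball (by norm_num) hR.1, hp⟩, hτ.trans_le hR.2.1,
      hR.2.2.trans_lt (by norm_num)⟩
  · rw [h1 p hR, h2 p hR]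

/-- The weak form is used on `[0, 9]`. The two time-slice terms vanish because the test function is
supported in `[τ, 2]`, and its support does not see the truncation. -/
lemma IsWeakSolutionWith.weak_form_trunc {B : Grad n →L[ℝ] Val n}
    {V : Thin n × ℝ → Val n →L[ℝ] Val n} {U : Thick n × ℝ → Val n} {DU : Thick n × ℝ → Grad n}
    {T : Thin n × ℝ → Val n} (hU : IsWeakSolutionWith a B V U DU T) {τ : ℝ} (hτ : 0 < τ)
    {Φ : Thick n × ℝ → Val n} (hΦ : ContDiff ℝ ∞ Φ)
    (hΦs : tsupport Φ ⊆ Metric.closedBall 0 2 ×ˢ Icc τ 2) :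
    -(∫ p, inner ℝ (trunc U p) (partialT Φ p) ∂(halfMeasureTime n a))
      - (∫ p, inner ℝ (trunc DU p) (gradX Φ p) ∂(halfMeasureTime n a))
      - (∫ q : Thin n × ℝ, inner ℝ (V q (thinTrunc T q)) (Φ (thinPoint q.1, q.2)))
      = ∫ p, inner ℝ (B (trunc DU p)) (Φ p) ∂(halfMeasureTime n a) := by
  have hΦc : HasCompactSupport Φ := (isCompact_closedBall _ _ |>.prod isCompact_Icc).of_isClosed_subset
    (isClosed_tsupport _) hΦs
  have h := hU.weak_form Φ hΦ hΦc (hΦs.trans (prod_mono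
    (Metric.closedBall_subset_ball (by norm_num)) (subset_univ _))) 0 9 le_rfl (by norm_num)
    (by norm_num)
  have h0 : ∀ p ∉ Metric.closedBall (0 : Thick n) 2 ×ˢ Icc τ 2, Φ p = 0 := fun p hp =>
    image_eq_zero_of_notMem_tsupport fun h => hp (hΦs h)
  have hT0 : ∀ p ∉ Metric.closedBall (0 : Thick n) 2 ×ˢ Icc τ 2, partialT Φ p = 0 := fun p hp =>
    partialT_eq_zero_of_notMem fun h => hp (hΦs h)
  have hX0 : ∀ p ∉ Metric.closedBall (0 : Thick n) 2 ×ˢ Icc τ 2, gradX Φ p = 0 := fun p hp =>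
    PiLp.ext fun i => partialX_eq_zero_of_notMem (fun h => hp (hΦs h)) i
  have e1 : ∀ X, Φ (X, 9) = 0 := fun X => h0 _ fun h => by
    have := h.2.2; norm_num at this
  have e2 : ∀ X, Φ (X, 0) = 0 := fun X => h0 _ fun h => by
    have := h.2.1; simp only at this; linarith
  simp only [e1, e2, inner_zero_right, integral_zero, sub_self, zero_sub] at h
  rw [integral_weightMeasureTime_eq hτ (F' := fun p => inner ℝ (trunc U p) (partialT Φ p))
      (fun p hp => by rw [hT0 p hp, inner_zero_right])
      (fun p hp => by rw [hT0 p hp, inner_zero_right])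
      (fun p hp => by rw [trunc, indicator_of_mem hp]),
    integral_weightMeasureTime_eq hτ (F' := fun p => inner ℝ (trunc DU p) (gradX Φ p))
      (fun p hp => by rw [hX0 p hp, inner_zero_right])
      (fun p hp => by rw [hX0 p hp, inner_zero_right])
      (fun p hp => by rw [trunc, indicator_of_mem hp]),
    integral_weightMeasureTime_eq hτ (F' := fun p => inner ℝ (B (trunc DU p)) (Φ p))
      (fun p hp => by rw [h0 p hp, inner_zero_right])
      (fun p hp => by rw [h0 p hp, inner_zero_right])
      (fun p hp => by rw [trunc, indicator_of_mem hp])] at h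
  have e3 : ∫ q, inner ℝ (V q (T q)) (Φ (thinPoint q.1, q.2)) ∂(thinMeasureTime n 4 0 9) =
      ∫ q : Thin n × ℝ, inner ℝ (V q (thinTrunc T q)) (Φ (thinPoint q.1, q.2)) := by
    have hn : ∀ q : Thin n × ℝ, q ∉ Metric.ball (0 : Thin n) 3 ×ˢ Ioo (0 : ℝ) 9 →
        Φ (thinPoint q.1, q.2) = 0 := fun q hq => h0 _ fun h => hq ⟨by
          have := h.1
          rw [mem_closedBall_zero_iff, norm_thinPoint] at this
          rw [mem_ball_zero_iff]; linarith, hτ.trans_le h.2.1, h.2.2.trans_lt (by norm_num)⟩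
    rw [thinMeasureTime_eq, setIntegral_eq_integral_of_forall_compl_eq_zero fun q hq => by
      rw [hn q fun h => hq ⟨Metric.ball_subset_ball (by norm_num) h.1, h.2⟩, inner_zero_right]]
    refine integral_congr_ae (ae_of_all _ fun q => ?_)
    by_cases hq : q ∈ Metric.ball (0 : Thin n) 3 ×ˢ Ioo (0 : ℝ) 9
    · simp only [thinTrunc, indicator_of_mem hq]
    · simp only [hn q hq, inner_zero_right]
  rw [e3] at h
  exact h

lemma IsWeakSolutionWith.memLp_three {B : Grad n →L[ℝ] Val n}
    {V : Thin n × ℝ → Val n →L[ℝ] Val n} {U : Thick n × ℝ → Val n} {DU : Thick n × ℝ → Grad n}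
    {T : Thin n × ℝ → Val n} (hU : IsWeakSolutionWith a B V U DU T) :
    MemLp U 2 (weightMeasureTime n a 3 0 9) ∧ MemLp DU 2 (weightMeasureTime n a 3 0 9) ∧
      MemLp T 2 (thinMeasureTime n 3 0 9) := by
  have h9 : (3 : ℝ) ^ 2 = 9 := by norm_num
  refine ⟨?_, ?_, ?_⟩
  · refine hU.memLp.mono_measure ?_
    rw [weightMeasureTime_eq, weightMeasureTime_eq]
    exact Measure.restrict_mono (prod_mono (Metric.ball_subset_ball (by norm_num))
      (Ioo_subset_Ioo le_rfl (by norm_num))) le_rfl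
  · have := hU.memLp_gradient 3 (by norm_num) (by norm_num)
    rwa [h9] at this
  · have := hU.memLp_trace 3 (by norm_num) (by norm_num)
    rwa [h9] at this

lemma C1NormLE.norm_le {V : Thin n × ℝ → Val n →L[ℝ] Val n} {K : ℝ} (hV : C1NormLE V K)
    {q : Thin n × ℝ} (hq : q ∈ Metric.ball (0 : Thin n) 4 ×ˢ Ico (0 : ℝ) 16) : ‖V q‖ ≤ K :=
  le_of_add_le_of_nonneg_left (hV.2 q hq q hq)
    (norm_nonneg (fderivWithin ℝ V (Metric.ball 0 4 ×ˢ Ico 0 16) q))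

lemma C1NormLE.nonneg {V : Thin n × ℝ → Val n →L[ℝ] Val n} {K : ℝ} (hV : C1NormLE V K) : 0 ≤ K :=
  (norm_nonneg _).trans (hV.norm_le (q := (0, 0)) ⟨by simp, by simp⟩)

lemma C1NormLE.norm_apply_thinTrunc_le {V : Thin n × ℝ → Val n →L[ℝ] Val n} {K : ℝ}
    (hV : C1NormLE V K) (T : Thin n × ℝ → Val n) (q : Thin n × ℝ) :
    ‖V q (thinTrunc T q)‖ ≤ K * ‖thinTrunc T q‖ := by
  by_cases hq : q ∈ Metric.ball (0 : Thin n) 3 ×ˢ Ioo (0 : ℝ) 9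
  · refine (V q).le_of_opNorm_le (hV.norm_le ⟨Metric.ball_subset_ball (by norm_num) hq.1,
      hq.2.1.le, hq.2.2.trans (by norm_num)⟩) _
  · simp [thinTrunc, indicator_of_notMem hq]

lemma C1NormLE.memLp_apply_thinTrunc {V : Thin n × ℝ → Val n →L[ℝ] Val n} {K : ℝ}
    (hV : C1NormLE V K) {T : Thin n × ℝ → Val n} (hT : MemLp (thinTrunc T) 2 volume) :
    MemLp (fun q => V q (thinTrunc T q)) 2 volume := by
  have hS : MeasurableSet (Metric.ball (0 : Thin n) 3 ×ˢ Ioo (0 : ℝ) 9) :=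
    Metric.isOpen_ball.measurableSet.prod measurableSet_Ioo
  have hVc : ContinuousOn V (Metric.ball (0 : Thin n) 3 ×ˢ Ioo (0 : ℝ) 9) :=
    hV.1.continuousOn.mono (prod_mono (Metric.ball_subset_ball (by norm_num))
      (fun t ht => ⟨ht.1.le, ht.2.trans (by norm_num)⟩))
  have hm : AEStronglyMeasurable (fun q => V q (thinTrunc T q)) volume := by
    have h1 : AEStronglyMeasurable
        ((Metric.ball (0 : Thin n) 3 ×ˢ Ioo (0 : ℝ) 9).indicator V) volume :=
      (aestronglyMeasurable_indicator_iff hS).2 (hVc.aestronglyMeasurable hS)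
    have h2 := (isBoundedBilinearMap_apply (𝕜 := ℝ) (E := Val n)
      (F := Val n)).continuous.comp_aestronglyMeasurable (h1.prodMk hT.1)
    refine h2.congr (ae_of_all _ fun q => ?_)
    by_cases hq : q ∈ Metric.ball (0 : Thin n) 3 ×ˢ Ioo (0 : ℝ) 9
    · simp [indicator_of_mem hq]
    · simp [thinTrunc, indicator_of_notMem hq]
  refine (hT.const_smul K).mono hm (ae_of_all _ fun q => ?_)
  rw [Pi.smul_apply, norm_smul, Real.norm_of_nonneg hV.nonneg]
  exact hV.norm_apply_thinTrunc_le T q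

end WeakForm

lemma continuous_gradX {n : ℕ} {Φ : Thick n × ℝ → Val n} (hΦ : ContDiff ℝ ∞ Φ) :
    Continuous (gradX Φ) :=
  (PiLp.continuous_toLp 2 _).comp (continuous_pi fun i => continuous_partialX hΦ i)

set_option maxHeartbeats 1600000 in
/-- The local energy estimate for weak solutions: a Caccioppoli inequality in which only `U`
appears. -/
theorem exists_caccioppoli (n : ℕ) {a : ℝ} (ha : -1 < a) (ha' : a < 1) (β K : ℝ) :
    ∃ C : ℝ, 0 ≤ C ∧ ∀ (B : Grad n →L[ℝ] Val n) (V : Thin n × ℝ → Val n →L[ℝ] Val n)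
      (U : Thick n × ℝ → Val n), ‖B‖ ≤ β → C1NormLE V K → IsWeakSolution a B V U →
      ∀ (ζ : Thick n × ℝ → ℝ) (τ : ℝ), 0 < τ → ContDiff ℝ ∞ ζ →
        tsupport ζ ⊆ Metric.closedBall 0 2 ×ˢ Icc τ 2 →
        ∫ p, ‖trunc U p‖ ^ 2 * (ζ p * partialT ζ p) ∂(halfMeasureTime n a) ≤
          C * ∫ p, ‖trunc U p‖ ^ 2 * (∑ i, partialX ζ i p ^ 2 + ζ p ^ 2)
            ∂(halfMeasureTime n a) := by
  -- This gives `K ε ≤ 1/8`, so the boundary term uses at most a quarter of the gradient energy.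
  set ε := 1 / (8 * (|K| + 1)) with hεd
  have hε : 0 < ε := by positivity
  obtain ⟨Ct, hCt⟩ := exists_trace_inequality n ha ha' hε
  -- The terms with `∇ζ` need `4` from Young's inequality and `1/4` from the trace; the terms with
  -- `ζ²` need `β²` from the drift and `K Ct` from the trace.
  refine ⟨5 + β ^ 2 + |K| * Ct, by positivity, ?_⟩
  rintro B V U hB hV ⟨DU, T, hU⟩ ζ τ hτ hζ hζs
  set μ := halfMeasureTime n a with hμ
  have hfin : IsFiniteMeasureOnCompacts μ := isFiniteMeasureOnCompacts_halfMeasureTime ha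
  have hK := hV.nonneg
  obtain ⟨mU, mD, mT⟩ := hU.memLp_three
  have tU : MemLp (trunc U) 2 μ := memLp_trunc mU
  have tD : MemLp (trunc DU) 2 μ := memLp_trunc mD
  have tT := memLp_thinTrunc mT
  have hRc : IsCompact (Metric.closedBall (0 : Thick n) 2 ×ˢ Icc τ 2) :=
    (isCompact_closedBall _ _).prod isCompact_Icc
  have hRc' : IsCompact (Metric.closedBall (0 : Thin n) 2 ×ˢ Icc τ 2) :=
    (isCompact_closedBall _ _).prod isCompact_Icc
  have hRm : MeasurableSet (Metric.closedBall (0 : Thick n) 2 ×ˢ Icc τ 2) := hRc.measurableSet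
  have hRm' : MeasurableSet (Metric.closedBall (0 : Thin n) 2 ×ˢ Icc τ 2) := hRc'.measurableSet
  have hζc : HasCompactSupport ζ := hRc.of_isClosed_subset (isClosed_tsupport _) hζs
  have hζ0 : ∀ p ∉ Metric.closedBall (0 : Thick n) 2 ×ˢ Icc τ 2, ζ p = 0 := fun p hp =>
    image_eq_zero_of_notMem_tsupport fun h => hp (hζs h)
  have hζX0 : ∀ i, ∀ p ∉ Metric.closedBall (0 : Thick n) 2 ×ˢ Icc τ 2, partialX ζ i p = 0 :=
    fun i p hp => partialX_eq_zero_of_notMem (fun h => hp (hζs h)) i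
  have hζT0 : ∀ p ∉ Metric.closedBall (0 : Thick n) 2 ×ˢ Icc τ 2, partialT ζ p = 0 :=
    fun p hp => partialT_eq_zero_of_notMem (fun h => hp (hζs h))
  have hcs : ∀ {F : Type} [Zero F] {f : Thick n × ℝ → F},
      (∀ p ∉ Metric.closedBall (0 : Thick n) 2 ×ˢ Icc τ 2, f p = 0) → HasCompactSupport f :=
    fun h => HasCompactSupport.of_support_subset_isCompact hRc fun p hp => by
      by_contra h'; exact hp (h p h')
  set θ : Thin n × ℝ → ℝ := fun q => ζ (thinPoint q.1, q.2) with hθ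
  have hιc : Continuous fun q : Thin n × ℝ => (thinPoint q.1, q.2) :=
    (continuous_thinPoint.comp continuous_fst).prodMk continuous_snd
  have hθc : Continuous θ := hζ.continuous.comp hιc
  have hθ0 : ∀ q ∉ Metric.closedBall (0 : Thin n) 2 ×ˢ Icc τ 2, θ q = 0 := fun q hq =>
    hζ0 _ fun h => hq ⟨by simpa [norm_thinPoint] using h.1, h.2⟩
  have hXc := fun i => continuous_partialX hζ i
  have hTc := continuous_partialT hζ
  obtain ⟨M, hM⟩ : ∃ M : ℝ, ∀ p, |ζ p| ≤ M :=
    hζ.continuous.bounded_above_of_compact_support hζc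
  have hMT : ∃ M : ℝ, ∀ p, |partialT ζ p| ≤ M :=
    hTc.bounded_above_of_compact_support (hcs hζT0)
  have hMX : ∀ i, ∃ M : ℝ, ∀ p, |partialX ζ i p| ≤ M := fun i =>
    (hXc i).bounded_above_of_compact_support (hcs (hζX0 i))
  obtain ⟨M', hM'⟩ := hMT
  choose MX hMX using hMX
  -- The `v j` converge in every norm that the weak form involves except for the time derivative,
  -- which enters only through the one-sided bound `hv4`.
  choose v hv hv1 hv2 hv3 hv4 using fun j : ℕ => exists_smooth_approx ha ha' hU.weak_gradient
    mU mD mT hζ hζc hτ (show (0 : ℝ) < 1 / ((j : ℝ) + 1) by positivity)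
  have he : Tendsto (fun j : ℕ => 1 / ((j : ℝ) + 1)) atTop (𝓝 0) :=
    tendsto_one_div_add_atTop_nhds_zero_nat
  -- the limits
  have mζU : MemLp (fun p => ζ p • trunc U p) 2 μ :=
    memLp_smul_of_bdd tU hζ.continuous.aestronglyMeasurable hM
  have mζD : MemLp (fun p => ζ p • trunc DU p) 2 μ :=
    memLp_smul_of_bdd tD hζ.continuous.aestronglyMeasurable hM
  have mYU : MemLp (fun p => partialX ζ (Fin.last n) p • trunc U p) 2 μ :=
    memLp_smul_of_bdd tU (hXc _).aestronglyMeasurable (hMX _)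
  have mθT : MemLp (fun q => θ q • thinTrunc T q) 2 volume :=
    memLp_smul_of_bdd tT hθc.aestronglyMeasurable fun q => hM _
  have mTU : MemLp (fun p => partialT ζ p • trunc U p) 2 μ :=
    memLp_smul_of_bdd tU hTc.aestronglyMeasurable hM'
  have mP : MemLp (fun p => ∑ i, partialX ζ i p • trunc DU p i) 2 μ := by
    refine memLp_finsetSum _ fun i _ => ?_
    refine memLp_smul_of_bdd ?_ (hXc i).aestronglyMeasurable (hMX i)
    refine tD.mono ((PiLp.proj 2 (𝕜 := ℝ) (fun _ : Fin (n + 1) => Val n)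
      i).continuous.comp_aestronglyMeasurable tD.1) (ae_of_all _ fun p => PiLp.norm_apply_le _ _)
  have mVT : MemLp (fun q => θ q • V q (thinTrunc T q)) 2 volume :=
    memLp_smul_of_bdd (hV.memLp_apply_thinTrunc tT) hθc.aestronglyMeasurable fun q => hM _
  have mBD : MemLp (fun p => ζ p • B (trunc DU p)) 2 μ :=
    memLp_smul_of_bdd (B.comp_memLp' tD) hζ.continuous.aestronglyMeasurable hM
  -- the approximations
  have mζv : ∀ j, MemLp (fun p => ζ p • v j p) 2 μ := fun j =>
    (hζ.continuous.smul (hv j).continuous).memLp_of_hasCompactSupport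
      (hcs fun p hp => by simp [hζ0 p hp])
  have mζG : ∀ j, MemLp (fun p => ζ p • gradX (v j) p) 2 μ := fun j =>
    (hζ.continuous.smul (continuous_gradX (hv j))).memLp_of_hasCompactSupport
      (hcs fun p hp => by simp [hζ0 p hp])
  have mYv : ∀ j, MemLp (fun p => partialX ζ (Fin.last n) p • v j p) 2 μ := fun j =>
    ((hXc _).smul (hv j).continuous).memLp_of_hasCompactSupport
      (hcs fun p hp => by simp [hζX0 _ p hp])
  have mθv : ∀ j, MemLp (fun q : Thin n × ℝ => θ q • v j (thinPoint q.1, q.2)) 2 volume := fun j =>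
    (hθc.smul ((hv j).continuous.comp hιc)).memLp_of_hasCompactSupport
      (HasCompactSupport.of_support_subset_isCompact hRc' fun p hp => by
        by_contra h'; exact hp (by simp [hθ0 p h']))
  have mTv : ∀ j, MemLp (fun p => ζ p ^ 2 • partialT (v j) p) 2 μ := fun j =>
    ((hζ.continuous.pow 2).smul (continuous_partialT (hv j))).memLp_of_hasCompactSupport
      (hcs fun p hp => by simp [hζ0 p hp])
  have hcM : ∀ M : ℝ, ENNReal.ofReal M ^ 2 ≠ ⊤ := fun M => by simp
  have cU : Tendsto (fun j => eLpNorm ((fun p => ζ p • v j p) - fun p => ζ p • trunc U p) 2 μ)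
      atTop (𝓝 0) := by
    refine tendsto_eLpNorm_of_lintegral (hcM M) he fun j => (lintegral_smul_sub_le hM
      MeasurableSet.univ (fun p hp => absurd (mem_univ p) hp)).trans ?_
    rw [Measure.restrict_univ]
    gcongr
    exact hv1 j
  have cY : Tendsto (fun j => eLpNorm ((fun p => partialX ζ (Fin.last n) p • v j p) -
      fun p => partialX ζ (Fin.last n) p • trunc U p) 2 μ) atTop (𝓝 0) := by
    refine tendsto_eLpNorm_of_lintegral (hcM (MX (Fin.last n))) he fun j =>
      (lintegral_smul_sub_le (hMX _) MeasurableSet.univ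
        (fun p hp => absurd (mem_univ p) hp)).trans ?_
    rw [Measure.restrict_univ]
    gcongr
    exact hv1 j
  have cG : Tendsto (fun j => eLpNorm ((fun p => ζ p • gradX (v j) p) -
      fun p => ζ p • trunc DU p) 2 μ) atTop (𝓝 0) := by
    refine tendsto_eLpNorm_of_lintegral (hcM M) he fun j => (lintegral_smul_sub_le hM
      hRm hζ0).trans ?_
    gcongr
    exact hv2 j
  have cT : Tendsto (fun j => eLpNorm ((fun q : Thin n × ℝ => θ q • v j (thinPoint q.1, q.2)) -
      fun q => θ q • thinTrunc T q) 2 volume) atTop (𝓝 0) := by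
    refine tendsto_eLpNorm_of_lintegral (hcM M) he fun j => (lintegral_smul_sub_le
      (fun q => hM _) hRm' hθ0).trans ?_
    gcongr
    exact hv3 j
  -- the trace inequality
  have htrace : ∫ q, ‖θ q • thinTrunc T q‖ ^ 2 ≤ Ct * ∫ p, ‖ζ p • trunc U p‖ ^ 2 ∂μ +
      ε * (2 * ((∫ p, ‖partialX ζ (Fin.last n) p • trunc U p‖ ^ 2 ∂μ) +
        ∫ p, ‖ζ p • trunc DU p‖ ^ 2 ∂μ)) := by
    refine le_of_tendsto_of_tendsto' (tendsto_integral_norm_sq mθv mθT cT)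
      (((tendsto_integral_norm_sq mζv mζU cU).const_mul _).add
      ((((tendsto_integral_norm_sq mYv mYU cY).add
        (tendsto_integral_norm_sq mζG mζD cG)).const_mul 2).const_mul ε)) fun j => ?_
    have h1 := hCt (E := Val n) (g := fun p => ζ p • v j p) (hζ.smul (hv j))
    have h2 : ∫⁻ p, ‖partialX (fun p => ζ p • v j p) (Fin.last n) p‖ₑ ^ 2 ∂μ ≤
        ENNReal.ofReal (2 * ((∫ p, ‖partialX ζ (Fin.last n) p • v j p‖ ^ 2 ∂μ) +
          ∫ p, ‖ζ p • gradX (v j) p‖ ^ 2 ∂μ)) := by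
      have i1 := integrable_norm_sq_of_memLp (mYv j)
      have i2 := integrable_norm_sq_of_memLp (mζG j)
      have i3 : Integrable (fun p => 2 * (‖partialX ζ (Fin.last n) p • v j p‖ ^ 2 +
          ‖ζ p • gradX (v j) p‖ ^ 2)) μ := (i1.add i2).const_mul 2
      rw [← integral_add i1 i2, ← integral_const_mul, ofReal_integral_eq_lintegral_ofReal
        i3 (ae_of_all _ fun p => by simp only [Pi.zero_apply]; positivity)]
      refine lintegral_mono fun p => ?_
      rw [← ofReal_norm, ← ENNReal.ofReal_pow (norm_nonneg _)]
      refine ENNReal.ofReal_le_ofReal ?_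
      have h3 : partialX (fun p => ζ p • v j p) (Fin.last n) p =
          partialX ζ (Fin.last n) p • v j p + ζ p • partialX (v j) (Fin.last n) p :=
        fderiv_smul_apply_of_contDiff hζ (hv j) p _
      have h4 : ‖ζ p • partialX (v j) (Fin.last n) p‖ ≤ ‖ζ p • gradX (v j) p‖ :=
        PiLp.norm_apply_le (ζ p • gradX (v j) p) (Fin.last n)
      rw [h3]
      have h5 := norm_add_le (partialX ζ (Fin.last n) p • v j p)
        (ζ p • partialX (v j) (Fin.last n) p)
      calc _ ≤ (‖partialX ζ (Fin.last n) p • v j p‖ + ‖ζ p • gradX (v j) p‖) ^ 2 :=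
            pow_le_pow_left₀ (norm_nonneg _) (h5.trans (by gcongr)) 2
        _ ≤ _ := add_sq_le
    rw [lintegral_enorm_sq_eq_ofReal (mζv j)] at h1
    have h6 : ∫⁻ q : Thin n × ℝ, ‖ζ (thinPoint q.1, q.2) • v j (thinPoint q.1, q.2)‖ₑ ^ 2 = _ :=
      lintegral_enorm_sq_eq_ofReal (mθv j)
    rw [h6] at h1
    have h7 := h1.trans (add_le_add_right (mul_le_mul' le_rfl h2) _)
    have hn1 : 0 ≤ ∫ p, ‖ζ p • v j p‖ ^ 2 ∂μ := integral_nonneg fun _ => sq_nonneg _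
    have hn2 : 0 ≤ 2 * ((∫ p, ‖partialX ζ (Fin.last n) p • v j p‖ ^ 2 ∂μ) +
          ∫ p, ‖ζ p • gradX (v j) p‖ ^ 2 ∂μ) :=
      mul_nonneg (by norm_num) (add_nonneg (integral_nonneg fun _ => sq_nonneg _)
        (integral_nonneg fun _ => sq_nonneg _))
    rw [← ENNReal.ofReal_coe_nnreal (p := Ct), ← ENNReal.ofReal_mul Ct.coe_nonneg,
      ← ENNReal.ofReal_mul hε.le, ← ENNReal.ofReal_add (mul_nonneg Ct.coe_nonneg hn1)
      (mul_nonneg hε.le hn2)] at h7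
    exact (ENNReal.ofReal_le_ofReal_iff (add_nonneg (mul_nonneg Ct.coe_nonneg hn1)
      (mul_nonneg hε.le hn2))).1 h7
  -- the energy inequality
  have henergy : (∫ p, inner ℝ (ζ p • trunc DU p) (ζ p • trunc DU p) ∂μ)
      + 2 * (∫ p, inner ℝ (∑ i, partialX ζ i p • trunc DU p i) (ζ p • trunc U p) ∂μ)
      + (∫ q, inner ℝ (θ q • V q (thinTrunc T q)) (θ q • thinTrunc T q))
      + (∫ p, inner ℝ (ζ p • B (trunc DU p)) (ζ p • trunc U p) ∂μ) ≤
      -(2 * ∫ p, inner ℝ (partialT ζ p • trunc U p) (ζ p • trunc U p) ∂μ) +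
        (∫ p, ‖trunc U p‖ ^ 2 * (ζ p * partialT ζ p) ∂μ) + 0 := by
    refine le_of_tendsto_of_tendsto' ((((tendsto_integral_inner mζD mζG mζD cG).add
      ((tendsto_integral_inner mP mζv mζU cU).const_mul 2)).add
      (tendsto_integral_inner mVT mθv mθT cT)).add (tendsto_integral_inner mBD mζv mζU cU))
      ((((tendsto_integral_inner mTU mζv mζU cU).const_mul 2).neg.add_const _).add he) fun j => ?_
    -- The admissible substitute for the test function `ζ² U` is `ζ² v_j`.
    have hΦs : tsupport (fun p => ζ p ^ 2 • v j p) ⊆ Metric.closedBall 0 2 ×ˢ Icc τ 2 := by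
      refine (closure_mono fun p hp => ?_).trans hζs
      intro h
      exact hp (by simp [h])
    have hw := hU.weak_form_trunc (Φ := fun p => ζ p ^ 2 • v j p) hτ ((hζ.pow 2).smul (hv j)) hΦs
    have w1 : ∫ p, inner ℝ (trunc U p) (partialT (fun p => ζ p ^ 2 • v j p) p) ∂μ =
        2 * (∫ p, inner ℝ (partialT ζ p • trunc U p) (ζ p • v j p) ∂μ) +
          ∫ p, inner ℝ (ζ p ^ 2 • trunc U p) (partialT (v j) p) ∂μ := by
      have e : ∀ p, inner ℝ (ζ p ^ 2 • trunc U p) (partialT (v j) p) =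
          inner ℝ (trunc U p) (ζ p ^ 2 • partialT (v j) p) := fun p => by
        rw [real_inner_smul_left, real_inner_smul_right]
      simp_rw [e]
      rw [← integral_const_mul, ← integral_add ((integrable_inner_of_memLp mTU (mζv j)).const_mul 2)
        (integrable_inner_of_memLp tU (mTv j))]
      refine integral_congr_ae (ae_of_all _ fun p => ?_)
      simp only [partialT, fderiv_sq_smul_apply_of_contDiff hζ (hv j), inner_add_right,
        real_inner_smul_left, real_inner_smul_right]
      ring
    have w2 : ∫ p, inner ℝ (trunc DU p) (gradX (fun p => ζ p ^ 2 • v j p) p) ∂μ =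
        (∫ p, inner ℝ (ζ p • trunc DU p) (ζ p • gradX (v j) p) ∂μ) +
          2 * ∫ p, inner ℝ (∑ i, partialX ζ i p • trunc DU p i) (ζ p • v j p) ∂μ := by
      rw [← integral_const_mul, ← integral_add (integrable_inner_of_memLp mζD (mζG j))
        ((integrable_inner_of_memLp mP (mζv j)).const_mul 2)]
      refine integral_congr_ae (ae_of_all _ fun p => ?_)
      simp only [PiLp.inner_apply, gradX, partialX, fderiv_sq_smul_apply_of_contDiff hζ (hv j),
        inner_add_right, real_inner_smul_left, real_inner_smul_right, sum_inner, PiLp.smul_apply,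
        Finset.mul_sum, ← Finset.sum_add_distrib]
      refine Finset.sum_congr rfl fun i _ => ?_
      ring_nf
    have w3 : ∫ q : Thin n × ℝ, inner ℝ (V q (thinTrunc T q))
        ((fun p => ζ p ^ 2 • v j p) (thinPoint q.1, q.2)) =
        ∫ q : Thin n × ℝ, inner ℝ (θ q • V q (thinTrunc T q)) (θ q • v j (thinPoint q.1, q.2)) := by
      refine integral_congr_ae (ae_of_all _ fun q => ?_)
      simp only [real_inner_smul_left, real_inner_smul_right, hθ]
      ring
    have w4 : ∫ p, inner ℝ (B (trunc DU p)) (ζ p ^ 2 • v j p) ∂μ =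
        ∫ p, inner ℝ (ζ p • B (trunc DU p)) (ζ p • v j p) ∂μ := by
      refine integral_congr_ae (ae_of_all _ fun q => ?_)
      simp only [real_inner_smul_left, real_inner_smul_right]
      ring
    rw [w1, w2, w3, w4] at hw
    have := hv4 j
    linarith
  -- absorption
  have iN : ∀ i, Integrable (fun p => ‖trunc U p‖ ^ 2 * partialX ζ i p ^ 2) μ := fun i => by
    have := integrable_norm_sq_of_memLp
      (memLp_smul_of_bdd tU (hXc i).aestronglyMeasurable (hMX i))
    refine this.congr (ae_of_all _ fun p => ?_)
    simp only [norm_smul, mul_pow, Real.norm_eq_abs, sq_abs]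
    ring
  have iN' : Integrable (fun p => ‖trunc U p‖ ^ 2 * ∑ i, partialX ζ i p ^ 2) μ := by
    simp_rw [Finset.mul_sum]
    exact integrable_finsetSum _ fun i _ => iN i
  have iZ := integrable_norm_sq_of_memLp mζU
  have iG := integrable_norm_sq_of_memLp mζD
  have i1 : ∫ p, inner ℝ (partialT ζ p • trunc U p) (ζ p • trunc U p) ∂μ =
      ∫ p, ‖trunc U p‖ ^ 2 * (ζ p * partialT ζ p) ∂μ := by
    refine integral_congr_ae (ae_of_all _ fun p => ?_)
    simp only [real_inner_smul_left, real_inner_smul_right, real_inner_self_eq_norm_sq]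
    ring
  have i2 : -(2 * ∫ p, inner ℝ (∑ i, partialX ζ i p • trunc DU p i) (ζ p • trunc U p) ∂μ) ≤
      4⁻¹ * (∫ p, ‖ζ p • trunc DU p‖ ^ 2 ∂μ) +
        4 * ∫ p, ‖trunc U p‖ ^ 2 * ∑ i, partialX ζ i p ^ 2 ∂μ := by
    rw [← integral_const_mul, ← integral_neg, ← integral_const_mul, ← integral_const_mul,
      ← integral_add (iG.const_mul _) (iN'.const_mul _)]
    refine integral_mono ((integrable_inner_of_memLp mP mζU).const_mul 2).neg
      ((iG.const_mul _).add (iN'.const_mul _)) fun p => ?_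
    simp only
    rw [PiLp.norm_sq_eq_of_L2, sum_inner, Finset.mul_sum, Finset.mul_sum, Finset.mul_sum,
      Finset.mul_sum, ← Finset.sum_neg_distrib, ← Finset.sum_add_distrib]
    refine Finset.sum_le_sum fun i _ => ?_
    rw [PiLp.smul_apply, norm_smul, real_inner_smul_left, real_inner_smul_right, mul_pow,
      Real.norm_eq_abs, sq_abs]
    have h1 : |partialX ζ i p * (ζ p * inner ℝ (trunc DU p i) (trunc U p))| ≤
        |partialX ζ i p| * (|ζ p| * (‖trunc DU p i‖ * ‖trunc U p‖)) := by
      rw [abs_mul, abs_mul]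
      gcongr
      exact abs_real_inner_le_norm _ _
    have h2 := (abs_le.1 h1).1
    nlinarith [sq_nonneg (|ζ p| * ‖trunc DU p i‖ / 2 - 2 * (|partialX ζ i p| * ‖trunc U p‖)),
      sq_abs (ζ p), sq_abs (partialX ζ i p)]
  have i3 : -(∫ q, inner ℝ (θ q • V q (thinTrunc T q)) (θ q • thinTrunc T q)) ≤
      K * ∫ q, ‖θ q • thinTrunc T q‖ ^ 2 := by
    rw [← integral_neg, ← integral_const_mul]
    refine integral_mono (integrable_inner_of_memLp mVT mθT).neg
      ((integrable_norm_sq_of_memLp mθT).const_mul K) fun q => ?_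
    have h1 := abs_real_inner_le_norm (θ q • V q (thinTrunc T q)) (θ q • thinTrunc T q)
    have h2 : ‖θ q • V q (thinTrunc T q)‖ ≤ K * ‖θ q • thinTrunc T q‖ := by
      rw [norm_smul, norm_smul]
      have := mul_le_mul_of_nonneg_left (hV.norm_apply_thinTrunc_le T q) (norm_nonneg (θ q))
      linarith
    have h3 := (abs_le.1 h1).1
    have h4 := mul_le_mul_of_nonneg_right h2 (norm_nonneg (θ q • thinTrunc T q))
    simp only
    nlinarith
  have i4 : -(∫ p, inner ℝ (ζ p • B (trunc DU p)) (ζ p • trunc U p) ∂μ) ≤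
      4⁻¹ * (∫ p, ‖ζ p • trunc DU p‖ ^ 2 ∂μ) + β ^ 2 * ∫ p, ‖ζ p • trunc U p‖ ^ 2 ∂μ := by
    rw [← integral_neg, ← integral_const_mul, ← integral_const_mul,
      ← integral_add (iG.const_mul _) (iZ.const_mul _)]
    refine integral_mono (integrable_inner_of_memLp mBD mζU).neg
      ((iG.const_mul _).add (iZ.const_mul _)) fun p => ?_
    simp only
    have h1 := abs_real_inner_le_norm (ζ p • B (trunc DU p)) (ζ p • trunc U p)
    have h2 : ‖ζ p • B (trunc DU p)‖ ≤ β * ‖ζ p • trunc DU p‖ := by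
      rw [← B.map_smul]
      exact B.le_of_opNorm_le hB _
    have h3 := (abs_le.1 h1).1
    have h4 := mul_le_mul_of_nonneg_right h2 (norm_nonneg (ζ p • trunc U p))
    nlinarith [sq_nonneg (‖ζ p • trunc DU p‖ / 2 - β * ‖ζ p • trunc U p‖)]
  have i5 : ∫ p, ‖partialX ζ (Fin.last n) p • trunc U p‖ ^ 2 ∂μ ≤
      ∫ p, ‖trunc U p‖ ^ 2 * ∑ i, partialX ζ i p ^ 2 ∂μ := by
    refine integral_mono (integrable_norm_sq_of_memLp mYU) iN' fun p => ?_
    simp only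
    rw [norm_smul, mul_pow, mul_comm, Real.norm_eq_abs, sq_abs]
    gcongr
    exact Finset.single_le_sum (f := fun i => partialX ζ i p ^ 2) (fun i _ => sq_nonneg _)
      (Finset.mem_univ _)
  have i6 : ∫ p, ‖trunc U p‖ ^ 2 * (∑ i, partialX ζ i p ^ 2 + ζ p ^ 2) ∂μ =
      (∫ p, ‖trunc U p‖ ^ 2 * ∑ i, partialX ζ i p ^ 2 ∂μ) + ∫ p, ‖ζ p • trunc U p‖ ^ 2 ∂μ := by
    rw [← integral_add iN' iZ]
    refine integral_congr_ae (ae_of_all _ fun p => ?_)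
    simp only [norm_smul, mul_pow, Real.norm_eq_abs, sq_abs]
    ring
  simp only [real_inner_self_eq_norm_sq] at henergy
  rw [i1] at henergy
  rw [i6, abs_of_nonneg hK]
  set I := ∫ p, ‖trunc U p‖ ^ 2 * (ζ p * partialT ζ p) ∂μ
  set Gd := ∫ p, ‖ζ p • trunc DU p‖ ^ 2 ∂μ with hGd
  set N := ∫ p, ‖trunc U p‖ ^ 2 * ∑ i, partialX ζ i p ^ 2 ∂μ with hN
  set Z := ∫ p, ‖ζ p • trunc U p‖ ^ 2 ∂μ with hZ
  have hG0 : 0 ≤ Gd := integral_nonneg fun _ => sq_nonneg _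
  have hZ0 : 0 ≤ Z := integral_nonneg fun _ => sq_nonneg _
  have hN0 : 0 ≤ N := integral_nonneg fun p =>
    mul_nonneg (sq_nonneg _) (Finset.sum_nonneg fun i _ => sq_nonneg _)
  have hKε : K * ε ≤ 8⁻¹ := by
    rw [hεd, abs_of_nonneg hK, mul_one_div, div_le_iff₀ (by positivity)]
    linarith
  have h8 : K * (∫ q, ‖θ q • thinTrunc T q‖ ^ 2) ≤ K * Ct * Z + 4⁻¹ * (N + Gd) := by
    have h9 : ∫ q, ‖θ q • thinTrunc T q‖ ^ 2 ≤ Ct * Z + ε * (2 * (N + Gd)) :=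
      htrace.trans (by gcongr)
    have h10 := mul_le_mul_of_nonneg_left h9 hK
    have h11 := mul_le_mul_of_nonneg_right hKε (add_nonneg hN0 hG0)
    linear_combination h10 + 2 * h11
  have hCtN : 0 ≤ K * Ct * N := mul_nonneg (mul_nonneg hK Ct.coe_nonneg) hN0
  have hβN : 0 ≤ β ^ 2 * N := mul_nonneg (sq_nonneg _) hN0
  -- The cross term, the drift and the trace each take a quarter of the gradient energy `Gd`; the
  -- remaining quarter is discarded.
  linear_combination henergy + i2 + i3 + i4 + h8 + hCtN + hβN + 3 / 4 * hN0 + 5 * hZ0 + 4⁻¹ * hG0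

/-! ### The exponentially decaying cutoff -/

section Cutoffs

/-- A smooth bump on the thick space, equal to `1` on `𝔹₁` and supported in `𝔹_{3/2}`. -/
def innerBump (n : ℕ) : ContDiffBump (0 : Thick n) := ⟨1, 3 / 2, by norm_num, by norm_num⟩

/-- A smooth bump on the thick space, equal to `1` on `𝔹_{3/2}` and supported in `𝔹₂`. -/
def outerBump (n : ℕ) : ContDiffBump (0 : Thick n) := ⟨3 / 2, 2, by norm_num, by norm_num⟩

lemma ContDiffBump.exists_sum_fderiv_sq_le {n : ℕ} (f : ContDiffBump (0 : Thick n)) :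
    ∃ L : ℝ, 0 ≤ L ∧ ∀ X, ∑ i : Fin (n + 1), fderiv ℝ f X (EuclideanSpace.single i 1) ^ 2 ≤ L := by
  have hc : Continuous fun X : Thick n => ∑ i : Fin (n + 1),
      fderiv ℝ f X (EuclideanSpace.single i 1) ^ 2 :=
    continuous_finsetSum _ fun i _ => ((f.contDiff (n := 1).continuous_fderiv
      (by simp)).clm_apply continuous_const).pow 2
  have hs : HasCompactSupport fun X : Thick n => ∑ i : Fin (n + 1),
      fderiv ℝ f X (EuclideanSpace.single i 1) ^ 2 :=
    (f.hasCompactSupport.fderiv (𝕜 := ℝ)).comp_left (g := fun l : Thick n →L[ℝ] ℝ =>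
      ∑ i : Fin (n + 1), l (EuclideanSpace.single i 1) ^ 2) (by simp)
  obtain ⟨L, hL⟩ := hc.bounded_above_of_compact_support hs
  exact ⟨L, (norm_nonneg _).trans (hL 0), fun X => (le_abs_self _).trans (hL X)⟩

/-- The weight whose square is integrated against `|U|²`: outside `𝔹₁` it decays like
`exp (-c / T)` for times between `0` and `T`, and this decay deteriorates with time. -/
def decayWeight (n : ℕ) (μ κ T : ℝ) (p : Thick n × ℝ) : ℝ :=
  outerBump n p.1 *
    Real.exp (μ * p.2 - (2 - p.2 / T) / (2 * κ * T) * (1 - innerBump n p.1) ^ 2)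

lemma contDiff_decayWeight (n : ℕ) (μ κ T : ℝ) : ContDiff ℝ ∞ (decayWeight n μ κ T) := by
  have h1 : ContDiff ℝ ∞ fun p : Thick n × ℝ => outerBump n p.1 :=
    (outerBump n).contDiff.comp contDiff_fst
  have h2 : ContDiff ℝ ∞ fun p : Thick n × ℝ => innerBump n p.1 :=
    (innerBump n).contDiff.comp contDiff_fst
  unfold decayWeight
  fun_prop

/-- The gain is in the last factor of the time derivative: as `2 - t/T` decreases, the exponent
grows at the rate `(1 - η)²/(2κT²)` in addition to `μ`, where `η` is the inner bump. -/
lemma hasFDerivAt_mul_decayWeight {n : ℕ} (μ κ T : ℝ) {θ : ℝ → ℝ} (hθ : Differentiable ℝ θ)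
    (p : Thick n × ℝ) :
    (∀ i, partialX (fun p => θ p.2 * decayWeight n μ κ T p) i p = θ p.2 *
      Real.exp (μ * p.2 - (2 - p.2 / T) / (2 * κ * T) * (1 - innerBump n p.1) ^ 2) *
      (fderiv ℝ (outerBump n) p.1 (EuclideanSpace.single i 1) + outerBump n p.1 *
        ((2 - p.2 / T) / (κ * T)) * (1 - innerBump n p.1) *
          fderiv ℝ (innerBump n) p.1 (EuclideanSpace.single i 1))) ∧
    partialT (fun p => θ p.2 * decayWeight n μ κ T p) p =
      deriv θ p.2 * decayWeight n μ κ T p + θ p.2 * decayWeight n μ κ T p *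
        (μ + (1 - innerBump n p.1) ^ 2 / (2 * κ * T ^ 2)) := by
  have hφ : HasFDerivAt (fun p : Thick n × ℝ => outerBump n p.1) _ p :=
    ((outerBump n).contDiff (n := 1).differentiable (by simp) p.1).hasFDerivAt.comp p hasFDerivAt_fst
  have hη : HasFDerivAt (fun p : Thick n × ℝ => innerBump n p.1) _ p :=
    ((innerBump n).contDiff (n := 1).differentiable (by simp) p.1).hasFDerivAt.comp p hasFDerivAt_fst
  have hθ' : HasFDerivAt (fun p : Thick n × ℝ => θ p.2) _ p :=
    (hθ p.2).hasDerivAt.comp_hasFDerivAt p (hasFDerivAt_snd (𝕜 := ℝ) (E := Thick n) (F := ℝ) (p := p))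
  have ht : HasFDerivAt (fun p : Thick n × ℝ => p.2) _ p := hasFDerivAt_snd (𝕜 := ℝ)
  have hs := ((ht.mul_const T⁻¹).const_sub 2).mul_const (2 * κ * T)⁻¹
  have hE := (ht.const_mul μ).sub (hs.mul ((hη.const_sub 1).pow 2))
  have h := hθ'.mul (hφ.mul hE.exp)
  have h' : HasFDerivAt (fun p => θ p.2 * decayWeight n μ κ T p) _ p := h
  refine ⟨fun i => ?_, ?_⟩
  · rw [partialX, h'.fderiv]
    simp
    ring_nf
  · rw [partialT, h'.fderiv]
    simp [decayWeight]
    ring_nf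

/-- Pointwise algebra for the weight, with `η` here standing for one minus the inner bump. By `(u +
v)² ≤ 2u² + 2v²` the gradient splits into a `φ'` part, kept as the error `Y`, and an `η'` part
proportional to `η² σ²`, which the term `η²/(2κT²)` of the time derivative absorbs. The zero-order
term is absorbed by `μ ≥ C`. -/
lemma decay_absorption {ι : Type*} [Fintype ι] {θ θ' φ e η σ μ C κ T L Y : ℝ} {φ' η' : ι → ℝ}
    (hC : 0 ≤ C) (hμ : C ≤ μ) (hT : 0 < T) (hκ : 0 < κ) (hκL : 16 * C * L ≤ κ) (hσ : 0 ≤ σ)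
    (hσ' : σ ≤ 2 / (κ * T)) (hη : ∑ i, η' i ^ 2 ≤ L) (hφ : e ^ 2 * ∑ i, φ' i ^ 2 ≤ Y)
    (hθ : θ ^ 2 ≤ 1) :
    θ * θ' * (φ * e) ^ 2 ≤ θ * (φ * e) * (θ' * (φ * e) + θ * (φ * e) *
        (μ + η ^ 2 / (2 * κ * T ^ 2))) -
      C * (∑ i, (θ * e * (φ' i + φ * σ * η * η' i)) ^ 2 + (θ * (φ * e)) ^ 2) + 2 * C * Y := by
  have h1 : ∑ i, (θ * e * (φ' i + φ * σ * η * η' i)) ^ 2 ≤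
      2 * Y + 2 * (θ * (φ * e)) ^ 2 * η ^ 2 * σ ^ 2 * L := by
    calc _ ≤ ∑ i, (2 * θ ^ 2 * (e ^ 2 * φ' i ^ 2) +
          2 * (θ * (φ * e)) ^ 2 * η ^ 2 * σ ^ 2 * η' i ^ 2) :=
          Finset.sum_le_sum fun i _ => by
            nlinarith [sq_nonneg (θ * e * (φ' i - φ * σ * η * η' i))]
      _ = 2 * (θ ^ 2 * (e ^ 2 * ∑ i, φ' i ^ 2)) +
          2 * (θ * (φ * e)) ^ 2 * η ^ 2 * σ ^ 2 * ∑ i, η' i ^ 2 := by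
          rw [Finset.sum_add_distrib, ← Finset.mul_sum, ← Finset.mul_sum, ← Finset.mul_sum]
          ring
      _ ≤ _ := by
          have := mul_le_mul hθ hφ (mul_nonneg (sq_nonneg _)
            (Finset.sum_nonneg fun i _ => sq_nonneg _)) zero_le_one
          gcongr
          linarith
  -- Since `σ ≤ 2/(κT)`, the left side is at most `8CL/(κ²T²)`; this is the origin of the condition
  -- `16CL ≤ κ`.
  have h2 : C * (2 * σ ^ 2 * L) ≤ 1 / (2 * κ * T ^ 2) := by
    have hL : 0 ≤ L := (Finset.sum_nonneg fun i _ => sq_nonneg _).trans hη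
    calc C * (2 * σ ^ 2 * L) ≤ C * (2 * (2 / (κ * T)) ^ 2 * L) := by gcongr
      _ = 16 * C * L * (1 / (2 * κ ^ 2 * T ^ 2)) := by field_simp; ring
      _ ≤ κ * (1 / (2 * κ ^ 2 * T ^ 2)) := by gcongr
      _ = _ := by field_simp
  have h3 := mul_le_mul_of_nonneg_left h1 hC
  have h4 := mul_le_mul_of_nonneg_left h2 (mul_nonneg (sq_nonneg (θ * (φ * e))) (sq_nonneg η))
  have h5 := mul_le_mul_of_nonneg_left hμ (sq_nonneg (θ * (φ * e)))
  rw [show η ^ 2 / (2 * κ * T ^ 2) = η ^ 2 * (1 / (2 * κ * T ^ 2)) by ring]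
  linear_combination h3 + h4 + h5

/-- The two bumps are arranged so that the gradient of the outer one vanishes where the norm is
below `3/2`, while elsewhere the inner one is 0 and the exponential has its full decay. For `t ≤ T`
the factor `2 - t/T` is still at least 1. -/
lemma exp_sq_mul_sum_fderiv_outerBump_le {n : ℕ} {μ κ T L : ℝ} (hμ : 0 ≤ μ) (hκ : 0 < κ)
    (hT : 0 < T) (hT1 : T ≤ 1)
    (hL : ∀ X, ∑ i : Fin (n + 1), fderiv ℝ (outerBump n) X (EuclideanSpace.single i 1) ^ 2 ≤ L)
    {p : Thick n × ℝ} (hp : p.2 ≤ T) :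
    Real.exp (μ * p.2 - (2 - p.2 / T) / (2 * κ * T) * (1 - innerBump n p.1) ^ 2) ^ 2 *
      ∑ i : Fin (n + 1), fderiv ℝ (outerBump n) p.1 (EuclideanSpace.single i 1) ^ 2 ≤
      L * (Real.exp (2 * μ) * Real.exp (-(κ⁻¹ / T))) := by
  have hL0 : 0 ≤ L := (Finset.sum_nonneg fun i _ => sq_nonneg _).trans (hL p.1)
  rcases lt_or_ge ‖p.1‖ (3 / 2) with h | h
  · have h1 : (outerBump n : Thick n → ℝ) =ᶠ[𝓝 p.1] 1 :=
      (outerBump n).eventuallyEq_one_of_mem_ball (by simpa [outerBump] using h)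
    have h2 : fderiv ℝ (outerBump n) p.1 = 0 := by
      rw [h1.fderiv_eq]
      exact fderiv_const_apply (𝕜 := ℝ) (1 : ℝ)
    simp only [h2, zero_apply]
    simp only [ne_eq, OfNat.ofNat_ne_zero, not_false_eq_true, zero_pow, Finset.sum_const_zero,
      mul_zero]
    positivity
  · have h1 : innerBump n p.1 = 0 := (innerBump n).zero_of_le_dist (by simpa [innerBump] using h)
    rw [mul_comm, h1, ← Real.exp_add, ← Real.exp_nat_mul]
    refine mul_le_mul (hL _) (Real.exp_le_exp.2 ?_) (Real.exp_nonneg _) hL0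
    have h2 : 1 ≤ 2 - p.2 / T := by
      have : p.2 / T ≤ 1 := (div_le_one hT).2 hp
      linarith
    have h3 : μ * p.2 ≤ μ * 1 := mul_le_mul_of_nonneg_left (hp.trans hT1) hμ
    have h4 : κ⁻¹ / T ≤ 2 * ((2 - p.2 / T) / (2 * κ * T)) := by
      rw [show 2 * ((2 - p.2 / T) / (2 * κ * T)) = (2 - p.2 / T) * (κ⁻¹ / T) by field_simp]
      exact le_mul_of_one_le_left (by positivity) h2
    push_cast
    linarith

lemma decayWeight_eq_one {n : ℕ} (μ κ T : ℝ) {X : Thick n} (hX : ‖X‖ ≤ 1) :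
    decayWeight n μ κ T (X, 0) = 1 := by
  have h1 : innerBump n X = 1 :=
    (innerBump n).one_of_mem_closedBall (by simpa [innerBump] using hX)
  have h2 : outerBump n X = 1 := (outerBump n).one_of_mem_closedBall (by
    simp only [outerBump, mem_closedBall_zero_iff]; linarith)
  simp [decayWeight, h1, h2]

lemma decayWeight_eq_zero {n : ℕ} (μ κ T : ℝ) {p : Thick n × ℝ} (hp : 2 ≤ ‖p.1‖) :
    decayWeight n μ κ T p = 0 := by
  have h2 : outerBump n p.1 = 0 := (outerBump n).zero_of_le_dist (by simpa [outerBump] using hp)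
  simp [decayWeight, h2]

lemma decayWeight_nonneg {n : ℕ} (μ κ T : ℝ) (p : Thick n × ℝ) : 0 ≤ decayWeight n μ κ T p :=
  mul_nonneg (outerBump n).nonneg (Real.exp_nonneg _)

lemma decayWeight_le {n : ℕ} {μ κ T : ℝ} (hμ : 0 ≤ μ) (hκ : 0 < κ) (hT : 0 < T) (hT1 : T ≤ 1)
    {p : Thick n × ℝ} (hp : p.2 ≤ T) : decayWeight n μ κ T p ≤ Real.exp μ := by
  have h1 : 0 ≤ (2 - p.2 / T) / (2 * κ * T) := by
    have : p.2 / T ≤ 1 := (div_le_one hT).2 hp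
    exact div_nonneg (by linarith) (by positivity)
  have h2 : μ * p.2 ≤ μ * 1 := mul_le_mul_of_nonneg_left (hp.trans hT1) hμ
  have h3 := mul_nonneg h1 (sq_nonneg (1 - innerBump n p.1))
  calc decayWeight n μ κ T p ≤ 1 * Real.exp μ :=
        mul_le_mul (outerBump n).le_one (Real.exp_le_exp.2 (by linarith)) (Real.exp_nonneg _)
          zero_le_one
    _ = _ := one_mul _

end Cutoffs

/-! ### Almost monotonicity of the weighted mass, tested against functions of time -/

section Decay

variable {n : ℕ} {a : ℝ}

lemma integral_trunc_sq_le {U : Thick n × ℝ → Val n} (hU : MemLp U 2 (weightMeasureTime n a 4 0 16)) :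
    ∫ p, ‖trunc U p‖ ^ 2 ∂(halfMeasureTime n a) ≤
      ∫ p, ‖U p‖ ^ 2 ∂(weightMeasureTime n a 4 0 16) := by
  have h1 : ∫ p, ‖trunc U p‖ ^ 2 ∂(halfMeasureTime n a) =
      ∫ p in halfBall n 3 ×ˢ Ioo (0 : ℝ) 9, ‖U p‖ ^ 2 ∂(halfMeasureTime n a) := by
    rw [← integral_indicator (measurableSet_truncDomain n)]
    refine integral_congr_ae (ae_of_all _ fun p => ?_)
    by_cases hp : p ∈ halfBall n 3 ×ˢ Ioo (0 : ℝ) 9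
    · simp [trunc, indicator_of_mem hp]
    · simp [trunc, indicator_of_notMem hp]
  rw [h1, weightMeasureTime_eq]
  have h2 := integrable_norm_sq_of_memLp hU
  rw [weightMeasureTime_eq] at h2
  exact setIntegral_mono_set h2 (ae_of_all _ fun p => sq_nonneg _)
    (prod_mono (inter_subset_left.trans (Metric.ball_subset_ball (by norm_num)))
      (Ioo_subset_Ioo le_rfl (by norm_num))).eventuallyLE

/-- The weighted mass of a time slice. -/
def weightedMass (n : ℕ) (a : ℝ) (q : Thick n × ℝ → ℝ) (U : Thick n × ℝ → Val n) (t : ℝ) : ℝ :=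
  ∫ X, ‖q (X, t) • U (X, t)‖ ^ 2 ∂(weightMeasure n a 3)

lemma integral_trunc_eq_integral_weightedMass {U : Thick n × ℝ → Val n} {q : Thick n × ℝ → ℝ}
    {k : ℝ → ℝ} (hk : ∀ t ∉ Ioo (0 : ℝ) 9, k t = 0)
    (hi : Integrable (fun p => ‖trunc U p‖ ^ 2 * (k p.2 * q p ^ 2)) (halfMeasureTime n a)) :
    ∫ p, ‖trunc U p‖ ^ 2 * (k p.2 * q p ^ 2) ∂(halfMeasureTime n a) =
      ∫ t, k t * weightedMass n a q U t := by
  rw [halfMeasureTime] at hi ⊢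
  rw [integral_prod_symm _ hi]
  refine integral_congr_ae (ae_of_all _ fun t => ?_)
  simp only
  by_cases ht : t ∈ Ioo (0 : ℝ) 9
  · rw [weightedMass, weightMeasure_eq, ← integral_const_mul,
      ← integral_indicator Metric.isOpen_ball.measurableSet]
    refine integral_congr_ae ?_
    filter_upwards [ae_halfMeasure_pos n a] with X hX
    by_cases h3 : X ∈ Metric.ball (0 : Thick n) 3
    · have : (X, t) ∈ halfBall n 3 ×ˢ Ioo (0 : ℝ) 9 := ⟨⟨h3, hX⟩, ht⟩
      simp only [trunc, indicator_of_mem this, indicator_of_mem h3, norm_smul, mul_pow,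
        Real.norm_eq_abs, sq_abs]
      ring
    · have : (X, t) ∉ halfBall n 3 ×ˢ Ioo (0 : ℝ) 9 := fun h => h3 h.1.1
      simp [trunc, indicator_of_notMem this, indicator_of_notMem h3]
  · simp [hk t ht]

/-- The Caccioppoli inequality is applied to the cutoff `θ(t)` times the decaying weight. The
pointwise absorption leaves only the `θ θ'` term and an error supported where the weight is
exponentially small. As `θ θ' = (θ²)'/2`, this is a weak form of a lower bound on the time
derivative of the weighted mass. -/
theorem exists_weighted_decay (n : ℕ) {a : ℝ} (ha : -1 < a) (ha' : a < 1) (β K : ℝ) :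
    ∃ μ κ D : ℝ, 0 ≤ μ ∧ 0 < κ ∧ 0 ≤ D ∧
      ∀ (B : Grad n →L[ℝ] Val n) (V : Thin n × ℝ → Val n →L[ℝ] Val n)
      (U : Thick n × ℝ → Val n), ‖B‖ ≤ β → C1NormLE V K → IsWeakSolution a B V U →
      ∀ T : ℝ, 0 < T → T ≤ 1 → ∀ (θ : ℝ → ℝ) (τ : ℝ), 0 < τ → ContDiff ℝ ∞ θ →
        (∀ t, θ t ^ 2 ≤ 1) → (∀ t ∉ Icc τ T, θ t = 0) →
        ∫ t, θ t * deriv θ t * weightedMass n a (decayWeight n μ κ T) U t ≤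
          D * Real.exp (-(κ⁻¹ / T)) * ∫ p, ‖U p‖ ^ 2 ∂(weightMeasureTime n a 4 0 16) := by
  obtain ⟨C, hC, hCac⟩ := exists_caccioppoli n ha ha' β K
  obtain ⟨L₁, hL₁, hi⟩ := (innerBump n).exists_sum_fderiv_sq_le
  obtain ⟨L₂, hL₂, ho⟩ := (outerBump n).exists_sum_fderiv_sq_le
  -- `μ = C` absorbs the zero-order term and `κ ≥ 16 C L₁` the gradient of the exponent; the `+ 1`
  -- keeps `κ` positive when `C L₁ = 0`.
  refine ⟨C, 16 * C * L₁ + 1, 2 * C * (L₂ * Real.exp (2 * C)), hC, by positivity, by positivity, ?_⟩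
  set κ := 16 * C * L₁ + 1 with hκd
  have hκ : 0 < κ := by positivity
  intro B V U hB hV hU T hT hT1 θ τ hτ hθ hθ1 hθ0
  have hdt : Differentiable ℝ θ := hθ.differentiable (by simp)
  set ζ : Thick n × ℝ → ℝ := fun p => θ p.2 * decayWeight n C κ T p with hζd
  have hζ : ContDiff ℝ ∞ ζ := (hθ.comp contDiff_snd).mul (contDiff_decayWeight n C κ T)
  have hRc : IsCompact (Metric.closedBall (0 : Thick n) 2 ×ˢ Icc τ T) :=
    (isCompact_closedBall _ _).prod isCompact_Icc
  have hζ0 : ∀ p ∉ Metric.closedBall (0 : Thick n) 2 ×ˢ Icc τ T, ζ p = 0 := fun p hp => by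
    by_cases h : p.1 ∈ Metric.closedBall (0 : Thick n) 2
    · simp only [hζd, hθ0 p.2 fun h' => hp ⟨h, h'⟩, zero_mul]
    · rw [mem_closedBall_zero_iff, not_le] at h
      simp only [hζd, decayWeight_eq_zero C κ T h.le, mul_zero]
  have hζs : tsupport ζ ⊆ Metric.closedBall 0 2 ×ˢ Icc τ T :=
    closure_minimal (fun p hp => by by_contra h; exact hp (hζ0 p h)) hRc.isClosed
  have hζc : HasCompactSupport ζ := hRc.of_isClosed_subset (isClosed_tsupport _) hζs
  have h1 := hCac B V U hB hV hU ζ τ hτ hζ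
    (hζs.trans (prod_mono le_rfl (Icc_subset_Icc le_rfl (hT1.trans one_le_two))))
  obtain ⟨DU, Tr, hW⟩ := hU
  have tU : MemLp (trunc U) 2 (halfMeasureTime n a) := memLp_trunc hW.memLp_three.1
  have iU := integrable_norm_sq_of_memLp tU
  have hint : ∀ {g : Thick n × ℝ → ℝ}, Continuous g →
      (∀ p ∉ Metric.closedBall (0 : Thick n) 2 ×ˢ Icc τ T, g p = 0) →
      Integrable (fun p => ‖trunc U p‖ ^ 2 * g p) (halfMeasureTime n a) := fun {g} hg hg0 => by
    obtain ⟨M, hM⟩ := hg.bounded_above_of_compact_support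
      (HasCompactSupport.of_support_subset_isCompact hRc fun p hp => by
        by_contra h; exact hp (hg0 p h))
    exact iU.mul_bdd (c := M) hg.aestronglyMeasurable (ae_of_all _ hM)
  have hX0 : ∀ i, ∀ p ∉ Metric.closedBall (0 : Thick n) 2 ×ˢ Icc τ T, partialX ζ i p = 0 :=
    fun i p hp => partialX_eq_zero_of_notMem (fun h => hp (hζs h)) i
  have j1 : Integrable (fun p => ‖trunc U p‖ ^ 2 * (ζ p * partialT ζ p)) (halfMeasureTime n a) :=
    hint (hζ.continuous.mul (continuous_partialT hζ)) fun p hp => by rw [hζ0 p hp, zero_mul]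
  have j2 : Integrable (fun p => ‖trunc U p‖ ^ 2 * (∑ i, partialX ζ i p ^ 2 + ζ p ^ 2))
      (halfMeasureTime n a) :=
    hint ((continuous_finsetSum _ fun i _ => (continuous_partialX hζ i).pow 2).add
      (hζ.continuous.pow 2)) fun p hp => by simp [hζ0 p hp, hX0 _ p hp]
  have j3 : Integrable (fun p => ‖trunc U p‖ ^ 2 *
      (θ p.2 * deriv θ p.2 * decayWeight n C κ T p ^ 2)) (halfMeasureTime n a) :=
    hint (((hθ.continuous.comp continuous_snd).mul ((hθ.continuous_deriv (by simp)).comp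
      continuous_snd)).mul ((contDiff_decayWeight n C κ T).continuous.pow 2)) fun p hp => by
        have : θ p.2 * decayWeight n C κ T p = 0 := hζ0 p hp
        rw [show θ p.2 * deriv θ p.2 * decayWeight n C κ T p ^ 2 = deriv θ p.2 *
          decayWeight n C κ T p * (θ p.2 * decayWeight n C κ T p) by ring, this, mul_zero]
  set Y := L₂ * (Real.exp (2 * C) * Real.exp (-(κ⁻¹ / T))) with hY
  have hY0 : 0 ≤ Y := by positivity
  have key : ∀ p, θ p.2 * deriv θ p.2 * decayWeight n C κ T p ^ 2 ≤
      ζ p * partialT ζ p - C * (∑ i, partialX ζ i p ^ 2 + ζ p ^ 2) + 2 * C * Y := fun p => by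
    obtain ⟨e1, e2⟩ := hasFDerivAt_mul_decayWeight (n := n) C κ T hdt p
    rw [hζd]
    simp only [e1, e2]
    by_cases hp : p.2 ∈ Icc τ T
    · have hσ : p.2 / T ≤ 1 := (div_le_one hT).2 hp.2
      have hσ0 : 0 ≤ p.2 / T := div_nonneg (hτ.le.trans hp.1) hT.le
      refine decay_absorption (L := L₁) hC le_rfl hT hκ (by linarith) ?_ ?_ (hi p.1)
        (exp_sq_mul_sum_fderiv_outerBump_le hC hκ hT hT1 ho hp.2) (hθ1 _)
      · exact div_nonneg (by linarith) (by positivity)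
      · gcongr
        linarith
    · rw [hθ0 _ hp]
      simp only [zero_mul, ne_eq, OfNat.ofNat_ne_zero, not_false_eq_true, zero_pow,
        Finset.sum_const_zero, add_zero, mul_zero, sub_zero, zero_add]
      positivity
  have j4 : Integrable (fun p => ‖trunc U p‖ ^ 2 * (ζ p * partialT ζ p) - C * (‖trunc U p‖ ^ 2 *
      (∑ i, partialX ζ i p ^ 2 + ζ p ^ 2))) (halfMeasureTime n a) := j1.sub (j2.const_mul C)
  rw [← integral_trunc_eq_integral_weightedMass (k := fun t => θ t * deriv θ t)
    (fun t ht => by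
      simp only [hθ0 t fun h => ht ⟨hτ.trans_le h.1, (h.2.trans hT1).trans_lt (by norm_num)⟩,
        zero_mul]) j3]
  calc ∫ p, ‖trunc U p‖ ^ 2 * (θ p.2 * deriv θ p.2 * decayWeight n C κ T p ^ 2)
        ∂(halfMeasureTime n a)
      ≤ ∫ p, (‖trunc U p‖ ^ 2 * (ζ p * partialT ζ p) - C * (‖trunc U p‖ ^ 2 *
          (∑ i, partialX ζ i p ^ 2 + ζ p ^ 2)) + 2 * C * Y * ‖trunc U p‖ ^ 2)
          ∂(halfMeasureTime n a) := by
        refine integral_mono j3 (j4.add (iU.const_mul _)) fun p => ?_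
        have := mul_le_mul_of_nonneg_left (key p) (sq_nonneg ‖trunc U p‖)
        linear_combination this
    _ = (∫ p, ‖trunc U p‖ ^ 2 * (ζ p * partialT ζ p) ∂(halfMeasureTime n a)) - C *
          (∫ p, ‖trunc U p‖ ^ 2 * (∑ i, partialX ζ i p ^ 2 + ζ p ^ 2) ∂(halfMeasureTime n a)) +
          2 * C * Y * ∫ p, ‖trunc U p‖ ^ 2 ∂(halfMeasureTime n a) := by
        rw [integral_add j4 (iU.const_mul _),
          integral_sub j1 (j2.const_mul C), integral_const_mul, integral_const_mul]
    _ ≤ 2 * C * Y * ∫ p, ‖trunc U p‖ ^ 2 ∂(halfMeasureTime n a) := by linarith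
    _ ≤ 2 * C * Y * ∫ p, ‖U p‖ ^ 2 ∂(weightMeasureTime n a 4 0 16) := by
        have := integral_trunc_sq_le hW.memLp
        gcongr
    _ = _ := by rw [hY]; ring

end Decay

/-! ### Continuity in time of the weighted mass -/

section Slices

variable {n : ℕ} {a : ℝ}

/-- The change of `q U` between two times is split into `q` times the change of `U`, small by
continuity in `L²`, and the change of `q` times a fixed slice of `U`, small by dominated
convergence. -/
lemma IsWeakSolutionWith.continuousOn_weightedMass {B : Grad n →L[ℝ] Val n}
    {V : Thin n × ℝ → Val n →L[ℝ] Val n} {U : Thick n × ℝ → Val n} {DU : Thick n × ℝ → Grad n}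
    {Tr : Thin n × ℝ → Val n} (hU : IsWeakSolutionWith a B V U DU Tr) {q : Thick n × ℝ → ℝ}
    (hq : Continuous q) {T M : ℝ} (hT : T < 16) (hM : ∀ X, ∀ t ∈ Icc 0 T, |q (X, t)| ≤ M) :
    ContinuousOn (weightedMass n a q U) (Icc 0 T) := by
  rw [continuousOn_iff_continuous_domRestrict]
  refine continuous_iff_seqContinuous.2 fun x t hx => ?_
  have hI : ∀ t : Icc 0 T, (t : ℝ) ∈ Ico (0 : ℝ) 16 := fun t => ⟨t.2.1, t.2.2.trans_lt hT⟩
  have hx' : Tendsto (fun j => (x j : ℝ)) atTop (𝓝 t) := (continuous_subtype_val.tendsto t).comp hx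
  have hUm : ∀ t : Icc 0 T, MemLp (fun X => U (X, (t : ℝ))) 2 (weightMeasure n a 3) := fun t =>
    hU.memLp_slice 3 (by norm_num) (by norm_num) t (hI t)
  have hqt : ∀ t : ℝ, Continuous fun X : Thick n => q (X, t) := fun t =>
    hq.comp (continuous_id.prodMk continuous_const)
  have hm : ∀ t : Icc 0 T, MemLp (fun X => q (X, (t : ℝ)) • U (X, (t : ℝ))) 2
      (weightMeasure n a 3) := fun t =>
    memLp_smul_of_bdd (hUm t) (hqt t).aestronglyMeasurable fun X => hM X t t.2
  have h1 : Tendsto (fun j => ∫ X, ‖U (X, (x j : ℝ)) - U (X, (t : ℝ))‖ ^ 2 ∂(weightMeasure n a 3))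
      atTop (𝓝 0) :=
    (hU.continuous_time 3 (by norm_num) (by norm_num) t (hI t)).comp
      (tendsto_nhdsWithin_iff.2 ⟨hx', Eventually.of_forall fun j => hI (x j)⟩)
  have hU2 := integrable_norm_sq_of_memLp (hUm t)
  have hqd : ∀ j X, ‖q (X, (x j : ℝ)) - q (X, (t : ℝ))‖ ≤ 2 * M := fun j X =>
    (norm_sub_le _ _).trans (by
      have h1 := hM X _ (x j).2
      have h2 := hM X _ t.2
      rw [Real.norm_eq_abs, Real.norm_eq_abs]; linarith)
  have h2 : Tendsto (fun j => ∫ X, (q (X, (x j : ℝ)) - q (X, (t : ℝ))) ^ 2 * ‖U (X, (t : ℝ))‖ ^ 2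
      ∂(weightMeasure n a 3)) atTop (𝓝 (∫ _, (0 : ℝ) ∂(weightMeasure n a 3))) := by
    refine tendsto_integral_of_dominated_convergence
      (fun X => (2 * M) ^ 2 * ‖U (X, (t : ℝ))‖ ^ 2) (fun j => ?_) (hU2.const_mul _)
      (fun j => ae_of_all _ fun X => ?_) (ae_of_all _ fun X => ?_)
    · exact (((hqt _).sub (hqt _)).pow 2).aestronglyMeasurable.mul hU2.1
    · rw [norm_mul, norm_pow, norm_pow, norm_norm]
      gcongr
      exact hqd j X
    · have h3 : Tendsto (fun j => q (X, (x j : ℝ))) atTop (𝓝 (q (X, (t : ℝ)))) :=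
        (hq.tendsto _).comp (tendsto_const_nhds.prodMk_nhds hx')
      have h4 := ((h3.sub_const (q (X, (t : ℝ)))).pow 2).mul_const (‖U (X, (t : ℝ))‖ ^ 2)
      simpa using h4
  rw [integral_zero] at h2
  have h3 : Tendsto (fun j => M ^ 2 * (2 * ∫ X, ‖U (X, (x j : ℝ)) - U (X, (t : ℝ))‖ ^ 2
      ∂(weightMeasure n a 3)) + 2 * ∫ X, (q (X, (x j : ℝ)) - q (X, (t : ℝ))) ^ 2 *
        ‖U (X, (t : ℝ))‖ ^ 2 ∂(weightMeasure n a 3)) atTop (𝓝 0) := by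
    simpa using ((h1.const_mul 2).const_mul (M ^ 2)).add (h2.const_mul 2)
  refine tendsto_integral_norm_sq (fun j => hm (x j)) (hm t)
    (tendsto_eLpNorm_of_lintegral ENNReal.one_ne_top h3 fun j => ?_)
  have hd := (hUm (x j)).sub (hUm t)
  have hd2 : Integrable (fun X => ‖U (X, (x j : ℝ)) - U (X, (t : ℝ))‖ ^ 2)
      (weightMeasure n a 3) := integrable_norm_sq_of_memLp hd
  rw [one_mul, lintegral_enorm_sq_eq_ofReal ((hm (x j)).sub (hm t))]
  refine ENNReal.ofReal_le_ofReal ?_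
  have i2 : Integrable (fun X => (q (X, (x j : ℝ)) - q (X, (t : ℝ))) ^ 2 * ‖U (X, (t : ℝ))‖ ^ 2)
      (weightMeasure n a 3) := by
    refine hU2.bdd_mul (c := (2 * M) ^ 2) (((hqt _).sub (hqt _)).pow 2).aestronglyMeasurable
      (ae_of_all _ fun X => ?_)
    rw [norm_pow]
    exact pow_le_pow_left₀ (norm_nonneg _) (hqd j X) 2
  rw [← integral_const_mul, ← integral_const_mul, ← integral_const_mul,
    ← integral_add ((hd2.const_mul 2).const_mul _) (i2.const_mul 2)]
  refine integral_mono (integrable_norm_sq_of_memLp ((hm (x j)).sub (hm t)))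
    (((hd2.const_mul 2).const_mul _).add (i2.const_mul 2)) fun X => ?_
  simp only [Pi.sub_apply]
  have e : q (X, (x j : ℝ)) • U (X, (x j : ℝ)) - q (X, (t : ℝ)) • U (X, (t : ℝ)) =
      q (X, (x j : ℝ)) • (U (X, (x j : ℝ)) - U (X, (t : ℝ))) +
        (q (X, (x j : ℝ)) - q (X, (t : ℝ))) • U (X, (t : ℝ)) := by module
  have hMx := hM X _ (x j).2
  calc _ ≤ (‖q (X, (x j : ℝ)) • (U (X, (x j : ℝ)) - U (X, (t : ℝ)))‖ +
        ‖(q (X, (x j : ℝ)) - q (X, (t : ℝ))) • U (X, (t : ℝ))‖) ^ 2 := by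
        rw [e]; gcongr; exact norm_add_le _ _
    _ ≤ 2 * (‖q (X, (x j : ℝ)) • (U (X, (x j : ℝ)) - U (X, (t : ℝ)))‖ ^ 2 +
        ‖(q (X, (x j : ℝ)) - q (X, (t : ℝ))) • U (X, (t : ℝ))‖ ^ 2) := add_sq_le
    _ = |q (X, (x j : ℝ))| ^ 2 * (2 * ‖U (X, (x j : ℝ)) - U (X, (t : ℝ))‖ ^ 2) +
        2 * ((q (X, (x j : ℝ)) - q (X, (t : ℝ))) ^ 2 * ‖U (X, (t : ℝ))‖ ^ 2) := by
        rw [norm_smul, norm_smul, mul_pow, mul_pow, Real.norm_eq_abs, Real.norm_eq_abs,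
          sq_abs (q (X, (x j : ℝ)) - q (X, (t : ℝ)))]
        ring
    _ ≤ _ := by gcongr

end Slices

/-! ### From integrals over time to pointwise comparison -/

section Plateau

/-- For `θ` rising from 0 to 1 just after `t₁` and falling back to 0 just before `t₂`, `θ θ' =
(θ²)'/2` acts as half a unit mass at `t₁` minus half a unit mass at `t₂`. Hence `(M t₁ - M t₂)/2 ≤
E` in the limit of steep ramps. -/
lemma le_add_of_forall_plateau {M : ℝ → ℝ} {T E : ℝ} (hM : ContinuousOn M (Icc 0 T))
    (hp : ∀ (θ : ℝ → ℝ) (τ : ℝ), 0 < τ → ContDiff ℝ ∞ θ → (∀ t, θ t ^ 2 ≤ 1) →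
      (∀ t ∉ Icc τ T, θ t = 0) → ∫ t, θ t * deriv θ t * M t ≤ E)
    {t₁ t₂ : ℝ} (h0 : 0 < t₁) (h12 : t₁ < t₂) (h2 : t₂ ≤ T) : M t₁ ≤ M t₂ + 2 * E := by
  refine le_of_forall_pos_le_add fun ε hε => ?_
  obtain ⟨δ₁, hδ₁, hd₁⟩ := Metric.continuousWithinAt_iff.1 (hM t₁ ⟨h0.le, h12.le.trans h2⟩)
    (ε / 2) (by positivity)
  obtain ⟨δ₂, hδ₂, hd₂⟩ := Metric.continuousWithinAt_iff.1 (hM t₂ ⟨(h0.trans h12).le, h2⟩)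
    (ε / 2) (by positivity)
  -- The first two bounds keep `M` within `ε/2` of its endpoint values on the ramps; the last makes
  -- the ramps disjoint.
  obtain ⟨h, hh, hl⟩ : ∃ h, 0 < h ∧ h < δ₁ ∧ h < δ₂ ∧ 2 * h < t₂ - t₁ := by
    refine ⟨min (min δ₁ δ₂) (t₂ - t₁) / 3, ?_, ?_, ?_, ?_⟩
    · have := sub_pos.2 h12
      positivity
    all_goals
      have h1 := min_le_left (min δ₁ δ₂) (t₂ - t₁)
      have h3 := min_le_right (min δ₁ δ₂) (t₂ - t₁)
      have h4 := min_le_left δ₁ δ₂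
      have h5 := min_le_right δ₁ δ₂
      linarith
  obtain ⟨hl1, hl2, hl3⟩ := hl
  set g₁ : ℝ → ℝ := fun t => Real.smoothTransition ((t - t₁) / h) with hg₁
  set g₂ : ℝ → ℝ := fun t => Real.smoothTransition ((t₂ - t) / h) with hg₂
  have c₁ : ContDiff ℝ ∞ g₁ := Real.smoothTransition.contDiff.comp (by fun_prop)
  have c₂ : ContDiff ℝ ∞ g₂ := Real.smoothTransition.contDiff.comp (by fun_prop)
  have d₁ : ∀ t, HasDerivAt g₁ (deriv g₁ t) t := fun t =>
    (c₁.differentiable (by simp) t).hasDerivAt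
  have d₂ : ∀ t, HasDerivAt g₂ (deriv g₂ t) t := fun t =>
    (c₂.differentiable (by simp) t).hasDerivAt
  have z₁ : ∀ t, 0 ≤ g₁ t := fun t => Real.smoothTransition.nonneg _
  have z₂ : ∀ t, 0 ≤ g₂ t := fun t => Real.smoothTransition.nonneg _
  have o₁ : ∀ t, g₁ t ≤ 1 := fun t => Real.smoothTransition.le_one _
  have o₂ : ∀ t, g₂ t ≤ 1 := fun t => Real.smoothTransition.le_one _
  have p₁ : ∀ t, 0 ≤ deriv g₁ t := fun t => Monotone.deriv_nonneg fun x y hxy =>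
    Real.smoothTransition.monotone (by gcongr)
  have p₂ : ∀ t, deriv g₂ t ≤ 0 := fun t => Antitone.deriv_nonpos fun x y hxy =>
    Real.smoothTransition.monotone (by gcongr)
  have e₁ : ∀ t, t₁ + h ≤ t → g₁ t = 1 := fun t ht =>
    Real.smoothTransition.one_of_one_le ((one_le_div hh).2 (by linarith))
  have e₂ : ∀ t, t ≤ t₂ - h → g₂ t = 1 := fun t ht =>
    Real.smoothTransition.one_of_one_le ((one_le_div hh).2 (by linarith))
  have f₁ : ∀ t, t₁ + h < t → deriv g₁ t = 0 := fun t ht => by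
    have : g₁ =ᶠ[𝓝 t] fun _ => 1 := by
      filter_upwards [lt_mem_nhds ht] with s hs using e₁ s hs.le
    rw [this.deriv_eq, deriv_const]
  have f₂ : ∀ t, t < t₂ - h → deriv g₂ t = 0 := fun t ht => by
    have : g₂ =ᶠ[𝓝 t] fun _ => 1 := by
      filter_upwards [gt_mem_nhds ht] with s hs using e₂ s hs.le
    rw [this.deriv_eq, deriv_const]
  have n₁ : ∀ t ≤ t₁, g₁ t = 0 := fun t ht =>
    Real.smoothTransition.zero_of_nonpos (div_nonpos_of_nonpos_of_nonneg (by linarith) hh.le)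
  have n₂ : ∀ t, t₂ ≤ t → g₂ t = 0 := fun t ht =>
    Real.smoothTransition.zero_of_nonpos (div_nonpos_of_nonpos_of_nonneg (by linarith) hh.le)
  have hz : ∀ t ∉ Ioc t₁ t₂, g₁ t * g₂ t = 0 := fun t ht => by
    rcases le_or_gt t t₁ with h' | h'
    · rw [n₁ t h', zero_mul]
    · rw [n₂ t (le_of_not_ge fun h'' => ht ⟨h', h''⟩), mul_zero]
  have key := hp (fun t => g₁ t * g₂ t) t₁ h0 (c₁.mul c₂)
    (fun t => pow_le_one₀ (mul_nonneg (z₁ t) (z₂ t)) (mul_le_one₀ (o₁ t) (z₂ t) (o₂ t)))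
    (fun t ht => hz t fun h' => ht ⟨h'.1.le, h'.2.trans h2⟩)
  have hd : ∀ t, deriv (fun t => g₁ t * g₂ t) t = deriv g₁ t * g₂ t + g₁ t * deriv g₂ t := fun t =>
    ((d₁ t).mul (d₂ t)).deriv
  simp only [hd] at key
  rw [← setIntegral_eq_integral_of_forall_compl_eq_zero (s := Ioc t₁ t₂)
    (fun t ht => by rw [hz t ht]; ring), ← intervalIntegral.integral_of_le h12.le] at key
  have k₁ : Continuous (deriv g₁) := c₁.continuous_deriv (by simp)
  have k₂ : Continuous (deriv g₂) := c₂.continuous_deriv (by simp)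
  have l₁ : Continuous g₁ := c₁.continuous
  have l₂ : Continuous g₂ := c₂.continuous
  have hM' : ContinuousOn M (uIcc t₁ t₂) := hM.mono (by
    rw [uIcc_of_le h12.le]; exact Icc_subset_Icc h0.le h2)
  have i₁ : IntervalIntegrable (fun t => g₁ t * deriv g₁ t) volume t₁ t₂ :=
    (l₁.mul k₁).intervalIntegrable ..
  have q₁ : ∫ t in t₁..t₂, g₁ t * deriv g₁ t = 1 / 2 := by
    have hd : ∀ t, HasDerivAt (fun t => g₁ t ^ 2 / 2) (g₁ t * deriv g₁ t) t := fun t => by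
      refine (((d₁ t).fun_pow 2).div_const 2).congr_deriv ?_
      ring
    rw [intervalIntegral.integral_eq_sub_of_hasDerivAt (fun t _ => hd t)
      i₁, n₁ t₁ le_rfl, e₁ t₂ (by linarith)]
    norm_num
  have i₂ : IntervalIntegrable (fun t => g₂ t * deriv g₂ t) volume t₁ t₂ :=
    (l₂.mul k₂).intervalIntegrable ..
  have q₂ : ∫ t in t₁..t₂, g₂ t * deriv g₂ t = -(1 / 2) := by
    have hd : ∀ t, HasDerivAt (fun t => g₂ t ^ 2 / 2) (g₂ t * deriv g₂ t) t := fun t => by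
      refine (((d₂ t).fun_pow 2).div_const 2).congr_deriv ?_
      ring
    rw [intervalIntegral.integral_eq_sub_of_hasDerivAt (fun t _ => hd t)
      i₂, n₂ t₂ le_rfl, e₂ t₁ (by linarith)]
    norm_num
  have hlow : ∫ t in t₁..t₂, ((M t₁ - ε / 2) * (g₁ t * deriv g₁ t) +
      (M t₂ + ε / 2) * (g₂ t * deriv g₂ t)) ≤
      ∫ t in t₁..t₂, g₁ t * g₂ t * (deriv g₁ t * g₂ t + g₁ t * deriv g₂ t) * M t := by
    refine intervalIntegral.integral_mono_on h12.le ((i₁.const_mul _).add (i₂.const_mul _))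
      (ContinuousOn.intervalIntegrable ((by fun_prop : Continuous fun t => g₁ t * g₂ t *
        (deriv g₁ t * g₂ t + g₁ t * deriv g₂ t)).continuousOn.mul hM')) fun t ht => ?_
    have htT : t ∈ Icc 0 T := ⟨h0.le.trans ht.1, ht.2.trans h2⟩
    -- At each time at most one ramp has nonzero derivative, and the other factor is then 1. On the
    -- second ramp the derivative is nonpositive, so an upper bound on `M` is what is needed there.
    rcases le_or_gt t (t₁ + h) with h' | h'
    · rw [f₂ t (by linarith), e₂ t (by linarith)]
      have h3 := hd₁ htT (by rw [Real.dist_eq, abs_lt]; constructor <;> linarith [ht.1])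
      rw [Real.dist_eq, abs_lt] at h3
      nlinarith [mul_nonneg (z₁ t) (p₁ t)]
    · rw [f₁ t h', e₁ t h'.le]
      rcases lt_or_ge t (t₂ - h) with h'' | h''
      · simp [f₂ t h'']
      · have h3 := hd₂ htT (by rw [Real.dist_eq, abs_lt]; constructor <;> linarith [ht.2])
        rw [Real.dist_eq, abs_lt] at h3
        nlinarith [mul_nonneg (z₂ t) (neg_nonneg.2 (p₂ t))]
  rw [intervalIntegral.integral_add (i₁.const_mul _) (i₂.const_mul _),
    intervalIntegral.integral_const_mul, intervalIntegral.integral_const_mul, q₁, q₂] at hlow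
  linarith

end Plateau

/-! ### Comparison of the masses of two time slices -/

section Mass

variable {n : ℕ} {a : ℝ}

lemma mass_nonneg (U : Thick n × ℝ → Val n) (r t : ℝ) : 0 ≤ mass a U r t :=
  integral_nonneg fun _ => sq_nonneg _

lemma mass_le_weightedMass {U : Thick n × ℝ → Val n} {q : Thick n × ℝ → ℝ}
    (hq : ∀ X, ‖X‖ ≤ 1 → q (X, 0) = 1)
    (hm : MemLp (fun X => q (X, 0) • U (X, 0)) 2 (weightMeasure n a 3)) :
    mass a U 1 0 ≤ weightedMass n a q U 0 := by
  have h1 := integrable_norm_sq_of_memLp hm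
  rw [weightMeasure_eq] at h1
  rw [mass, weightedMass, weightMeasure_eq, weightMeasure_eq]
  have h2 : ∫ X in Metric.ball 0 1, ‖U (X, 0)‖ ^ 2 ∂(halfMeasure n a) =
      ∫ X in Metric.ball 0 1, ‖q (X, 0) • U (X, 0)‖ ^ 2 ∂(halfMeasure n a) :=
    setIntegral_congr_fun Metric.isOpen_ball.measurableSet fun X hX => by
      simp only [hq X (mem_ball_zero_iff.1 hX).le, one_smul]
  rw [h2]
  exact setIntegral_mono_set h1 (ae_of_all _ fun p => sq_nonneg _)
    (Metric.ball_subset_ball (by norm_num)).eventuallyLE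

lemma weightedMass_le_mass {U : Thick n × ℝ → Val n} {q : Thick n × ℝ → ℝ} {M t : ℝ}
    (hq : ∀ X, |q (X, t)| ≤ M) (hq0 : ∀ X, 2 ≤ ‖X‖ → q (X, t) = 0)
    (hqm : Continuous q) (hm : MemLp (fun X => U (X, t)) 2 (weightMeasure n a 2)) :
    weightedMass n a q U t ≤ M ^ 2 * mass a U 2 t := by
  have h1 : weightedMass n a q U t = ∫ X, ‖q (X, t) • U (X, t)‖ ^ 2 ∂(weightMeasure n a 2) := by
    rw [weightedMass, weightMeasure_eq, weightMeasure_eq]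
    refine (setIntegral_eq_of_subset_of_forall_sdiff_eq_zero Metric.isOpen_ball.measurableSet
      (Metric.ball_subset_ball (by norm_num)) fun X hX => ?_)
    have : 2 ≤ ‖X‖ := by simpa using hX.2
    simp [hq0 X this]
  rw [h1, mass, ← integral_const_mul]
  refine integral_mono (integrable_norm_sq_of_memLp (memLp_smul_of_bdd hm
    (hqm.comp (continuous_id.prodMk continuous_const)).aestronglyMeasurable hq))
    ((integrable_norm_sq_of_memLp hm).const_mul _) fun X => ?_
  simp only
  rw [norm_smul, mul_pow]
  gcongr
  exact hq X

/-- The weight is 1 on `𝔹₁` at time 0, is at most `e^μ` up to time `T`, and vanishes outside `𝔹₂`,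
so almost monotonicity of the weighted mass compares the two unweighted masses. -/
theorem exists_mass_bound (n : ℕ) {a : ℝ} (ha : -1 < a) (ha' : a < 1) (β K : ℝ) :
    ∃ c A : ℝ, 0 < c ∧ 0 < A ∧
      ∀ (B : Grad n →L[ℝ] Val n) (V : Thin n × ℝ → Val n →L[ℝ] Val n)
      (U : Thick n × ℝ → Val n), ‖B‖ ≤ β → C1NormLE V K → IsWeakSolution a B V U →
      ∀ T : ℝ, 0 < T → T ≤ 1 → ∀ t ∈ Icc 0 T, mass a U 1 0 ≤ A * mass a U 2 t +
        A * Real.exp (-(c / T)) * ∫ p, ‖U p‖ ^ 2 ∂(weightMeasureTime n a 4 0 16) := by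
  obtain ⟨μ, κ, D, hμ, hκ, hD, H⟩ := exists_weighted_decay n ha ha' β K
  refine ⟨κ⁻¹, Real.exp μ ^ 2 + 2 * D, by positivity, by positivity, ?_⟩
  intro B V U hB hV hU T hT hT1 t ht
  have H' := H B V U hB hV hU T hT hT1
  obtain ⟨DU, Tr, hW⟩ := hU
  set q := decayWeight n μ κ T with hq
  have hqc : Continuous q := (contDiff_decayWeight n μ κ T).continuous
  have hqM : ∀ X, ∀ t ∈ Icc 0 T, |q (X, t)| ≤ Real.exp μ := fun X t ht => by
    rw [abs_of_nonneg (decayWeight_nonneg μ κ T _)]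
    exact decayWeight_le hμ hκ hT hT1 ht.2
  have hM := hW.continuousOn_weightedMass hqc (hT1.trans_lt (by norm_num)) hqM
  set I := ∫ p, ‖U p‖ ^ 2 ∂(weightMeasureTime n a 4 0 16)
  have hI : 0 ≤ I := integral_nonneg fun _ => sq_nonneg _
  have h0 : weightedMass n a q U 0 ≤
      weightedMass n a q U t + 2 * (D * Real.exp (-(κ⁻¹ / T)) * I) := by
    rcases ht.1.eq_or_lt with h | h
    · rw [← h]
      have : 0 ≤ D * Real.exp (-(κ⁻¹ / T)) * I := by positivity
      linarith
    -- The plateau argument needs a positive initial time because cutoffs must vanish near time 0;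
    -- the value at 0 is reached by continuity.
    · have h1 : Tendsto (weightedMass n a q U) (𝓝[>] 0) (𝓝 (weightedMass n a q U 0)) := by
        rw [← nhdsWithin_Ioo_eq_nhdsGT h]
        exact (hM 0 ⟨le_rfl, hT.le⟩).mono_left (nhdsWithin_mono _
          (Ioo_subset_Icc_self.trans (Icc_subset_Icc le_rfl ht.2)))
      refine le_of_tendsto h1 ?_
      filter_upwards [Ioo_mem_nhdsGT h] with s hs
      exact le_add_of_forall_plateau hM H' hs.1 hs.2 ht.2
  have hT16 : T < 16 := hT1.trans_lt (by norm_num)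
  have h1 := mass_le_weightedMass (q := q) (fun X hX => decayWeight_eq_one μ κ T hX)
    (memLp_smul_of_bdd (hW.memLp_slice 3 (by norm_num) (by norm_num) 0 (by simp))
      (hqc.comp (continuous_id.prodMk continuous_const)).aestronglyMeasurable
      fun X => hqM X 0 ⟨le_rfl, hT.le⟩)
  have h2 := weightedMass_le_mass (fun X => hqM X t ht)
    (fun X hX => decayWeight_eq_zero μ κ T (p := (X, t)) hX) hqc
    (hW.memLp_slice 2 (by norm_num) (by norm_num) t ⟨ht.1, ht.2.trans_lt hT16⟩)
  have h3 : 0 ≤ 2 * D * mass a U 2 t := mul_nonneg (by positivity) (mass_nonneg _ _ _)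
  have h4 : 0 ≤ Real.exp μ ^ 2 * Real.exp (-(κ⁻¹ / T)) * I := by positivity
  linear_combination h0 + h1 + h2 + h3 + h4

lemma integral_mass_le {U : Thick n × ℝ → Val n} (hU : MemLp U 2 (weightMeasureTime n a 4 0 16)) :
    IntegrableOn (fun t => mass a U 2 t) (Ioo 0 1) ∧ ∫ t in Ioo 0 1, mass a U 2 t ≤
      ∫ p, ‖U p‖ ^ 2 ∂(weightMeasureTime n a 4 0 16) := by
  have hs : Metric.ball (0 : Thick n) 2 ×ˢ Ioo (0 : ℝ) 1 ⊆ Metric.ball 0 4 ×ˢ Ioo 0 16 :=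
    prod_mono (Metric.ball_subset_ball (by norm_num)) (Ioo_subset_Ioo le_rfl (by norm_num))
  have h1 := integrable_norm_sq_of_memLp hU
  rw [weightMeasureTime_eq] at h1
  have h2 : Integrable (fun p => ‖U p‖ ^ 2) (weightMeasureTime n a 2 0 1) := by
    rw [weightMeasureTime_eq]
    exact h1.mono_measure (Measure.restrict_mono hs le_rfl)
  have h3 : ∫ p, ‖U p‖ ^ 2 ∂(weightMeasureTime n a 2 0 1) ≤
      ∫ p, ‖U p‖ ^ 2 ∂(weightMeasureTime n a 4 0 16) := by
    rw [weightMeasureTime_eq, weightMeasureTime_eq]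
    exact setIntegral_mono_set h1 (ae_of_all _ fun p => sq_nonneg _) hs.eventuallyLE
  rw [weightMeasureTime, weightMeasure_eq] at h2
  refine ⟨?_, le_of_eq_of_le ?_ h3⟩
  · have := h2.integral_prod_right
    simp only [mass, weightMeasure_eq]
    exact this
  · rw [weightMeasureTime, weightMeasure_eq, integral_prod_symm _ h2]
    simp only [mass, weightMeasure_eq]

end Mass

end

/-! ### Choice of `N` and of the time scale -/

theorem lemma6p1 (n : ℕ) (hn : 1 ≤ n) (a : ℝ) (ha : -1 < a) (ha' : a < 1) (β K : ℝ) :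
    ∃ N : ℝ, 2 < N ∧
      ∀ (B : Grad n →L[ℝ] Val n) (V : Thin n × ℝ → Val n →L[ℝ] Val n) (U : Thick n × ℝ → Val n),
        ‖B‖ ≤ β → C1NormLE V K → IsWeakSolution a B V U → 0 < mass a U 1 0 →
          1 ≤ N * Real.log (N * massRatio a U) ∧
          ∀ t : ℝ, 0 ≤ t → t ≤ 1 / (N * Real.log (N * massRatio a U)) →
            mass a U 1 0 ≤ N * mass a U 2 t := by
  obtain ⟨c, A, hc, hA, H⟩ := exists_mass_bound n ha ha' β K
  have hc' : 0 < c⁻¹ := inv_pos.2 hc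
  -- `3` ensures `N > 2`; `6A` ensures both `Nθ ≥ 3` and `A/N ≤ 1/2`; `c⁻¹` ensures `cN ≥ 1`.
  refine ⟨3 + 6 * A + c⁻¹, by linarith, fun B V U hB hV hU hm => ?_⟩
  set N := 3 + 6 * A + c⁻¹ with hN
  have hN0 : 0 < N := by positivity
  have H' := H B V U hB hV hU
  obtain ⟨DU, Tr, hW⟩ := hU
  obtain ⟨i1, i2⟩ := integral_mass_le hW.memLp
  rw [massRatio]
  set m := mass a U 1 0
  set I := ∫ p, ‖U p‖ ^ 2 ∂(weightMeasureTime n a 4 0 16)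
  have hI : 0 ≤ I := integral_nonneg fun _ => sq_nonneg _
  have hconst : ∀ x : ℝ, IntegrableOn (fun _ => x) (Ioo (0 : ℝ) 1) := fun x =>
    integrableOn_const (by simp)
  -- The mass bound with `T = 1`, integrated over `0 < t < 1`: this is the lower bound on `θ`.
  have h1 : m ≤ 2 * A * I := by
    have h2 : ∫ _ in Ioo (0 : ℝ) 1, m ≤ ∫ t in Ioo (0 : ℝ) 1, (A * mass a U 2 t + A * I) := by
      refine setIntegral_mono_on (hconst m) ((i1.const_mul A).add (hconst _)) measurableSet_Ioo
        fun t ht => (H' 1 one_pos le_rfl t ⟨ht.1.le, ht.2.le⟩).trans ?_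
      have h3 : Real.exp (-(c / 1)) ≤ 1 := Real.exp_le_one_iff.2 (by simp [hc.le])
      gcongr
      exact mul_le_of_le_one_right hA.le h3
    rw [integral_add (i1.const_mul A) (hconst _), integral_const_mul] at h2
    simp only [integral_const, measureReal_restrict_apply_univ, Real.volume_real_Ioo, sub_zero,
      zero_le_one, sup_of_le_left, one_smul] at h2
    have := mul_le_mul_of_nonneg_left i2 hA.le
    linarith
  have hθ : 3 ≤ N * (I / m) := by
    rw [mul_div_assoc', le_div_iff₀ hm]
    have : 0 ≤ (3 + c⁻¹) * I := by positivity
    linear_combination 3 * h1 + this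
  have hθ0 : 0 < N * (I / m) := by linarith
  set l := Real.log (N * (I / m)) with hl
  have hl1 : 1 ≤ l := by
    rw [hl, Real.le_log_iff_exp_le hθ0]
    -- `e < 3 ≤ Nθ`.
    exact (Real.exp_one_lt_d9.le.trans (by norm_num)).trans hθ
  have hNl : 1 ≤ N * l := one_le_mul_of_one_le_of_one_le (by linarith) hl1
  refine ⟨hNl, fun t ht ht' => ?_⟩
  -- The largest allowed time is itself taken as `T`; then `e^{-c/T} = (Nθ)^{-cN} ≤ (Nθ)⁻¹`.
  have h2 := H' (1 / (N * l)) (by positivity) ((div_le_one (by positivity)).2 hNl) t ⟨ht, ht'⟩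
  have h3 : Real.exp (-(c / (1 / (N * l)))) ≤ (N * (I / m))⁻¹ := by
    rw [← Real.exp_log hθ0, ← hl, ← Real.exp_neg, Real.exp_le_exp, neg_le_neg_iff]
    have h4 : 1 ≤ c * N := by
      have : c * c⁻¹ = 1 := mul_inv_cancel₀ hc.ne'
      nlinarith
    rw [div_div_eq_mul_div, div_one, ← mul_assoc]
    exact le_mul_of_one_le_left (by linarith) h4
  have hI0 : 0 < I := by
    rcases hI.eq_or_lt with h | h
    · rw [← h] at h1; linarith
    · exact h
  have h4 : A * Real.exp (-(c / (1 / (N * l)))) * I ≤ m / 2 := by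
    calc _ ≤ A * (N * (I / m))⁻¹ * I := by gcongr
      _ = A / N * m := by field_simp
      _ ≤ 1 / 2 * m := by
        refine mul_le_mul_of_nonneg_right ?_ hm.le
        rw [div_le_div_iff₀ hN0 two_pos]
        linarith
      _ = m / 2 := by ring
  have h5 : 0 ≤ (3 + 4 * A + c⁻¹) * mass a U 2 t :=
    mul_nonneg (by positivity) (mass_nonneg _ _ _)
  -- Absorbing half of `m` leaves `m ≤ 2A` times the mass at time `t`, and `2A ≤ N`.
  linear_combination 2 * h2 + 2 * h4 + h5
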